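/- **Setting.** Let $X$ be a smooth 3-manifold (the space of dust worldlines) and let $g$ be a Lorentzian metric on an open subset of $\mathbb R_t\times X$ whose slices $t=\mathrm{const}$ are spacelike and for which the dust four-velocity $u=\partial_t$ is a unit timelike vector. Let $h(t)$ be the induced metric of the slices and $N$ the shift vector, $h_{ij}N^j=g_{0i}$. A comoving domain is a region $C\subset X$ with connected interior that is the closure of its interior and whose boundary is a smoothly embedded sphere $\xi:S^2\to X$. Put $q(t)=\xi^*h(t)$. The domain is *admissible* at time $t$ if its boundary at time $t$ lies in the spacetime and $q(t)$ has positive scalar curvature. Let $f:S^2\to\mathbf E^3$ be a smooth isometric embedding of $(S^2,q(t))$, let $V_0$ be the Euclidean volume enclosed by $f(S^2)$, and let $n$ be its outward unit normal. The coarse-grained velocity gradient (with respect to $f$) is the matrix $\langle Z_{ab}\rangle$ with $$\langle Z_{(ab)}\rangle=\frac1{V_0}\int v_{(a}n_{b)}\,d\sigma,\qquad \langle Z_{[ab]}\rangle=\frac1{V_0}\int g(N)_{[a}n_{b]}\,d\sigma ,$$ the integrals being over $f(S^2)$. Here $v:S^2\to\mathbf E^3$ is any smooth solution of $\langle dv(Y),df(Y')\rangle+\langle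 df(Y),dv(Y')\rangle=\dot q(t)(Y,Y')$, and $g(N)$ is the push-forward of the shift along the boundary: the part of $N$ tangent to the boundary is pushed by $df$, and the component of $N$ along the outward normal is kept. The coarse-grained expansion, shear and vorticity are the trace, the symmetric trace-free part and the antisymmetric part of $\langle Z_{ab}\rangle$. The local quantities are $Z_{\mu\nu}=\nabla_\nu u_\mu$, $\theta=g^{\mu\nu}Z_{\mu\nu}$, $\sigma_{\mu\nu}=Z_{(\mu\nu)}-\frac13\theta(g_{\mu\nu}+u_\mu u_\nu)$ and $\omega_{\mu\nu}=Z_{[\mu\nu]}$. **Theorem.** In each of the following cases let $t$ be a time at which the comoving domain $C$ is admissible, and let $f$ be any smooth isometric embedding of its boundary at time $t$. Then the coarse-grained velocity gradient exists, is unique (it does not depend on the choice of $v$), and has the value stated. 1. (FLRW.) Let $g=-dt^2+a(t)^2\gamma$ on $I\times X$, with $I\subset\mathbb R$ open, $a>0$ smooth on $I$ (in particular $a$ may be the scale factor of a dust solution), $k\in\{-1,0,1\}$, and $\gamma$ a metric that near every point takes the form $\frac{dr^2}{1-kr^2}+r^2(d\vartheta^2+\sin^2\vartheta\,d\varphi^2)$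 in suitable coordinates. Then for every $t\in I$ $$\langle Z_{ab}\rangle=H(t)\,\delta_{ab},\qquad H=\dot a/a ;$$ hence the coarse-grained expansion is $3H(t)$, and the coarse-grained shear and vorticity vanish. 2. (Kasner.) Let $g=-dt^2+\sum_{i=1}^3t^{2p_i}(dx^i)^2$ on $(0,\infty)\times\mathbb R^3$ with $\sum_ip_i=\sum_ip_i^2=1$. Then for every $t>0$ there are a linear isometry $L$ from $(\mathbb R^3,h(t))$ onto $\mathbf E^3$ and a vector $c$ with $f=L\circ\xi+c$, and under the identification of the flat slice with $\mathbf E^3$ by $L$ $$\langle Z_{ab}\rangle=\sigma_{ab}+\tfrac13\theta\,\delta_{ab},$$ where $\theta$ and $\sigma$ are the local expansion and shear at time $t$, at any point of the slice. In particular the coarse-grained expansion and shear equal the local ones, and the coarse-grained and local vorticities both vanish. 3. (Swiss cheese.) Let $g_0$ be an FLRW spacetime over $X_0$ as in 1, let $B_j\subset X_0$ be any family of excised regions (for instance disjoint balls), and let $g$ be a spacetime over $X$ such that an injective smooth map $\psi:X_0\setminus\bigcup_jB_j\to X$ of the spaces of worldlines identifies, for all times in $I$, the metric $g_0$ outside the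 excised regions with $g$; the rest of $g$ is arbitrary. If $\partial C=\xi(S^2)$ is contained in $\psi(X_0\setminus\bigcup_jB_j)$, that is, if it avoids the excised regions, then for every $t\in I$ again $\langle Z_{ab}\rangle=H(t)\,\delta_{ab}$ with $H=\dot a/a$ the Hubble parameter of the background, and the coarse-grained shear and vorticity vanish. -/

import Mathlib

open Set Filter Topology MeasureTheory
open scoped Manifold ContDiff

noncomputable section

namespace CoarseGraining

/-! ### Spaces -/

/-- Euclidean three-space, with its Euclidean norm. It is used both as the target of the isometric
embeddings and as the model space of the slices. -/
abbrev E3 : Type := EuclideanSpace ℝ (Fin 3)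

/-- The model space of surfaces. -/
abbrev E2 : Type := EuclideanSpace ℝ (Fin 2)

/-- The standard two-sphere with its standard smooth structure. -/
abbrev S2 : Type := Metric.sphere (0 : E3) 1

/-- The tangent space at `y` of a three-manifold `X`. -/
abbrev TX {X : Type*} [TopologicalSpace X] [ChartedSpace E3 X] (y : X) : Type :=
  TangentSpace (𝓡 3) y

/-- The tangent space of the two-sphere at `p`. -/
abbrev TS (p : S2) : Type := TangentSpace (𝓡 2) p

/-- The components of a tangent vector of a three-manifold at `y`, in the coordinates given by the
preferred chart at `y`. On `E3` itself these are the Cartesian components. -/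
def comp {X : Type*} [TopologicalSpace X] [ChartedSpace E3 X] {y : X} (w : TX y) (i : Fin 3) : ℝ :=
  (show E3 from w) i

/-! ### Spacetimes in comoving 3+1 form -/

/-- A spacetime in comoving coordinates `(t, y)`, where `y` ranges over a three-manifold `X`
(the space of dust worldlines) and `(t, y)` over an open set `dom` of `ℝ × X`.
The tangent space at `(t, y)` is `ℝ × T_y X`, the dust four-velocity is `u = ∂_t = (1, 0)`, which is
a unit timelike vector, and the slices of constant `t` are spacelike. Lapse and shift are otherwise
unrestricted. No smoothness is built in: the metrics of interest
may be non-smooth across matching hypersurfaces, and only the metric along a given tube of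
worldlines enters the coarse-graining. -/
structure ComovingSpacetime (X : Type*) [TopologicalSpace X] [ChartedSpace E3 X] where
  /-- The region of `ℝ × X` on which the metric is given. -/
  dom : Set (ℝ × X)
  isOpen_dom : IsOpen dom
  /-- The spacetime metric, of signature `(-,+,+,+)`. -/
  g : ∀ x : ℝ × X, LinearMap.BilinForm ℝ (ℝ × TX x.2)
  symm : ∀ x ∈ dom, ∀ a b, g x a b = g x b a
  unit : ∀ x ∈ dom, g x (1, 0) (1, 0) = -1
  spacelike : ∀ x ∈ dom, ∀ w : TX x.2, w ≠ 0 → 0 < g x (0, w) (0, w)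

variable {X : Type*} [TopologicalSpace X] [ChartedSpace E3 X]

namespace ComovingSpacetime

/-- The metric `h_ij` induced on the slice of constant `t`. -/
def h (M : ComovingSpacetime X) (t : ℝ) (y : X) (v w : TX y) : ℝ :=
  M.g (t, y) (0, v) (0, w)

/-- `N` is the shift vector at `(t, y)`: `h_ij N^j = g_{0i}`. -/
def IsShift (M : ComovingSpacetime X) (t : ℝ) (y : X) (N : TX y) : Prop :=
  ∀ w : TX y, M.h t y N w = M.g (t, y) (1, 0) (0, w)

/-! #### The local velocity gradient -/

/-- The components of the spacetime metric in the coordinates `(t, y^i)` given by the preferred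
chart of `X` at `y₀`, as a function of the coordinates. -/
def chartMetric (M : ComovingSpacetime X) (y₀ : X) (z : ℝ × E3) (a b : ℝ × E3) : ℝ :=
  M.g (z.1, (extChartAt (𝓡 3) y₀).symm z.2)
    (a.1, mfderiv (𝓡 3) (𝓡 3) (extChartAt (𝓡 3) y₀).symm z.2 a.2)
    (b.1, mfderiv (𝓡 3) (𝓡 3) (extChartAt (𝓡 3) y₀).symm z.2 b.2)

/-- Christoffel symbols of the first kind,
`Γ_{κ μν} = ½ (∂_μ g_{κν} + ∂_ν g_{κμ} - ∂_κ g_{μν})`, contracted with constant vectors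
`c^κ a^μ b^ν`. -/
def christoffel (M : ComovingSpacetime X) (y₀ : X) (z : ℝ × E3) (c a b : ℝ × E3) : ℝ :=
  (fderiv ℝ (fun z' => M.chartMetric y₀ z' c b) z a
    + fderiv ℝ (fun z' => M.chartMetric y₀ z' c a) z b
    - fderiv ℝ (fun z' => M.chartMetric y₀ z' a b) z c) / 2

/-- The local velocity gradient `Z_{μν} = ∇_ν u_μ = ∂_ν u_μ - Γ^κ_{μν} u_κ` of `u = ∂_t` at
`(t, y)`, evaluated as `Z_{μν} a^μ b^ν`. Here `u_μ = g_{μ0}` and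
`Γ^κ_{μν} u_κ = Γ_{κ μν} u^κ`. -/
def Z (M : ComovingSpacetime X) (t : ℝ) (y : X) (a b : ℝ × E3) : ℝ :=
  fderiv ℝ (fun z' => M.chartMetric y z' a (1, 0)) (t, extChartAt (𝓡 3) y y) b
    - M.christoffel y (t, extChartAt (𝓡 3) y y) (1, 0) a b

/-- The coordinate basis of `ℝ × E3`. -/
def frame (i : Fin 4) : ℝ × E3 :=
  Fin.cons (α := fun _ => ℝ × E3) (1, 0) (fun j : Fin 3 => (0, EuclideanSpace.single j 1)) i

/-- The metric at `(t, y)`, in the coordinates of the preferred chart at `y`. -/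
def metricAt (M : ComovingSpacetime X) (t : ℝ) (y : X) (a b : ℝ × E3) : ℝ :=
  M.chartMetric y (t, extChartAt (𝓡 3) y y) a b

/-- The local expansion `θ = g^{μν} Z_{μν}`. -/
def localExpansion (M : ComovingSpacetime X) (t : ℝ) (y : X) : ℝ :=
  ((Matrix.of fun μ ν => M.metricAt t y (frame μ) (frame ν))⁻¹ *
    (Matrix.of fun μ ν => M.Z t y (frame μ) (frame ν))).trace

/-- The rest-space metric `g_{μν} + u_μ u_ν` of the dust. -/
def restMetric (M : ComovingSpacetime X) (t : ℝ) (y : X) (a b : ℝ × E3) : ℝ :=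
  M.metricAt t y a b + M.metricAt t y a (1, 0) * M.metricAt t y b (1, 0)

/-- The local shear `σ_{μν} = Z_{(μν)} - ⅓ θ (g_{μν} + u_μ u_ν)`. -/
def localShear (M : ComovingSpacetime X) (t : ℝ) (y : X) (a b : ℝ × E3) : ℝ :=
  (M.Z t y a b + M.Z t y b a) / 2 - M.localExpansion t y / 3 * M.restMetric t y a b

/-- The local vorticity `ω_{μν} = Z_{[μν]}`. -/
def localVorticity (M : ComovingSpacetime X) (t : ℝ) (y : X) (a b : ℝ × E3) : ℝ :=
  (M.Z t y a b - M.Z t y b a) / 2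

end ComovingSpacetime

/-! ### Surfaces of spherical topology in Riemannian terms -/

/-- The components `q_{AB}` of a metric on the sphere in the preferred chart at `p`. -/
def chartGram (q : ∀ p : S2, TS p → TS p → ℝ) (p : S2) (z : E2) : Matrix (Fin 2) (Fin 2) ℝ :=
  Matrix.of fun A B => q ((extChartAt (𝓡 2) p).symm z)
    (mfderiv (𝓡 2) (𝓡 2) (extChartAt (𝓡 2) p).symm z (EuclideanSpace.single A (1 : ℝ) : E2))
    (mfderiv (𝓡 2) (𝓡 2) (extChartAt (𝓡 2) p).symm z (EuclideanSpace.single B (1 : ℝ) : E2))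

/-- The partial derivative of a function on the plane. -/
def pd (A : Fin 2) (F : E2 → ℝ) (z : E2) : ℝ := fderiv ℝ F z (EuclideanSpace.single A 1)

/-- Christoffel symbols of the first kind, `Γ_{C AB}`, of a metric on the plane. -/
def gamma (Q : E2 → Matrix (Fin 2) (Fin 2) ℝ) (C A B : Fin 2) (z : E2) : ℝ :=
  (pd A (fun z' => Q z' C B) z + pd B (fun z' => Q z' C A) z - pd C (fun z' => Q z' A B) z) / 2

/-- The only independent component `R_{0101}` of the curvature tensor of a metric on the plane. -/
def riemann0101 (Q : E2 → Matrix (Fin 2) (Fin 2) ℝ) (z : E2) : ℝ :=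
  -(pd 1 (pd 1 fun z' => Q z' 0 0) z - 2 * pd 0 (pd 1 fun z' => Q z' 0 1) z
      + pd 0 (pd 0 fun z' => Q z' 1 1) z) / 2
    + ∑ C, ∑ D, (Q z)⁻¹ C D *
        (gamma Q C 0 1 z * gamma Q D 0 1 z - gamma Q C 0 0 z * gamma Q D 1 1 z)

/-- The scalar curvature `R = 2 R_{0101} / det q` of a metric on the sphere (twice its Gauss
curvature). -/
def scalarCurvature (q : ∀ p : S2, TS p → TS p → ℝ) (p : S2) : ℝ :=
  2 * riemann0101 (chartGram q p) (extChartAt (𝓡 2) p p)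
    / (chartGram q p (extChartAt (𝓡 2) p p)).det

/-- The Euclidean inner product of the images of two tangent vectors under the differential of
a map from the sphere to Euclidean space. -/
def pullback (f : S2 → E3) (p : S2) (a b : TS p) : ℝ :=
  inner ℝ (mvfderiv (𝓡 2) f p a) (mvfderiv (𝓡 2) f p b)

/-- The area element of the surface `f`, relative to the area measure of the round unit sphere:
the square root of the quotient of the determinants of the two induced metrics (in any basis of
the tangent space). -/
def areaDensity (f : S2 → E3) (p : S2) : ℝ :=
  Real.sqrt
    ((Matrix.of fun A B : Fin 2 => pullback f p
        (EuclideanSpace.single A (1 : ℝ) : E2) (EuclideanSpace.single B (1 : ℝ) : E2)).det /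
     (Matrix.of fun A B : Fin 2 => pullback (fun p' : S2 => (p' : E3)) p
        (EuclideanSpace.single A (1 : ℝ) : E2) (EuclideanSpace.single B (1 : ℝ) : E2)).det)

/-- The region enclosed by a set `K` in Euclidean space: the union of the bounded connected
components of its complement. -/
def enclosed (K : Set E3) : Set E3 :=
  {x | x ∉ K ∧ Bornology.IsBounded (connectedComponentIn Kᶜ x)}

/-- The Euclidean volume `V₀` enclosed by the surface `f`. -/
def enclosedVolume (f : S2 → E3) : ℝ := (volume (enclosed (range f))).toReal

/-- `n` is the outward unit normal of the surface `f` at `f p`. -/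
def IsOutwardNormal (f : S2 → E3) (p : S2) (n : E3) : Prop :=
  ‖n‖ = 1 ∧ (∀ a : TS p, inner ℝ n (mvfderiv (𝓡 2) f p a) = 0) ∧
    ∀ᶠ s : ℝ in 𝓝[>] 0, f p + s • n ∉ enclosed (range f)

/-- The outward unit normal field of the surface `f`. -/
def outwardNormal (f : S2 → E3) (p : S2) : E3 := Classical.epsilon (IsOutwardNormal f p)

/-- `𝒩[Y_a]_b = V₀⁻¹ ∫ Y_a n_b dσ`, the integral being over the surface `f`. -/
def fluxMatrix (f : S2 → E3) (Y : S2 → E3) : Matrix (Fin 3) (Fin 3) ℝ :=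
  Matrix.of fun a b => (enclosedVolume f)⁻¹ *
    ∫ p : S2, Y p a * outwardNormal f p b * areaDensity f p ∂(volume : Measure E3).toSphere

/-! ### Comoving domains and the coarse-grained velocity gradient -/

/-- A comoving domain, i.e. a region of the space of worldlines, bounded by a smoothly embedded
sphere `ξ`. -/
structure Domain (X : Type*) [TopologicalSpace X] [ChartedSpace E3 X] where
  /-- The region itself. -/
  carrier : Set X
  /-- The parametrization of its boundary. -/
  ξ : S2 → X
  contMDiff_ξ : ContMDiff (𝓡 2) (𝓡 3) ∞ ξ
  injective_ξ : Function.Injective ξ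
  immersion_ξ : ∀ p, Function.Injective (mfderiv (𝓡 2) (𝓡 3) ξ p)
  frontier_eq : frontier carrier = range ξ
  closure_interior : closure (interior carrier) = carrier
  isConnected : IsConnected (interior carrier)

/-- The metric `q_{AB}(t)` induced on the boundary of the domain at time `t`. -/
def boundaryMetric (M : ComovingSpacetime X) (C : Domain X) (t : ℝ) (p : S2) (a b : TS p) : ℝ :=
  M.h t (C.ξ p) (mfderiv (𝓡 2) (𝓡 3) C.ξ p a) (mfderiv (𝓡 2) (𝓡 3) C.ξ p b)

/-- The domain is admissible at time `t`: its boundary (compact, orientable and of spherical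
topology by definition) lies in the spacetime and has positive scalar curvature. -/
def IsAdmissible (M : ComovingSpacetime X) (C : Domain X) (t : ℝ) : Prop :=
  (∀ p, (t, C.ξ p) ∈ M.dom) ∧ ∀ p, 0 < scalarCurvature (boundaryMetric M C t) p

/-- `f` is an isometric embedding of the boundary of the domain at time `t` into Euclidean space. -/
structure IsIsometricEmbedding (M : ComovingSpacetime X) (C : Domain X) (t : ℝ)
    (f : S2 → E3) : Prop where
  contMDiff : ContMDiff (𝓡 2) 𝓘(ℝ, E3) ∞ f
  injective : Function.Injective f
  isometric : ∀ p (a b : TS p), pullback f p a b = boundaryMetric M C t p a b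

/-- `v` is a smooth velocity field on the surface `f` such that dragging the surface along `v`
induces the time derivative of the metric of the boundary:
`2 v^a_{,(A} χ^b_{,B)} δ_ab = q̇_{AB}`. -/
def InducesMetricChange (M : ComovingSpacetime X) (C : Domain X) (t : ℝ) (f v : S2 → E3) : Prop :=
  ContMDiff (𝓡 2) 𝓘(ℝ, E3) ∞ v ∧
  ∀ p (a b : TS p), HasDerivAt (fun s => boundaryMetric M C s p a b)
    (inner ℝ (mvfderiv (𝓡 2) v p a) (mvfderiv (𝓡 2) f p b)
      + inner ℝ (mvfderiv (𝓡 2) f p a) (mvfderiv (𝓡 2) v p b)) t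

/-- `ν` is the outward unit normal, in the slice, of the boundary of the domain at `ξ p`. -/
def IsOutwardSliceNormal (M : ComovingSpacetime X) (C : Domain X) (t : ℝ) (p : S2)
    (ν : TX (C.ξ p)) : Prop :=
  M.h t (C.ξ p) ν ν = 1 ∧ (∀ a : TS p, M.h t (C.ξ p) ν (mfderiv (𝓡 2) (𝓡 3) C.ξ p a) = 0) ∧
    ∀ᶠ s : ℝ in 𝓝[>] 0, (extChartAt (𝓡 3) (C.ξ p)).symm
      (extChartAt (𝓡 3) (C.ξ p) (C.ξ p) + s • (show E3 from ν)) ∉ C.carrier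

/-- The outward unit normal, in the slice, of the boundary of the domain. -/
def outwardSliceNormal (M : ComovingSpacetime X) (C : Domain X) (t : ℝ) (p : S2) : TX (C.ξ p) :=
  Classical.epsilon (IsOutwardSliceNormal M C t p)

/-- `G` is the push-forward `g(N)` of the shift to Euclidean space along the surface: the tangent
part of `N` is pushed by the differential of `f`, the normal component is kept. -/
def IsPushedShift (M : ComovingSpacetime X) (C : Domain X) (t : ℝ) (f G : S2 → E3) : Prop :=
  ∀ p, ∃ (N : TX (C.ξ p)) (a : TS p), M.IsShift t (C.ξ p) N ∧
    N = mfderiv (𝓡 2) (𝓡 3) C.ξ p a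
      + M.h t (C.ξ p) N (outwardSliceNormal M C t p) • outwardSliceNormal M C t p ∧
    G p = mvfderiv (𝓡 2) f p a
      + M.h t (C.ξ p) N (outwardSliceNormal M C t p) • outwardNormal f p

/-- `⟨Z_ab⟩ = Q_ab` for the domain `C` at time `t`, in the Cartesian coordinates of the Euclidean
space into which the boundary is embedded by `f`:
the symmetric part of `Q` is `V₀⁻¹ ∫ v_(a n_b) dσ` for a velocity field `v` that induces the right
change of metric, the antisymmetric part is `V₀⁻¹ ∫ g(N)_[a n_b] dσ`. -/
def IsCoarseGrained (M : ComovingSpacetime X) (C : Domain X) (t : ℝ) (f : S2 → E3)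
    (Q : Matrix (Fin 3) (Fin 3) ℝ) : Prop :=
  ∃ v G : S2 → E3, InducesMetricChange M C t f v ∧ IsPushedShift M C t f G ∧
    Q = (1 / 2 : ℝ) • (fluxMatrix f v + (fluxMatrix f v).transpose)
      + (1 / 2 : ℝ) • (fluxMatrix f G - (fluxMatrix f G).transpose)

/-- The coarse-grained expansion. -/
def expansion (Q : Matrix (Fin 3) (Fin 3) ℝ) : ℝ := Q.trace

/-- The coarse-grained shear. -/
def shear (Q : Matrix (Fin 3) (Fin 3) ℝ) : Matrix (Fin 3) (Fin 3) ℝ :=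
  (1 / 2 : ℝ) • (Q + Q.transpose) - (expansion Q / 3) • (1 : Matrix (Fin 3) (Fin 3) ℝ)

/-- The coarse-grained vorticity. -/
def vorticity (Q : Matrix (Fin 3) (Fin 3) ℝ) : Matrix (Fin 3) (Fin 3) ℝ :=
  (1 / 2 : ℝ) • (Q - Q.transpose)

/-- The bilinear form `Q_ab x^a y^b` on Euclidean space. -/
def toForm (Q : Matrix (Fin 3) (Fin 3) ℝ) (x y : E3) : ℝ := ∑ a, ∑ b, x a * Q a b * y b

/-! ### The exact solutions -/

/-- A Riemannian metric `γ` on `X` which near every point takes the form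
`dr² / (1 - k r²) + r² (dθ² + sin² θ dφ²)` in suitable coordinates; in the Cartesian coordinates
`x^i` that belong to the polar coordinates `(r, θ, φ)` this is
`δ_ij dx^i dx^j + k (x_i dx^i)² / (1 - k |x|²)`. -/
def HasConstantCurvature (k : ℝ) (γ : ∀ y : X, TX y → TX y → ℝ) : Prop :=
  ∀ y₀ : X, ∃ φ ∈ IsManifold.maximalAtlas (𝓡 3) ∞ X, y₀ ∈ φ.source ∧ ∀ y ∈ φ.source,
    k * ‖φ y‖ ^ 2 < 1 ∧ ∀ v w : TX y,
      γ y v w = inner ℝ (mvfderiv (𝓡 3) φ y v) (mvfderiv (𝓡 3) φ y w)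
        + k * inner ℝ (φ y) (mvfderiv (𝓡 3) φ y v) * inner ℝ (φ y) (mvfderiv (𝓡 3) φ y w)
          / (1 - k * ‖φ y‖ ^ 2)

/-- `M` is, during the open set `I` of times, an FLRW spacetime with curvature parameter `k` and
scale factor `a`: its metric is `-dt² + a(t)² γ`. -/
structure IsFLRW (M : ComovingSpacetime X) (I : Set ℝ) (k : ℝ) (a : ℝ → ℝ) : Prop where
  isOpen : IsOpen I
  k_eq : k = -1 ∨ k = 0 ∨ k = 1
  pos : ∀ t ∈ I, 0 < a t
  smooth : ContDiffOn ℝ ∞ a I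
  dom_eq : M.dom = I ×ˢ univ
  metric_eq : ∃ γ : ∀ y : X, TX y → TX y → ℝ, HasConstantCurvature k γ ∧
    ∀ t ∈ I, ∀ (y : X) (v w : ℝ × TX y),
      M.g (t, y) v w = -(v.1 * w.1) + a t ^ 2 * γ y v.2 w.2

/-- `M` is the Kasner spacetime with exponents `κ`: its metric is `-dt² + ∑ t^(2 κ_i) (dx^i)²` for
`t > 0`, where the exponents satisfy the Kasner conditions. -/
structure IsKasner (M : ComovingSpacetime E3) (κ : Fin 3 → ℝ) : Prop where
  sum_eq : ∑ i, κ i = 1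
  sum_sq_eq : ∑ i, κ i ^ 2 = 1
  dom_eq : M.dom = Ioi 0 ×ˢ univ
  metric_eq : ∀ t > 0, ∀ (y : E3) (v w : ℝ × TX y),
    M.g (t, y) v w = -(v.1 * w.1) + ∑ i, t ^ (2 * κ i) * comp v.2 i * comp w.2 i

/-- `M` is a Swiss-cheese model built on the background `M₀`: the regions `B i` (for instance
disjoint balls) are excised from the space `X₀` of worldlines of the background, the remaining part
is identified by `ψ` with a part of `M` that carries, at the times in `I`, the metric and
four-velocity of the background, and the rest of `M` is arbitrary. -/
structure IsSwissCheese {X₀ : Type*} [TopologicalSpace X₀] [ChartedSpace E3 X₀] {ι : Type*}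
    (M₀ : ComovingSpacetime X₀) (I : Set ℝ) (B : ι → Set X₀) (ψ : X₀ → X)
    (M : ComovingSpacetime X) : Prop where
  injOn : InjOn ψ (⋃ i, B i)ᶜ
  smooth : ∀ y ∉ ⋃ i, B i, ContMDiffAt (𝓡 3) (𝓡 3) ∞ ψ y
  mem_dom : ∀ t ∈ I, ∀ y ∉ ⋃ i, B i, (t, ψ y) ∈ M.dom
  metric_eq : ∀ t ∈ I, ∀ y ∉ ⋃ i, B i, ∀ v w : ℝ × TX y,
    M.g (t, ψ y) (v.1, mfderiv (𝓡 3) (𝓡 3) ψ y v.2) (w.1, mfderiv (𝓡 3) (𝓡 3) ψ y w.2)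
      = M₀.g (t, y) v w

end CoarseGraining

end

universe u v w

open CoarseGraining

/-!
The boundary of an admissible domain is embedded in Euclidean space as a closed surface of positive
curvature, and everything follows from the classical theory of such surfaces.

A surface is treated through its radially constant extension `F` to `E3` without the origin, so
that the calculus on the sphere is calculus in space. The theorema egregium
(`scalarCurvature_pullback`) expresses the scalar curvature by the determinant of the second
fundamental form. Positive curvature therefore makes this form definite, with the same sign
everywhere, and a point reflection makes it negative definite with respect to the normal field
`∂₁F × ∂₂F` (`exists_sign_oval`); such a surface is called an oval.

The Gauss map of an oval is a local homeomorphism of the sphere, hence injective, and the surface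
lies strictly on one side of each of its tangent planes (`Oval.strictly_convex`). So the enclosed
region is the intersection of the inner sides of the tangent planes (`Oval.enclosed_eq`), and the
outward normal is the Gauss map (`isOutwardNormal_iff`). Stokes' theorem (`integral_wedge_eq_zero`)
then shows that the flux matrix of an affine field `A (f p) + c` is `A` (`fluxMatrix_affine`).

Two isometric ovals are congruent. By Herglotz's integral formula, which is again Stokes' theorem,
the integral of a nonpositive quadratic expression in the difference of the two second fundamental
forms vanishes (`Oval.exists_congruence`). Infinitesimal rigidity follows from this by comparing the
ovals `f + s v` and `f - s v` (`exists_skew_of_oval`): an infinitesimal isometric deformation is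
an infinitesimal rigid motion, whose flux matrix is antisymmetric. Hence the symmetric part of the
flux matrix of `v` does not depend on the choice of `v`. The shift vanishes in all three cases, so
the coarse-grained velocity gradient is the symmetric part of `A` as soon as one affine velocity
field `A (f p) + c` induces the change of the metric (`isCoarseGrained_iff`).

In the FLRW and Swiss-cheese cases the metric of the boundary evolves by `a(s) ^ 2`, and the field
`H • f` does this. In a Kasner spacetime the boundary lies in a flat slice, and rigidity shows that
`f` is its image under an affine isometry of the slice; the field is the image of the
diagonal map with entries `κ i / t`, whose form is the sum of the local shear and a third of the
local expansion.
-/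

noncomputable section

namespace CoarseGraining

/-! ### Vector algebra in Euclidean three-space -/

lemma inner_eq (x y : E3) : inner ℝ x y = x 0 * y 0 + x 1 * y 1 + x 2 * y 2 := by
  simp [PiLp.inner_apply, Fin.sum_univ_three, mul_comm]

lemma E3.ext_coord {x y : E3} (h0 : x 0 = y 0) (h1 : x 1 = y 1) (h2 : x 2 = y 2) : x = y := by
  ext i
  fin_cases i <;> assumption

/-- The standard basis vectors of Euclidean three-space. -/
abbrev bas (i : Fin 3) : E3 := EuclideanSpace.single i (1 : ℝ)

lemma eq_sum_bas (x : E3) : x = x 0 • bas 0 + x 1 • bas 1 + x 2 • bas 2 := by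
  apply E3.ext_coord <;> simp [bas]

/-- The cross product of Euclidean three-space, as a continuous bilinear map. -/
def crossL : E3 →L[ℝ] E3 →L[ℝ] E3 :=
  (LinearMap.mk₂ ℝ (fun a b : E3 =>
      (!₂[a 1 * b 2 - a 2 * b 1, a 2 * b 0 - a 0 * b 2, a 0 * b 1 - a 1 * b 0] : E3))
    (fun a a' b => by apply E3.ext_coord <;> simp <;> ring)
    (fun c a b => by apply E3.ext_coord <;> simp <;> ring)
    (fun a b b' => by apply E3.ext_coord <;> simp <;> ring)
    (fun c a b => by apply E3.ext_coord <;> simp <;> ring)).toContinuousBilinearMap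

/-- The cross product of Euclidean three-space. -/
abbrev cross (a b : E3) : E3 := crossL a b

@[simp] lemma cross_0 (a b : E3) : crossL a b 0 = a 1 * b 2 - a 2 * b 1 := by
  simp [crossL, LinearMap.toContinuousBilinearMap_apply]
@[simp] lemma cross_1 (a b : E3) : crossL a b 1 = a 2 * b 0 - a 0 * b 2 := by
  simp [crossL, LinearMap.toContinuousBilinearMap_apply]
@[simp] lemma cross_2 (a b : E3) : crossL a b 2 = a 0 * b 1 - a 1 * b 0 := by
  simp [crossL, LinearMap.toContinuousBilinearMap_apply]

lemma inner_cross_left (a b : E3) : inner ℝ (cross a b) a = 0 := by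
  simp [inner_eq]; ring

lemma inner_cross_right (a b : E3) : inner ℝ (cross a b) b = 0 := by
  simp [inner_eq]; ring

lemma inner_left_cross (a b : E3) : inner ℝ a (cross a b) = 0 := by
  rw [real_inner_comm, inner_cross_left]

lemma inner_right_cross (a b : E3) : inner ℝ b (cross a b) = 0 := by
  rw [real_inner_comm, inner_cross_right]

lemma inner_cross_cross (a b c d : E3) :
    inner ℝ (cross a b) (cross c d) = inner ℝ a c * inner ℝ b d - inner ℝ a d * inner ℝ b c := by
  simp [inner_eq]; ring

lemma cross_swap (a b : E3) : cross a b = - cross b a := by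
  apply E3.ext_coord <;> simp <;> ring

lemma cross_cross (a b c : E3) : cross a (cross b c) = inner ℝ a c • b - inner ℝ a b • c := by
  rw [inner_eq, inner_eq]
  apply E3.ext_coord <;> simp <;> ring

/-- A vector expanded with respect to the basis `a`, `b`, `a × b`, in terms of the dual basis. -/
lemma cross_expansion (a b x : E3) :
    inner ℝ (cross a b) (cross a b) • x =
      inner ℝ x (cross b (cross a b)) • a + inner ℝ x (cross (cross a b) a) • b
        + inner ℝ x (cross a b) • cross a b := by
  simp only [inner_eq]
  apply E3.ext_coord <;> simp <;> ring

/-- A linear map acts on cross products through its second exterior power, here written in the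
standard basis. -/
lemma cross_map (A : E3 →L[ℝ] E3) (a b : E3) :
    cross (A a) (A b) = cross a b 0 • cross (A (bas 1)) (A (bas 2))
      + cross a b 1 • cross (A (bas 2)) (A (bas 0))
      + cross a b 2 • cross (A (bas 0)) (A (bas 1)) := by
  rw [eq_sum_bas a, eq_sum_bas b]
  simp only [map_add, map_smul]
  generalize A (bas 0) = u
  generalize A (bas 1) = v
  generalize A (bas 2) = w
  apply E3.ext_coord <;> simp [bas] <;> ring

/-- The triple product `det (x, A, B)` of a vector and two linear functionals. On the unit sphere
this is the value of the two-form `A ∧ B` on an oriented orthonormal basis of the tangent plane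
at `x`. -/
def wedge (x : E3) (A B : E3 →L[ℝ] ℝ) : ℝ :=
  x 0 * (A (bas 1) * B (bas 2) - A (bas 2) * B (bas 1))
    + x 1 * (A (bas 2) * B (bas 0) - A (bas 0) * B (bas 2))
    + x 2 * (A (bas 0) * B (bas 1) - A (bas 1) * B (bas 0))

lemma wedge_cross (a b : E3) (A B : E3 →L[ℝ] ℝ) :
    wedge (cross a b) A B = A a * B b - A b * B a := by
  conv_rhs => rw [eq_sum_bas a, eq_sum_bas b]
  simp only [map_add, map_smul, wedge, cross_0, cross_1, cross_2, smul_eq_mul]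
  ring

/-- `(e₁, e₂, p)` is an oriented orthonormal basis. -/
structure OFrame (p e₁ e₂ : E3) : Prop where
  n₁ : inner ℝ e₁ e₁ = 1
  n₂ : inner ℝ e₂ e₂ = 1
  orth : inner ℝ e₁ e₂ = 0
  cross_eq : cross e₁ e₂ = p

namespace OFrame

variable {p e₁ e₂ : E3}

lemma inner_p_e₁ (h : OFrame p e₁ e₂) : inner ℝ p e₁ = 0 := by
  rw [← h.cross_eq, inner_cross_left]

lemma inner_p_e₂ (h : OFrame p e₁ e₂) : inner ℝ p e₂ = 0 := by
  rw [← h.cross_eq, inner_cross_right]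

lemma inner_e₁_p (h : OFrame p e₁ e₂) : inner ℝ e₁ p = 0 := by
  rw [real_inner_comm, h.inner_p_e₁]

lemma inner_e₂_p (h : OFrame p e₁ e₂) : inner ℝ e₂ p = 0 := by
  rw [real_inner_comm, h.inner_p_e₂]

lemma inner_p_p (h : OFrame p e₁ e₂) : inner ℝ p p = 1 := by
  rw [← h.cross_eq, inner_cross_cross, h.n₁, h.n₂, h.orth]; ring

lemma expansion (h : OFrame p e₁ e₂) (x : E3) :
    x = inner ℝ x e₁ • e₁ + inner ℝ x e₂ • e₂ + inner ℝ x p • p := by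
  have h1 := cross_expansion e₁ e₂ x
  have h2 : cross e₂ (cross e₁ e₂) = e₁ := by
    rw [cross_cross, h.n₂, real_inner_comm, h.orth]; simp
  have h3 : cross (cross e₁ e₂) e₁ = e₂ := by
    rw [cross_swap, cross_cross, h.n₁, h.orth]; simp
  rw [h2, h3, h.cross_eq, h.inner_p_p, one_smul] at h1
  exact h1

lemma expansion_tangent (h : OFrame p e₁ e₂) {x : E3} (hx : inner ℝ x p = 0) :
    x = inner ℝ x e₁ • e₁ + inner ℝ x e₂ • e₂ := by
  conv_lhs => rw [h.expansion x, hx]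
  simp

lemma e₁_ne (h : OFrame p e₁ e₂) : e₁ ≠ 0 := by
  rintro rfl
  simpa using h.n₁

end OFrame

lemma exists_oframe {p : E3} (hp : ‖p‖ = 1) : ∃ e₁ e₂, OFrame p e₁ e₂ := by
  have hpp : inner ℝ p p = 1 := by rw [real_inner_self_eq_norm_sq, hp]; norm_num
  obtain ⟨a, ha, ha0⟩ : ∃ a : E3, inner ℝ p a = 0 ∧ a ≠ 0 := by
    by_cases h : p 0 = 0 ∧ p 1 = 0
    · refine ⟨bas 0, by simp [inner_eq, h.1], fun h0 => ?_⟩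
      simpa using congrArg (fun v : E3 => v 0) h0
    · refine ⟨!₂[p 1, -p 0, 0], by simp [inner_eq]; ring, fun h0 => h ?_⟩
      have h1 := congrArg (fun v : E3 => v 0) h0
      have h2 := congrArg (fun v : E3 => v 1) h0
      simp at h1 h2
      exact ⟨h2, h1⟩
  have hn : ‖a‖ ≠ 0 := norm_ne_zero_iff.mpr ha0
  have h1 : inner ℝ (‖a‖⁻¹ • a) (‖a‖⁻¹ • a) = 1 := by
    rw [real_inner_smul_left, real_inner_smul_right, real_inner_self_eq_norm_sq]
    field_simp
  have h2 : inner ℝ p (‖a‖⁻¹ • a) = 0 := by rw [real_inner_smul_right, ha, mul_zero]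
  generalize ‖a‖⁻¹ • a = e at h1 h2
  refine ⟨e, cross p e, h1, ?_, ?_, ?_⟩
  · rw [inner_cross_cross, h1, hpp, h2]; simp
  · rw [real_inner_comm, inner_cross_right]
  · rw [cross_cross, h1, real_inner_comm, h2]; simp

/-- Two definite symmetric forms on a plane with the same determinant satisfy
`det (A - B) ≤ 0`, and equality holds only if they agree. -/
lemma det_sub_nonpos {a b c a' b' c' : ℝ} (ha : a < 0) (ha' : a' < 0)
    (hd : 0 < a * c - b ^ 2) (hdd : a' * c' - b' ^ 2 = a * c - b ^ 2) :
    (a' - a) * (c' - c) - (b' - b) ^ 2 ≤ 0 ∧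
      ((a' - a) * (c' - c) - (b' - b) ^ 2 = 0 → a' = a ∧ b' = b ∧ c' = c) := by
  have hc : c < 0 := by
    by_contra h
    push Not at h
    nlinarith [sq_nonneg b, mul_nonneg (neg_nonneg.2 ha.le) h]
  have hc' : c' < 0 := by
    by_contra h
    push Not at h
    nlinarith [mul_nonneg (neg_nonneg.2 ha'.le) h, sq_nonneg b']
  set d := a * c - b ^ 2 with hdef
  have hac : a * c = d + b ^ 2 := by rw [hdef]; ring
  have hac' : a' * c' = d + b' ^ 2 := by linarith
  -- The mixed determinant is the sum of `u = a c'` and `v = a' c`, whose product is known.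
  set u := a * c' with hu
  set v := a' * c with hv
  have hu0 : 0 < u := mul_pos_of_neg_of_neg ha hc'
  have hv0 : 0 < v := mul_pos_of_neg_of_neg ha' hc
  have huv : u * v = (d + b * b') ^ 2 + d * (b - b') ^ 2 := by
    have : u * v = (a * c) * (a' * c') := by rw [hu, hv]; ring
    rw [this, hac, hac']; ring
  have hexp : (a' - a) * (c' - c) - (b' - b) ^ 2 = 2 * (d + b * b') - (u + v) := by
    have : (a' - a) * (c' - c) = a' * c' + a * c - (u + v) := by rw [hu, hv]; ring
    rw [this, hac, hac']; ring
  have hsq : (u + v) ^ 2 = (u - v) ^ 2 + 4 * d * (b - b') ^ 2 + (2 * (d + b * b')) ^ 2 := by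
    have : (u + v) ^ 2 = (u - v) ^ 2 + 4 * (u * v) := by ring
    rw [this, huv]; ring
  have hdb : 0 ≤ 4 * d * (b - b') ^ 2 := by positivity
  have key : 2 * (d + b * b') ≤ u + v := by
    apply le_of_abs_le
    rw [← abs_of_pos (add_pos hu0 hv0)]
    apply sq_le_sq.mp
    nlinarith [sq_nonneg (u - v)]
  refine ⟨by linarith, fun h0 => ?_⟩
  have heq : u + v = 2 * (d + b * b') := by linarith
  rw [heq] at hsq
  have h1 : (u - v) ^ 2 = 0 := by nlinarith [sq_nonneg (u - v)]
  have h2 : d * (b - b') ^ 2 = 0 := by nlinarith [sq_nonneg (u - v)]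
  have hb : b' = b := by
    rcases mul_eq_zero.mp h2 with h | h
    · exact absurd h hd.ne'
    · linarith [pow_eq_zero_iff (two_ne_zero) |>.mp h]
  have huv' : u = v := by linarith [pow_eq_zero_iff (two_ne_zero) |>.mp h1]
  subst hb
  have hacac : a * c = a' * c' := by linarith
  have hcc : c' = c := by
    have : a * (c' ^ 2 - c ^ 2) = 0 := by
      have e1 : a * c' * c' = a' * c * c' := by rw [← hu, ← hv, huv']
      nlinarith
    rcases mul_eq_zero.mp this with h | h
    · exact absurd h ha.ne
    · have : (c' - c) * (c' + c) = 0 := by linarith [h, sq_sub_sq c' c]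
      rcases mul_eq_zero.mp this with h | h <;> linarith
  subst hcc
  refine ⟨?_, rfl, rfl⟩
  exact (mul_right_cancel₀ hc'.ne hacac).symm

/-! ### Radially constant maps -/

lemma two_le_infty : (2 : WithTop ℕ∞) ≤ ∞ :=
  WithTop.coe_le_coe.mpr (le_top : (2 : ℕ∞) ≤ ⊤)

/-- A map on `E3` which is smooth away from the origin and constant along the open rays from the
origin. Such maps are the extensions of the smooth maps on the unit sphere, and their derivatives
at a point of the sphere in directions orthogonal to it are the derivatives along the sphere. -/
structure Radial {F : Type*} [NormedAddCommGroup F] [NormedSpace ℝ F] (f : E3 → F) : Prop where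
  smooth : ∀ x ≠ 0, ContDiffAt ℝ ∞ f x
  homog : ∀ r : ℝ, 0 < r → ∀ x, f (r • x) = f x

namespace Radial

variable {F G : Type*} [NormedAddCommGroup F] [NormedSpace ℝ F] [NormedAddCommGroup G]
  [NormedSpace ℝ G] {f : E3 → F} {x : E3}

lemma differentiableAt (hf : Radial f) (hx : x ≠ 0) : DifferentiableAt ℝ f x :=
  (hf.smooth x hx).differentiableAt (by simp)

lemma contDiffAt_fderiv (hf : Radial f) (hx : x ≠ 0) : ContDiffAt ℝ ∞ (fderiv ℝ f) x :=
  (hf.smooth x hx).fderiv_right (by simp)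

lemma contDiffAt_fderiv_fderiv (hf : Radial f) (hx : x ≠ 0) :
    ContDiffAt ℝ ∞ (fderiv ℝ (fderiv ℝ f)) x :=
  (hf.contDiffAt_fderiv hx).fderiv_right (by simp)

lemma differentiableAt_fderiv (hf : Radial f) (hx : x ≠ 0) : DifferentiableAt ℝ (fderiv ℝ f) x :=
  (hf.contDiffAt_fderiv hx).differentiableAt (by simp)

lemma snd_symm (hf : Radial f) (hx : x ≠ 0) (a b : E3) :
    fderiv ℝ (fderiv ℝ f) x a b = fderiv ℝ (fderiv ℝ f) x b a :=
  (hf.smooth x hx).isSymmSndFDerivAt (by simpa using two_le_infty) a b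

lemma fderiv_smul (hf : Radial f) {r : ℝ} (hr : 0 < r) (x : E3) :
    fderiv ℝ f (r • x) = r⁻¹ • fderiv ℝ f x := by
  have h := fderiv_comp_smul (𝕜 := ℝ) (f := f) (x := x) r
  have h2 : (fun y => f (r • y)) = f := funext fun y => hf.homog r hr y
  rw [h2] at h
  rw [h, smul_smul, inv_mul_cancel₀ hr.ne', one_smul]

lemma fderiv_self (hf : Radial f) (hx : x ≠ 0) : fderiv ℝ f x x = 0 := by
  have h1 : HasDerivAt (fun t : ℝ => x + t • x) x 0 := by
    simpa using ((hasDerivAt_id (0 : ℝ)).smul_const x).const_add x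
  have h2 : HasFDerivAt f (fderiv ℝ f x) (x + (0 : ℝ) • x) := by
    simpa using (hf.differentiableAt hx).hasFDerivAt
  have h3 := h2.comp_hasDerivAt (0 : ℝ) h1
  have h4 : (f ∘ fun t : ℝ => x + t • x) =ᶠ[𝓝 0] fun _ => f x := by
    filter_upwards [Ioi_mem_nhds (show (-1 : ℝ) < 0 by norm_num)] with t ht
    have : x + t • x = (1 + t) • x := by rw [add_smul, one_smul]
    simp only [Function.comp, this]
    exact hf.homog _ (by linarith [mem_Ioi.mp ht]) x
  exact (h3.congr_of_eventuallyEq h4.symm).unique (hasDerivAt_const 0 (f x))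

lemma comp (hf : Radial f) {g : F → G} (hg : ContDiff ℝ ∞ g) : Radial fun x => g (f x) where
  smooth x hx := hg.contDiffAt.comp x (hf.smooth x hx)
  homog r hr x := by rw [hf.homog r hr]

lemma prodMk (hf : Radial f) {g : E3 → G} (hg : Radial g) : Radial fun x => (f x, g x) where
  smooth x hx := (hf.smooth x hx).prodMk (hg.smooth x hx)
  homog r hr x := by rw [hf.homog r hr, hg.homog r hr]

lemma add (hf : Radial f) {g : E3 → F} (hg : Radial g) : Radial fun x => f x + g x :=
  (hf.prodMk hg).comp (g := fun y : F × F => y.1 + y.2) (by fun_prop)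

lemma sub (hf : Radial f) {g : E3 → F} (hg : Radial g) : Radial fun x => f x - g x :=
  (hf.prodMk hg).comp (g := fun y : F × F => y.1 - y.2) (by fun_prop)

lemma const_smul (hf : Radial f) (c : ℝ) : Radial fun x => c • f x :=
  hf.comp (g := fun y => c • y) (by fun_prop)

lemma sub_const (hf : Radial f) (c : F) : Radial fun x => f x - c :=
  hf.comp (g := fun y => y - c) (by fun_prop)

lemma mul {α β : E3 → ℝ} (hα : Radial α) (hβ : Radial β) : Radial fun x => α x * β x :=
  (hα.prodMk hβ).comp (g := fun y : ℝ × ℝ => y.1 * y.2) (by fun_prop)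

lemma coord {f : E3 → E3} (hf : Radial f) (i : Fin 3) : Radial fun x => f x i :=
  hf.comp (g := fun y : E3 => y i) (by fun_prop)

lemma eq_normalize (hf : Radial f) (hx : x ≠ 0) : f x = f (‖x‖⁻¹ • x) :=
  (hf.homog _ (inv_pos.mpr (norm_pos_iff.mpr hx)) x).symm

/-- A radially constant map whose derivative vanishes along the unit sphere is constant. -/
lemma const_of_fderiv_eq_zero (hf : Radial f) (h : ∀ p : E3, ‖p‖ = 1 → fderiv ℝ f p = 0)
    {x y : E3} (hx : x ≠ 0) (hy : y ≠ 0) : f x = f y := by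
  have hconn : IsPreconnected ({0}ᶜ : Set E3) :=
    (isConnected_compl_singleton_of_one_lt_rank (by
      rw [← Module.finrank_eq_rank ℝ E3, finrank_euclideanSpace_fin]; norm_num) 0).isPreconnected
  refine isOpen_compl_singleton.is_const_of_fderiv_eq_zero hconn (𝕜 := ℝ)
    (fun z hz => (hf.differentiableAt hz).differentiableWithinAt) (fun z hz => ?_) hx hy
  have hz0 : z ≠ 0 := hz
  have hn : 0 < ‖z‖ := norm_pos_iff.mpr hz0
  have h1 : z = ‖z‖ • (‖z‖⁻¹ • z) := by rw [smul_smul, mul_inv_cancel₀ hn.ne', one_smul]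
  rw [h1, hf.fderiv_smul hn, h _ (by rw [norm_smul, norm_inv, norm_norm, inv_mul_cancel₀ hn.ne'])]
  simp

end Radial

lemma ne_zero_of_norm_one {p : E3} (hp : ‖p‖ = 1) : p ≠ 0 := by
  rintro rfl
  simp at hp

lemma norm_normalize {x : E3} (hx : x ≠ 0) : ‖‖x‖⁻¹ • x‖ = 1 := by
  rw [norm_smul, norm_inv, norm_norm, inv_mul_cancel₀ (norm_ne_zero_iff.mpr hx)]

/-- The radially constant extension of a map that is smooth along the unit sphere. -/
lemma radial_normalize {F : Type*} [NormedAddCommGroup F] [NormedSpace ℝ F] {g : E3 → F}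
    (hg : ∀ p, ‖p‖ = 1 → ContDiffAt ℝ ∞ g p) : Radial fun x => g (‖x‖⁻¹ • x) where
  smooth x hx := by
    have h1 : ContDiffAt ℝ ∞ (fun x : E3 => ‖x‖⁻¹ • x) x :=
      ((contDiffAt_norm ℝ hx).inv (norm_ne_zero_iff.mpr hx)).smul contDiffAt_id
    exact ContDiffAt.comp (g := g) (f := fun x : E3 => ‖x‖⁻¹ • x) x (hg _ (norm_normalize hx)) h1
  homog r hr x := by
    rw [norm_smul, Real.norm_of_nonneg hr.le, smul_smul, mul_inv, mul_assoc, mul_comm _ r,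
      ← mul_assoc, inv_mul_cancel₀ hr.ne', one_mul]

/-! ### Stokes' theorem on the sphere -/

lemma norm_coe_S2 (p : S2) : ‖(p : E3)‖ = 1 := by simp

lemma coe_S2_ne_zero (p : S2) : (p : E3) ≠ 0 := ne_zero_of_norm_one (norm_coe_S2 p)

/-- The standard area measure of the unit sphere. -/
abbrev sphereMeasure : Measure S2 := (volume : Measure E3).toSphere

lemma finrank_E3 : Module.finrank ℝ E3 = 3 := by simp

/-- Integration in polar coordinates of a product of a function on the sphere and a function of
the radius. -/
lemma integral_polar {ψ : E3 → ℝ} {φ : S2 → ℝ} {g : ℝ → ℝ}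
    (h : ∀ (p : S2) (r : ℝ), 0 < r → ψ (r • (p : E3)) = φ p * g r) :
    ∫ x, ψ x = (∫ p, φ p ∂sphereMeasure) * ∫ r in Ioi (0 : ℝ), r ^ 2 * g r := by
  have h0 : ∀ x : ({0}ᶜ : Set E3), ψ x = φ (homeomorphUnitSphereProd E3 x).1
      * g (homeomorphUnitSphereProd E3 x).2 := by
    intro x
    rw [← h _ _ (homeomorphUnitSphereProd E3 x).2.2]
    have hx : ‖(x : E3)‖ ≠ 0 := norm_ne_zero_iff.mpr x.2
    simp [smul_smul, mul_inv_cancel₀ hx]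
  calc ∫ x, ψ x = ∫ x : ({(0)}ᶜ : Set E3), ψ x ∂((volume : Measure E3).comap (↑)) := by
        rw [integral_subtype_comap (measurableSet_singleton _).compl fun x ↦ ψ x,
          restrict_compl_singleton]
    _ = ∫ z, φ z.1 * g z.2 ∂sphereMeasure.prod (.volumeIoiPow 2) := by
        have := (volume : Measure E3).measurePreserving_homeomorphUnitSphereProd.integral_comp
          (Homeomorph.measurableEmbedding _) (fun z => φ z.1 * g z.2)
        rw [finrank_E3] at this
        rw [← this]
        exact integral_congr_ae (.of_forall h0)
    _ = (∫ p, φ p ∂sphereMeasure) * ∫ r : Ioi (0 : ℝ), g r ∂.volumeIoiPow 2 :=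
        integral_prod_mul φ fun r : Ioi (0 : ℝ) => g r
    _ = _ := by
      congr 1
      simp only [Measure.volumeIoiPow, ENNReal.ofReal]
      rw [integral_withDensity_eq_integral_smul,
        integral_subtype_comap measurableSet_Ioi fun a ↦ Real.toNNReal (a ^ 2) • g a,
        setIntegral_congr_fun measurableSet_Ioi fun x hx ↦ ?_]
      · rw [NNReal.smul_def, Real.coe_toNNReal _ (pow_nonneg (le_of_lt hx) _), smul_eq_mul]
      · exact (measurable_subtype_coe.pow_const _).real_toNNReal

/-- Both terms integrate by parts to the same integral over `u`, because the coordinate `x i` does not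
depend on the coordinates `j` and `k`. -/
lemma integral_coord_mul_wedge {u v : E3 → ℝ} (hu : ContDiff ℝ ∞ u) (hv : ContDiff ℝ ∞ v)
    (hcu : HasCompactSupport u) {i j k : Fin 3} (hij : i ≠ j)
    (hik : i ≠ k) :
    ∫ x : E3, x i * (fderiv ℝ u x (bas j) * fderiv ℝ v x (bas k)
      - fderiv ℝ u x (bas k) * fderiv ℝ v x (bas j)) = 0 := by
  have hv' : ∀ k, ContDiff ℝ ∞ fun x => fderiv ℝ v x (bas k) := fun k =>
    (hv.fderiv_right (by simp)).clm_apply contDiff_const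
  have hu' : ∀ k, ContDiff ℝ ∞ fun x => fderiv ℝ u x (bas k) := fun k =>
    (hu.fderiv_right (by simp)).clm_apply contDiff_const
  have hcu' : ∀ k, HasCompactSupport fun x => fderiv ℝ u x (bas k) := fun k =>
    hcu.fderiv_apply (𝕜 := ℝ) (bas k)
  have hx : ContDiff ℝ ∞ fun x : E3 => x i := by fun_prop
  have hint : ∀ j k, Integrable fun x : E3 => fderiv ℝ u x (bas j)
      * (x i * fderiv ℝ v x (bas k)) := fun j k =>
    ((hu' j).continuous.mul (hx.continuous.mul (hv' k).continuous)).integrable_of_hasCompactSupport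
      (hcu' j).mul_right
  have hD : ∀ j k, i ≠ j → ∀ x, fderiv ℝ (fun x : E3 => x i * fderiv ℝ v x (bas k)) x (bas j)
      = x i * fderiv ℝ (fderiv ℝ v) x (bas j) (bas k) := by
    intro j k hij x
    have hvd : DifferentiableAt ℝ (fderiv ℝ v) x :=
      (hv.fderiv_right (m := ∞) (by simp)).contDiffAt.differentiableAt (by simp)
    have h1 : HasFDerivAt (fun x => fderiv ℝ v x (bas k))
        ((ContinuousLinearMap.apply ℝ ℝ (bas k)).comp (fderiv ℝ (fderiv ℝ v) x)) x :=
      (ContinuousLinearMap.apply ℝ ℝ (bas k)).hasFDerivAt.comp x hvd.hasFDerivAt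
    have h2 : HasFDerivAt (fun x : E3 => x i) (EuclideanSpace.proj (𝕜 := ℝ) i) x :=
      (EuclideanSpace.proj i : E3 →L[ℝ] ℝ).hasFDerivAt
    have h3 : HasFDerivAt (fun x : E3 => x i * fderiv ℝ v x (bas k)) _ x := h2.mul h1
    rw [h3.fderiv]
    simp [bas, hij]
  have hparts : ∀ j k, i ≠ j → ∫ x : E3, fderiv ℝ u x (bas j) * (x i * fderiv ℝ v x (bas k))
      = - ∫ x : E3, u x * (x i * fderiv ℝ (fderiv ℝ v) x (bas j) (bas k)) := by
    intro j k hij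
    have hG : ContDiff ℝ ∞ fun x : E3 => x i * fderiv ℝ v x (bas k) := hx.mul (hv' k)
    have hG' : ContDiff ℝ ∞ fun x : E3 =>
        fderiv ℝ (fun x : E3 => x i * fderiv ℝ v x (bas k)) x (bas j) :=
      (hG.fderiv_right (by simp)).clm_apply contDiff_const
    have := integral_mul_fderiv_eq_neg_fderiv_mul_of_integrable (μ := (volume : Measure E3))
      (f := u) (g := fun x : E3 => x i * fderiv ℝ v x (bas k)) (v := bas j) (hint j k)
      ((hu.continuous.mul hG'.continuous).integrable_of_hasCompactSupport hcu.mul_right)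
      ((hu.continuous.mul hG.continuous).integrable_of_hasCompactSupport hcu.mul_right)
      (fun x _ => hu.contDiffAt.differentiableAt (by simp))
      (fun x _ => hG.contDiffAt.differentiableAt (by simp))
    rw [eq_neg_iff_add_eq_zero, add_comm, ← eq_neg_iff_add_eq_zero, ← this]
    simp only [hD j k hij]
  have hsymm : ∀ x, fderiv ℝ (fderiv ℝ v) x (bas j) (bas k)
      = fderiv ℝ (fderiv ℝ v) x (bas k) (bas j) := fun x =>
    hv.contDiffAt.isSymmSndFDerivAt (by simpa using two_le_infty) _ _
  calc _ = ∫ x : E3, (fderiv ℝ u x (bas j) * (x i * fderiv ℝ v x (bas k))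
        - fderiv ℝ u x (bas k) * (x i * fderiv ℝ v x (bas j))) := by
        congr 1; ext x; ring
    _ = 0 := by
        rw [integral_sub (hint j k) (hint k j), hparts j k hij, hparts k j hik]
        simp only [hsymm, sub_self]

lemma integral_wedge_fderiv_of_hasCompactSupport {u v : E3 → ℝ} (hu : ContDiff ℝ ∞ u)
    (hv : ContDiff ℝ ∞ v) (hcu : HasCompactSupport u) :
    ∫ x : E3, wedge x (fderiv ℝ u x) (fderiv ℝ v x) = 0 := by
  have hu' : ∀ k, Continuous fun x => fderiv ℝ u x (bas k) := fun k =>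
    ((hu.fderiv_right (m := ∞) (by simp)).clm_apply contDiff_const).continuous
  have hv' : ∀ k, Continuous fun x => fderiv ℝ v x (bas k) := fun k =>
    ((hv.fderiv_right (m := ∞) (by simp)).clm_apply contDiff_const).continuous
  have hcu' : ∀ k, HasCompactSupport fun x => fderiv ℝ u x (bas k) := fun k =>
    hcu.fderiv_apply (𝕜 := ℝ) (bas k)
  have hint : ∀ i j k, Integrable fun x : E3 => x i * (fderiv ℝ u x (bas j)
      * fderiv ℝ v x (bas k) - fderiv ℝ u x (bas k) * fderiv ℝ v x (bas j)) := by
    intro i j k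
    have hx : Continuous fun x : E3 => x i := by fun_prop
    refine (hx.mul (((hu' j).mul (hv' k)).sub ((hu' k).mul (hv' j)))).integrable_of_hasCompactSupport
      (HasCompactSupport.mul_left ?_)
    exact ((hcu' j).mul_right).sub ((hcu' k).mul_right)
  simp only [wedge]
  rw [integral_add (f := fun x : E3 =>
      x 0 * (fderiv ℝ u x (bas 1) * fderiv ℝ v x (bas 2)
        - fderiv ℝ u x (bas 2) * fderiv ℝ v x (bas 1))
      + x 1 * (fderiv ℝ u x (bas 2) * fderiv ℝ v x (bas 0)
        - fderiv ℝ u x (bas 0) * fderiv ℝ v x (bas 2)))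
      ((hint 0 1 2).add (hint 1 2 0)) (hint 2 0 1),
    integral_add (hint 0 1 2) (hint 1 2 0),
    integral_coord_mul_wedge hu hv hcu (by decide) (by decide),
    integral_coord_mul_wedge hu hv hcu (by decide) (by decide),
    integral_coord_mul_wedge hu hv hcu (by decide) (by decide)]
  simp

/-- **Stokes' theorem on the unit sphere** for the exact two-form `dα ∧ dβ`. The functions are
multiplied by a radial cutoff, which turns the claim into an integration by parts in space. -/
theorem integral_wedge_eq_zero {α β : E3 → ℝ} (hα : Radial α) (hβ : Radial β) :
    ∫ p : S2, wedge p (fderiv ℝ α p) (fderiv ℝ β p) ∂sphereMeasure = 0 := by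
  -- A cutoff around the unit sphere: it is supported where `1 ≤ ‖x‖ ^ 2 ≤ 3`.
  let χ : ContDiffBump (2 : ℝ) := ⟨1 / 2, 1, by norm_num, by norm_num⟩
  let ρ : E3 → ℝ := fun x => χ (‖x‖ ^ 2)
  have hρ : ContDiff ℝ ∞ ρ := χ.contDiff.comp (contDiff_norm_sq ℝ)
  have hρ0 : ∀ x : E3, ‖x‖ < 1 → ρ x = 0 := by
    intro x hx
    apply χ.zero_of_le_dist
    have : ‖x‖ ^ 2 < 1 := by nlinarith [norm_nonneg x]
    rw [Real.dist_eq, abs_sub_comm, abs_of_pos (by linarith)]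
    show (1 : ℝ) ≤ _
    linarith
  have hρc : HasCompactSupport ρ := by
    refine HasCompactSupport.of_support_subset_isCompact (isCompact_closedBall (0 : E3) 2) ?_
    intro x hx
    by_contra hn
    apply hx
    have h2 : 2 < ‖x‖ := by simpa using hn
    apply χ.zero_of_le_dist
    rw [Real.dist_eq, abs_of_pos (by nlinarith)]
    show (1 : ℝ) ≤ _
    nlinarith
  have hρr : ∀ x a : E3, inner ℝ x a = 0 → fderiv ℝ ρ x a = 0 := by
    intro x a hxa
    have h1 : HasFDerivAt ρ ((fderiv ℝ χ (‖x‖ ^ 2)).comp (2 • (innerSL ℝ x))) x :=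
      (χ.contDiff (n := 1).contDiffAt.differentiableAt (by simp)).hasFDerivAt.comp x
        (hasStrictFDerivAt_norm_sq x).hasFDerivAt
    rw [h1.fderiv]
    simp [hxa]
  have hext : ∀ {γ : E3 → ℝ}, Radial γ → ContDiff ℝ ∞ fun x => ρ x * γ x := by
    intro γ hγ
    rw [contDiff_iff_contDiffAt]
    intro x
    by_cases hx : x = 0
    · subst hx
      refine (contDiffAt_const (c := (0 : ℝ))).congr_of_eventuallyEq ?_
      filter_upwards [Metric.ball_mem_nhds (0 : E3) one_pos] with y hy
      rw [hρ0 y (by simpa using hy), zero_mul]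
    · exact hρ.contDiffAt.mul (hγ.smooth x hx)
  have hder : ∀ {γ : E3 → ℝ}, Radial γ → ∀ (p : E3), p ≠ 0 → ∀ r : ℝ, 0 < r → ∀ a : E3,
      inner ℝ p a = 0 → fderiv ℝ (fun x => ρ x * γ x) (r • p) a
        = ρ (r • p) * (r⁻¹ * fderiv ℝ γ p a) := by
    intro γ hγ p hp r hr a hpa
    have h1 : HasFDerivAt (fun x => ρ x * γ x) _ (r • p) :=
      (hρ.contDiffAt.differentiableAt (x := r • p) (by simp)).hasFDerivAt.mul
      (hγ.differentiableAt (x := r • p) (smul_ne_zero hr.ne' hp)).hasFDerivAt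
    rw [h1.fderiv, hγ.fderiv_smul hr]
    simp [hρr (r • p) a (by rw [real_inner_smul_left, hpa, mul_zero])]
  -- The cutoff is constant in the tangential directions, so at `r • p` the two-form of the cut off
  -- functions is `ρ ^ 2 / r` times the two-form of `α` and `β` at `p`.
  have hpol := integral_polar (ψ := fun x => wedge x (fderiv ℝ (fun x => ρ x * α x) x)
      (fderiv ℝ (fun x => ρ x * β x) x)) (φ := fun p : S2 => wedge p (fderiv ℝ α p) (fderiv ℝ β p))
      (g := fun r => χ (r ^ 2) ^ 2 * r⁻¹) (by
    intro p r hr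
    obtain ⟨e₁, e₂, hF⟩ := exists_oframe (norm_coe_S2 p)
    have hρp : ρ (r • (p : E3)) = χ (r ^ 2) := by
      show χ (‖r • (p : E3)‖ ^ 2) = _
      rw [norm_smul, norm_coe_S2, Real.norm_of_nonneg hr.le, mul_one]
    have h1 : r • (p : E3) = cross (r • e₁) e₂ := by
      rw [← hF.cross_eq, cross, cross, map_smul, _root_.smul_apply]
    have h3 : wedge (p : E3) (fderiv ℝ α p) (fderiv ℝ β p) =
        fderiv ℝ α p e₁ * fderiv ℝ β p e₂ - fderiv ℝ α p e₂ * fderiv ℝ β p e₁ := by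
      rw [← wedge_cross, hF.cross_eq]
    rw [h3]
    have h4 : ∀ A B : E3 →L[ℝ] ℝ,
        wedge (r • (p : E3)) A B = A (r • e₁) * B e₂ - A e₂ * B (r • e₁) := fun A B => by
      rw [h1, wedge_cross]
    rw [h4, map_smul, map_smul, hder hα _ (coe_S2_ne_zero p) r hr _ hF.inner_p_e₁,
      hder hα _ (coe_S2_ne_zero p) r hr _ hF.inner_p_e₂,
      hder hβ _ (coe_S2_ne_zero p) r hr _ hF.inner_p_e₁,
      hder hβ _ (coe_S2_ne_zero p) r hr _ hF.inner_p_e₂, hρp, smul_eq_mul, smul_eq_mul]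
    field_simp)
  rw [integral_wedge_fderiv_of_hasCompactSupport (hext hα) (hext hβ) hρc.mul_right] at hpol
  rcases mul_eq_zero.mp hpol.symm with h | h
  · exact h
  · exfalso
    -- The radial factor is the integral of `r * χ (r ^ 2) ^ 2` over the half-line, which is positive.
    have hχ : Continuous χ := χ.contDiff (n := 1).continuous
    have hpos : 0 < ∫ r : ℝ, |r| * χ (|r| ^ 2) ^ 2 := by
      refine Continuous.integral_pos_of_hasCompactSupport_nonneg_nonzero (x := √2) (by fun_prop) ?_
        (fun r => by positivity) ?_
      · refine HasCompactSupport.of_support_subset_isCompact (isCompact_Icc (a := -2) (b := 2)) ?_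
        intro r hr
        by_contra hn
        apply hr
        have h2 : 2 < |r| := by
          by_contra h'
          exact hn (abs_le.mp (not_lt.mp h'))
        have : χ (|r| ^ 2) = 0 := by
          apply χ.zero_of_le_dist
          rw [Real.dist_eq, abs_of_pos (by nlinarith)]
          show (1 : ℝ) ≤ _
          nlinarith
        show |r| * χ (|r| ^ 2) ^ 2 = 0
        rw [this]; ring
      · have : χ (|√2| ^ 2) = 1 := by
          apply χ.one_of_mem_closedBall
          simp [χ]
        rw [this]
        positivity
    rw [integral_comp_abs (f := fun r => r * χ (r ^ 2) ^ 2)] at hpos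
    have : ∫ r in Ioi (0 : ℝ), r ^ 2 * (χ (r ^ 2) ^ 2 * r⁻¹)
        = ∫ r in Ioi (0 : ℝ), r * χ (r ^ 2) ^ 2 := by
      refine setIntegral_congr_fun measurableSet_Ioi fun r hr => ?_
      have hr0 : r ≠ 0 := (mem_Ioi.mp hr).ne'
      field_simp
    rw [this] at h
    rw [h] at hpos
    simp at hpos

/-! ### Ovals: normal field, second fundamental form and Gauss map -/

/-- The normal field `∂₁f × ∂₂f` of the surface with radially constant parametrization `f`, where
the derivatives are taken along an oriented orthonormal basis of the tangent plane of the unit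
sphere at `x`. It is written without choosing such a basis, so that it is smooth in `x`. -/
def normalField (f : E3 → E3) (x : E3) : E3 :=
  x 0 • cross (fderiv ℝ f x (bas 1)) (fderiv ℝ f x (bas 2))
    + x 1 • cross (fderiv ℝ f x (bas 2)) (fderiv ℝ f x (bas 0))
    + x 2 • cross (fderiv ℝ f x (bas 0)) (fderiv ℝ f x (bas 1))

lemma normalField_eq (f : E3 → E3) {p e₁ e₂ : E3} (h : OFrame p e₁ e₂) :
    normalField f p = cross (fderiv ℝ f p e₁) (fderiv ℝ f p e₂) := by
  rw [cross_map, h.cross_eq, normalField]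

/-- The second fundamental form with respect to the (not normalized) normal field. -/
def secondForm (f : E3 → E3) (p a b : E3) : ℝ :=
  inner ℝ (fderiv ℝ (fderiv ℝ f) p a b) (normalField f p)

/-- An oval: a closed surface, given by a radially constant parametrization, whose second
fundamental form with respect to `normalField` is negative definite. It is automatically an
immersed surface, and `normalField` turns out to be its outward normal. -/
structure Oval (f : E3 → E3) : Prop where
  radial : Radial f
  neg : ∀ p : E3, ‖p‖ = 1 → ∀ a : E3, inner ℝ a p = 0 → a ≠ 0 → secondForm f p a a < 0

namespace Radial

variable {f : E3 → E3}

lemma contDiffAt_normalField (hf : Radial f) {x : E3} (hx : x ≠ 0) :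
    ContDiffAt ℝ ∞ (normalField f) x := by
  have h : ∀ i, ContDiffAt ℝ ∞ (fun x => fderiv ℝ f x (bas i)) x := fun i =>
    (hf.contDiffAt_fderiv hx).clm_apply contDiffAt_const
  have hc : ∀ i j, ContDiffAt ℝ ∞
      (fun x => cross (fderiv ℝ f x (bas i)) (fderiv ℝ f x (bas j))) x := fun i j =>
    ((contDiffAt_const (c := crossL)).clm_apply (h i)).clm_apply (h j)
  have hx : ∀ i, ContDiffAt ℝ ∞ (fun x : E3 => x i) x := fun i => by fun_prop
  exact (((hx 0).smul (hc 1 2)).add ((hx 1).smul (hc 2 0))).add ((hx 2).smul (hc 0 1))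

lemma inner_fderiv_normalField (hf : Radial f) {p : E3} (hp : ‖p‖ = 1) (a : E3) :
    inner ℝ (fderiv ℝ f p a) (normalField f p) = 0 := by
  obtain ⟨e₁, e₂, hF⟩ := exists_oframe hp
  rw [normalField_eq f hF, hF.expansion a]
  simp only [map_add, map_smul, hf.fderiv_self (ne_zero_of_norm_one hp), inner_add_left,
    real_inner_smul_left, smul_zero, inner_zero_left]
  simp [inner_left_cross, inner_right_cross]

end Radial

lemma Oval.normalField_ne_zero {f : E3 → E3} (hf : Oval f) {p : E3} (hp : ‖p‖ = 1) :
    normalField f p ≠ 0 := by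
  obtain ⟨e₁, e₂, hF⟩ := exists_oframe hp
  intro h0
  have := hf.neg p hp e₁ hF.inner_e₁_p hF.e₁_ne
  simp [secondForm, h0] at this

lemma Oval.immersion {f : E3 → E3} (hf : Oval f) {p a : E3} (hp : ‖p‖ = 1)
    (ha : inner ℝ a p = 0) (h : fderiv ℝ f p a = 0) : a = 0 := by
  obtain ⟨e₁, e₂, hF⟩ := exists_oframe hp
  have hN := hf.normalField_ne_zero hp
  rw [normalField_eq f hF] at hN
  have hexp := hF.expansion_tangent ha
  rw [hexp, map_add, map_smul, map_smul] at h
  have h1 := congrArg (fun v => cross v (fderiv ℝ f p e₂)) h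
  have h2 := congrArg (fun v => cross (fderiv ℝ f p e₁) v) h
  have hself : ∀ v : E3, cross v v = 0 := fun v => by
    apply E3.ext_coord <;> simp <;> ring
  simp only [cross, map_add, map_smul, _root_.add_apply, _root_.smul_apply, map_zero,
    _root_.zero_apply] at h1 h2
  simp only [hself, smul_zero, add_zero, zero_add] at h1 h2
  rw [hexp, (smul_eq_zero.mp h1).resolve_right hN, (smul_eq_zero.mp h2).resolve_right hN]
  simp

/-- The Gauss map, extended to be radially constant. -/
def gaussMap (f : E3 → E3) (x : E3) : E3 :=
  ‖normalField f (‖x‖⁻¹ • x)‖⁻¹ • normalField f (‖x‖⁻¹ • x)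

lemma gaussMap_of_norm_one (f : E3 → E3) {p : E3} (hp : ‖p‖ = 1) :
    gaussMap f p = ‖normalField f p‖⁻¹ • normalField f p := by
  simp [gaussMap, hp]

namespace Oval

variable {f : E3 → E3} (hf : Oval f)
include hf

lemma radial_gaussMap : Radial (gaussMap f) :=
  radial_normalize (g := fun x => ‖normalField f x‖⁻¹ • normalField f x) fun _ hp =>
    have h := hf.radial.contDiffAt_normalField (ne_zero_of_norm_one hp)
    ((h.norm ℝ (hf.normalField_ne_zero hp)).inv
      (norm_ne_zero_iff.mpr (hf.normalField_ne_zero hp))).smul h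

lemma norm_gaussMap {x : E3} (hx : x ≠ 0) : ‖gaussMap f x‖ = 1 :=
  norm_normalize (hf.normalField_ne_zero (norm_normalize hx))

lemma inner_fderiv_gaussMap {x : E3} (hx : x ≠ 0) (a : E3) :
    inner ℝ (fderiv ℝ f x a) (gaussMap f x) = 0 := by
  have hn : 0 < ‖x‖ := norm_pos_iff.mpr hx
  have h1 : x = ‖x‖ • (‖x‖⁻¹ • x) := by rw [smul_smul, mul_inv_cancel₀ hn.ne', one_smul]
  have h2 : fderiv ℝ f x = ‖x‖⁻¹ • fderiv ℝ f (‖x‖⁻¹ • x) := by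
    conv_lhs => rw [h1]
    exact hf.radial.fderiv_smul hn _
  rw [h2, gaussMap, _root_.smul_apply, real_inner_smul_left, real_inner_smul_right,
    hf.radial.inner_fderiv_normalField (norm_normalize hx)]
  simp

/-- The Weingarten equation. -/
lemma inner_fderiv_fderiv_gaussMap {x : E3} (hx : x ≠ 0) (a b : E3) :
    inner ℝ (fderiv ℝ (fderiv ℝ f) x a b) (gaussMap f x)
      = - inner ℝ (fderiv ℝ f x b) (fderiv ℝ (gaussMap f) x a) := by
  have h1 : HasFDerivAt (fun y => fderiv ℝ f y b)
      ((ContinuousLinearMap.apply ℝ E3 b).comp (fderiv ℝ (fderiv ℝ f) x)) x :=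
    (ContinuousLinearMap.apply ℝ E3 b).hasFDerivAt.comp x
      (hf.radial.differentiableAt_fderiv hx).hasFDerivAt
  have h2 := (hf.radial_gaussMap.differentiableAt hx).hasFDerivAt
  have h3 := h1.inner ℝ h2
  have h4 : (fun y => inner ℝ (fderiv ℝ f y b) (gaussMap f y)) =ᶠ[𝓝 x] fun _ => (0 : ℝ) := by
    filter_upwards [isOpen_compl_singleton.mem_nhds (show x ∈ ({0}ᶜ : Set E3) from hx)] with y hy
    exact hf.inner_fderiv_gaussMap hy b
  have h5 := (h3.congr_of_eventuallyEq h4.symm).unique (hasFDerivAt_const (0 : ℝ) x)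
  have h6 := congrArg (fun A : E3 →L[ℝ] ℝ => A a) h5
  simp [fderivInnerCLM_apply] at h6
  linarith

lemma inner_fderiv_gaussMap_self {x : E3} (hx : x ≠ 0) (a : E3) :
    inner ℝ (gaussMap f x) (fderiv ℝ (gaussMap f) x a) = 0 := by
  have h2 := (hf.radial_gaussMap.differentiableAt hx).hasFDerivAt
  have h3 := h2.inner ℝ h2
  have h4 : (fun y => inner ℝ (gaussMap f y) (gaussMap f y)) =ᶠ[𝓝 x] fun _ => (1 : ℝ) := by
    filter_upwards [isOpen_compl_singleton.mem_nhds (show x ∈ ({0}ᶜ : Set E3) from hx)] with y hy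
    rw [real_inner_self_eq_norm_sq, hf.norm_gaussMap hy, one_pow]
  have h5 := (h3.congr_of_eventuallyEq h4.symm).unique (hasFDerivAt_const (1 : ℝ) x)
  have h6 := congrArg (fun A : E3 →L[ℝ] ℝ => A a) h5
  simp [fderivInnerCLM_apply] at h6
  rw [real_inner_comm (gaussMap f x)] at h6
  linarith [real_inner_comm (gaussMap f x) (fderiv ℝ (gaussMap f) x a)]

lemma secondForm_eq {p : E3} (hp : ‖p‖ = 1) (a b : E3) :
    secondForm f p a b
      = - ‖normalField f p‖ * inner ℝ (fderiv ℝ f p b) (fderiv ℝ (gaussMap f) p a) := by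
  have h := hf.inner_fderiv_fderiv_gaussMap (ne_zero_of_norm_one hp) a b
  have hn : ‖normalField f p‖ ≠ 0 := norm_ne_zero_iff.mpr (hf.normalField_ne_zero hp)
  rw [gaussMap_of_norm_one f hp, real_inner_smul_right] at h
  have : secondForm f p a b = ‖normalField f p‖ * (‖normalField f p‖⁻¹ * secondForm f p a b) := by
    rw [← mul_assoc, mul_inv_cancel₀ hn, one_mul]
  rw [this, secondForm, h]
  ring

lemma fderiv_gaussMap_injective {p : E3} (hp : ‖p‖ = 1) {a : E3} (ha : inner ℝ a p = 0)
    (h : fderiv ℝ (gaussMap f) p a = 0) : a = 0 := by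
  by_contra h0
  have h1 := hf.neg p hp a ha h0
  rw [hf.secondForm_eq hp, h] at h1
  simp at h1

end Oval

/-! ### The Gauss map of an oval is injective -/

/-- The radial projection onto the unit sphere (with an arbitrary value at the origin). -/
def sphereProj (x : E3) : S2 :=
  if h : x = 0 then ⟨bas 0, by simp⟩ else ⟨‖x‖⁻¹ • x, by simpa using norm_normalize h⟩

lemma coe_sphereProj {x : E3} (hx : x ≠ 0) : (sphereProj x : E3) = ‖x‖⁻¹ • x := by
  simp [sphereProj, hx]

lemma sphereProj_coe (p : S2) : sphereProj p = p := by
  apply Subtype.ext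
  rw [coe_sphereProj (coe_S2_ne_zero p), norm_coe_S2, inv_one, one_smul]

lemma sphereProj_smul {r : ℝ} (hr : 0 < r) (x : E3) : sphereProj (r • x) = sphereProj x := by
  by_cases hx : x = 0
  · simp [hx]
  · apply Subtype.ext
    rw [coe_sphereProj hx, coe_sphereProj (smul_ne_zero hr.ne' hx), norm_smul,
      Real.norm_of_nonneg hr.le, smul_smul, mul_inv, mul_assoc, mul_comm _ r, ← mul_assoc,
      inv_mul_cancel₀ hr.ne', one_mul]

lemma continuousAt_sphereProj {x : E3} (hx : x ≠ 0) : ContinuousAt sphereProj x := by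
  rw [Topology.IsInducing.subtypeVal.continuousAt_iff]
  have h : ContinuousAt (fun x : E3 => ‖x‖⁻¹ • x) x :=
    (continuousAt_id.norm.inv₀ (norm_ne_zero_iff.mpr hx)).smul continuousAt_id
  refine h.congr ?_
  filter_upwards [isOpen_compl_singleton.mem_nhds (show x ∈ ({0}ᶜ : Set E3) from hx)] with y hy
  exact (coe_sphereProj hy).symm

lemma one_lt_finrank_E3 : 1 < Module.rank ℝ E3 := by
  rw [← Module.finrank_eq_rank ℝ E3, finrank_euclideanSpace_fin]; norm_num

instance : Nonempty S2 := ⟨⟨bas 0, by simp⟩⟩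

/-- The complement of a finite subset of the two-sphere is connected. -/
lemma isPreconnected_compl_finite {F : Set S2} (hF : F.Finite) : IsPreconnected Fᶜ := by
  rcases F.eq_empty_or_nonempty with rfl | ⟨q, hq⟩
  · have : PreconnectedSpace S2 :=
      Subtype.preconnectedSpace (isPreconnected_sphere one_lt_finrank_E3 (0 : E3) 1)
    rw [compl_empty]
    exact isPreconnected_univ
  · have hv : ‖(q : E3)‖ = 1 := norm_coe_S2 q
    set s := (stereographic hv).symm with hs
    have hemb := isOpenEmbedding_stereographic_symm hv
    have hsub : Fᶜ ⊆ range s := by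
      rw [hs, range_stereographic_symm hv q.2]
      intro x hx hxq
      exact hx (by rwa [mem_singleton_iff.mp hxq])
    rw [← image_preimage_eq_of_subset hsub, preimage_compl]
    refine IsPreconnected.image ?_ _ hemb.continuous.continuousOn
    have : Fact (Module.finrank ℝ E3 = 2 + 1) := ⟨by simp⟩
    have hrank : 1 < Module.rank ℝ (ℝ ∙ (q : E3))ᗮ := by
      rw [← Module.finrank_eq_rank,
        Submodule.finrank_orthogonal_span_singleton (n := 2) (coe_S2_ne_zero q)]
      norm_num
    exact (Set.Countable.isPathConnected_compl_of_one_lt_rank hrank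
      (hF.preimage hemb.injective.injOn).countable).isConnected.isPreconnected

/-- A local homeomorphism of the two-sphere to itself is injective. It is a covering map, and over
the sphere without a point, which is simply connected, it has a section through every point of a
fibre. The preimage of the sphere without a point is connected, so such a section is onto. -/
theorem injective_of_isLocalHomeomorph {g : S2 → S2} (hg : IsLocalHomeomorph g) :
    Function.Injective g := by
  have cov : IsCoveringMap g := isLocalHomeomorph_iff_isCoveringMap.mp hg
  intro x y hxy
  have hv : ‖((-(g x) : S2) : E3)‖ = 1 := norm_coe_S2 _
  have hne : g x ≠ -(g x) := ne_neg_of_mem_unit_sphere ℝ _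
  -- The point that is removed from the sphere is the antipode of the common value.
  set v : S2 := -(g x) with hvdef
  have hfin : (g ⁻¹' {v}).Finite := by
    have : DiscreteTopology (g ⁻¹' {v}) := (cov v).1
    exact (isClosed_singleton.preimage cov.continuous).isCompact.finite ⟨this⟩
  set st := stereographic hv with hst
  let σ : C((ℝ ∙ (v : E3))ᗮ, S2) :=
    ⟨st.symm, (isOpenEmbedding_stereographic_symm hv).continuous⟩
  have hsrc : ∀ z : S2, z ≠ v → z ∈ st.source := fun z hz => by
    rw [hst, stereographic_source]
    exact hz
  have hσ : ∀ z : S2, z ≠ v → σ (st z) = z := fun z hz => st.left_inv (hsrc z hz)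
  obtain ⟨l, ⟨hl0, hl⟩, -⟩ := cov.existsUnique_continuousMap_lifts σ (st (g x)) x (hσ _ hne).symm
  have hgl : ∀ a, g (l a) = σ a := fun a => congrFun hl a
  -- On the connected preimage both `l ∘ st ∘ g` and the identity lift `g`, and they agree at `x`.
  have heq : EqOn (fun z => l (st (g z))) id (g ⁻¹' {v})ᶜ := by
    refine cov.eqOn_of_comp_eqOn (isPreconnected_compl_finite hfin) ?_ continuousOn_id
      (fun z hz => ?_) (a := x) hne hl0
    · exact l.continuous.comp_continuousOn
        (st.continuousOn.comp cov.continuous.continuousOn fun z hz => hsrc _ hz)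
    · simp only [Function.comp, id, hgl]
      exact hσ _ hz
  have h1 : l (st (g y)) = y := heq (x := y) (by
    rw [mem_compl_iff, mem_preimage, ← hxy]; exact hne)
  rw [← h1, ← hxy, hl0]

/-- The Gauss map of an oval, as a map of the unit sphere. -/
def gaussMapSphere (f : E3 → E3) (p : S2) : S2 := sphereProj (gaussMap f p)

namespace Oval

variable {f : E3 → E3} (hf : Oval f)
include hf

lemma coe_gaussMapSphere (p : S2) : (gaussMapSphere f p : E3) = gaussMap f p := by
  have h := hf.norm_gaussMap (coe_S2_ne_zero p)
  rw [gaussMapSphere, coe_sphereProj (ne_zero_of_norm_one h), h, inv_one, one_smul]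

lemma continuous_gaussMapSphere : Continuous (gaussMapSphere f) := by
  rw [Topology.IsInducing.subtypeVal.continuous_iff]
  have : Continuous fun p : S2 => gaussMap f p := continuous_iff_continuousAt.mpr fun p =>
    ContinuousAt.comp (g := gaussMap f) (f := fun p : S2 => (p : E3))
      (hf.radial_gaussMap.smooth _ (coe_S2_ne_zero p)).continuousAt
      continuous_subtype_val.continuousAt
  exact this.congr fun p => (hf.coe_gaussMapSphere p).symm

/-- The inverse function theorem is applied to the extension of the Gauss map that is homogeneous
of degree one, which preserves the norm. -/
lemma isLocalHomeomorph_gaussMapSphere : IsLocalHomeomorph (gaussMapSphere f) := by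
  let G : E3 → E3 := fun x => ‖x‖ • gaussMap f x
  have hGn : ∀ x, ‖G x‖ = ‖x‖ := by
    intro x
    by_cases hx : x = 0
    · simp [G, hx]
    · simp [G, norm_smul, hf.norm_gaussMap hx]
  have hGS : ∀ p : S2, (gaussMapSphere f p : E3) = G p := fun p => by
    rw [hf.coe_gaussMapSphere]; simp [G]
  refine IsLocalHomeomorph.mk _ fun p => ?_
  have hp0 := coe_S2_ne_zero p
  have hp1 := norm_coe_S2 p
  have hsm : ContDiffAt ℝ ∞ G p :=
    (contDiffAt_norm ℝ hp0).smul (hf.radial_gaussMap.smooth _ hp0)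
  have hder : ∀ y, fderiv ℝ G p y
      = inner ℝ (p : E3) y • gaussMap f p + fderiv ℝ (gaussMap f) p y := by
    intro y
    have h1 : HasFDerivAt (fun x : E3 => ‖x‖) (innerSL ℝ (p : E3)) (p : E3) := by
      have h2 : HasFDerivAt (fun x : E3 => √(‖x‖ ^ 2)) _ (p : E3) :=
        (hasStrictFDerivAt_norm_sq (p : E3)).hasFDerivAt.sqrt (by simp)
      convert! h2 using 1
      · ext x; simp
      · ext y; simp
    have h3 : HasFDerivAt G _ (p : E3) :=
      h1.smul (hf.radial_gaussMap.differentiableAt hp0).hasFDerivAt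
    rw [h3.fderiv]
    simp [add_comm]
  have hinj : Function.Injective (fderiv ℝ G p : E3 →ₗ[ℝ] E3) := by
    rw [← LinearMap.ker_eq_bot, LinearMap.ker_eq_bot']
    intro y hy
    have hy' : inner ℝ (p : E3) y • gaussMap f p + fderiv ℝ (gaussMap f) p y = 0 := by
      rw [← hder]; exact hy
    have h1 := congrArg (fun v => inner ℝ (gaussMap f p) v) hy'
    simp only [inner_add_right, real_inner_smul_right, real_inner_self_eq_norm_sq,
      hf.norm_gaussMap hp0, hf.inner_fderiv_gaussMap_self hp0, inner_zero_right] at h1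
    have h2 : inner ℝ (p : E3) y = 0 := by linarith
    rw [h2, zero_smul, zero_add] at hy'
    exact hf.fderiv_gaussMap_injective hp1 (by rw [real_inner_comm]; exact h2) hy'
  let A : E3 ≃L[ℝ] E3 := (LinearEquiv.ofInjectiveEndo _ hinj).toContinuousLinearEquiv
  have hA : HasFDerivAt G (A : E3 →L[ℝ] E3) p := by
    have : (A : E3 →L[ℝ] E3) = fderiv ℝ G p := by ext y; rfl
    rw [this]
    exact (hsm.differentiableAt (by simp)).hasFDerivAt
  let e := hsm.toOpenPartialHomeomorph G hA (by simp)
  have heG : ∀ x, e x = G x := fun x => rfl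
  have hinv : ∀ y : S2, (y : E3) ∈ e.target → ((sphereProj (e.symm y) : S2) : E3) = e.symm y := by
    intro y hy
    have h1 : ‖e.symm y‖ = 1 := by
      rw [← hGn, ← heG, e.right_inv hy, norm_coe_S2]
    rw [coe_sphereProj (ne_zero_of_norm_one h1), h1, inv_one, one_smul]
  refine ⟨{ toFun := gaussMapSphere f
            invFun := fun y => sphereProj (e.symm y)
            source := (fun q : S2 => (q : E3)) ⁻¹' e.source
            target := (fun q : S2 => (q : E3)) ⁻¹' e.target
            map_source' := fun q hq => ?_
            map_target' := fun y hy => ?_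
            left_inv' := fun q hq => ?_
            right_inv' := fun y hy => ?_
            open_source := e.open_source.preimage continuous_subtype_val
            open_target := e.open_target.preimage continuous_subtype_val
            continuousOn_toFun := hf.continuous_gaussMapSphere.continuousOn
            continuousOn_invFun := fun y hy => ContinuousAt.continuousWithinAt ?_ },
    hsm.mem_toOpenPartialHomeomorph_source hA (by simp), fun q _ => rfl⟩
  · rw [mem_preimage, hGS, ← heG]
    exact e.map_source hq
  · rw [mem_preimage, hinv y hy]
    exact e.map_target hy
  · rw [hGS, ← heG, e.left_inv hq, sphereProj_coe]
  · apply Subtype.ext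
    rw [hGS, hinv y hy, ← heG, e.right_inv hy]
  · have h1 : ‖e.symm y‖ = 1 := by
      rw [← hGn, ← heG, e.right_inv hy, norm_coe_S2]
    exact ContinuousAt.comp (g := sphereProj) (f := fun y : S2 => e.symm y)
      (continuousAt_sphereProj (ne_zero_of_norm_one h1))
      (ContinuousAt.comp (g := e.symm) (f := fun y : S2 => (y : E3)) (e.symm.continuousAt hy)
        continuous_subtype_val.continuousAt)

lemma gaussMap_injective {p q : S2} (h : gaussMap f p = gaussMap f q) : p = q :=
  injective_of_isLocalHomeomorph hf.isLocalHomeomorph_gaussMapSphere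
    (Subtype.ext (by rw [hf.coe_gaussMapSphere, hf.coe_gaussMapSphere, h]))

/-! ### Strict convexity of ovals -/

/-- At a maximum of the height in the direction `e`, the normal is `e`. -/
lemma gaussMap_eq_of_isMax {q : S2} {e : E3} (he : ‖e‖ = 1)
    (hmax : ∀ x : S2, inner ℝ (f x) e ≤ inner ℝ (f q) e) : gaussMap f q = e := by
  have hq0 := coe_S2_ne_zero q
  have hq1 := norm_coe_S2 q
  have hmax' : ∀ x : E3, x ≠ 0 → inner ℝ (f x) e ≤ inner ℝ (f q) e := by
    intro x hx
    rw [hf.radial.eq_normalize hx]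
    exact hmax ⟨_, by simpa using norm_normalize hx⟩
  have hkey : ∀ a : E3, inner ℝ a (q : E3) = 0 → inner ℝ (fderiv ℝ f q a) e = 0 ∧
      inner ℝ (fderiv ℝ (fderiv ℝ f) q a a) e ≤ 0 := by
    intro a ha
    have hne : ∀ t : ℝ, (q : E3) + t • a ≠ 0 := by
      intro t h0
      have := congrArg (fun v => inner ℝ v (q : E3)) h0
      simp only [inner_add_left, real_inner_smul_left, ha, real_inner_self_eq_norm_sq, hq1,
        inner_zero_left] at this
      norm_num at this
    let B : E3 →L[ℝ] ℝ := innerSL ℝ e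
    let φ : ℝ → ℝ := fun t => B (f ((q : E3) + t • a))
    have hl : ∀ t : ℝ, HasDerivAt (fun t : ℝ => (q : E3) + t • a) a t := fun t => by
      simpa using ((hasDerivAt_id t).smul_const a).const_add (q : E3)
    have h1 : ∀ t, HasDerivAt φ (B (fderiv ℝ f ((q : E3) + t • a) a)) t := by
      intro t
      exact B.hasFDerivAt.comp_hasDerivAt t
        ((hf.radial.differentiableAt (hne t)).hasFDerivAt.comp_hasDerivAt t (hl t))
    have h1' : deriv φ = fun t => B (fderiv ℝ f ((q : E3) + t • a) a) :=
      funext fun t => (h1 t).deriv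
    have h2 : HasDerivAt (deriv φ) (B (fderiv ℝ (fderiv ℝ f) q a a)) 0 := by
      rw [h1']
      have hd : HasFDerivAt (fderiv ℝ f) (fderiv ℝ (fderiv ℝ f) q) ((q : E3) + (0 : ℝ) • a) := by
        simpa using (hf.radial.differentiableAt_fderiv hq0).hasFDerivAt
      exact (B.comp (ContinuousLinearMap.apply ℝ E3 a)).hasFDerivAt.comp_hasDerivAt (0 : ℝ)
        (hd.comp_hasDerivAt (0 : ℝ) (hl 0))
    have hφ : ∀ t, φ t ≤ φ 0 := fun t => by
      simpa [φ, B, real_inner_comm e] using hmax' _ (hne t)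
    have hloc : IsLocalMax φ 0 := Eventually.of_forall hφ
    have hd0 : deriv φ 0 = 0 := hloc.deriv_eq_zero
    rw [real_inner_comm, real_inner_comm e]
    refine ⟨by simpa [h1', B] using hd0, ?_⟩
    change B (fderiv ℝ (fderiv ℝ f) q a a) ≤ 0
    -- A positive second derivative would make `0` a local minimum as well, and `φ` locally constant.
    by_contra hpos
    rw [not_le, ← h2.deriv] at hpos
    have hmin := isLocalMin_of_deriv_deriv_pos hpos hd0 (h1 0).continuousAt
    have hconst : φ =ᶠ[𝓝 0] fun _ => φ 0 := by
      filter_upwards [hmin] with t ht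
      exact le_antisymm (hφ t) ht
    have := hconst.deriv.deriv_eq
    rw [this] at hpos
    simp at hpos
  obtain ⟨e₁, e₂, hF⟩ := exists_oframe hq1
  have hN := hf.normalField_ne_zero hq1
  have hNn : 0 < ‖normalField f q‖ := norm_pos_iff.mpr hN
  have hexp := cross_expansion (fderiv ℝ f q e₁) (fderiv ℝ f q e₂) e
  rw [cross_cross, cross_swap (cross _ _) (fderiv ℝ f q e₁), cross_cross,
    ← normalField_eq f hF] at hexp
  simp only [inner_sub_right, inner_neg_right, real_inner_smul_right] at hexp
  rw [real_inner_comm _ e, (hkey e₁ hF.inner_e₁_p).1, real_inner_comm _ e,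
    (hkey e₂ hF.inner_e₂_p).1, real_inner_self_eq_norm_sq] at hexp
  simp only [mul_zero, sub_zero, neg_zero, zero_smul, zero_add] at hexp
  -- So `e` is a multiple of the normal; the second derivative of the height fixes the sign.
  set c := inner ℝ e (normalField f q) with hc
  have he' : e = (‖normalField f q‖ ^ 2)⁻¹ • c • normalField f q := by
    rw [← hexp, smul_smul, inv_mul_cancel₀ (by positivity), one_smul]
  have hc0 : 0 ≤ c := by
    by_contra hneg
    have h1 := (hkey e₁ hF.inner_e₁_p).2
    rw [he', real_inner_smul_right, real_inner_smul_right] at h1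
    have h2 := hf.neg q hq1 e₁ hF.inner_e₁_p hF.e₁_ne
    rw [secondForm] at h2
    have : 0 < (‖normalField f q‖ ^ 2)⁻¹ * (c *
        inner ℝ (fderiv ℝ (fderiv ℝ f) q e₁ e₁) (normalField f q)) :=
      mul_pos (by positivity) (mul_pos_of_neg_of_neg (not_le.mp hneg) h2)
    linarith
  have hcn : c = ‖normalField f q‖ := by
    have h1 := congrArg norm he'
    rw [norm_smul, norm_smul, he, norm_inv, norm_pow, norm_norm, Real.norm_of_nonneg hc0] at h1
    field_simp at h1
    nlinarith
  rw [gaussMap_of_norm_one f hq1, he', hcn, smul_smul]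
  congr 1
  field_simp

lemma continuous_coe : Continuous fun p : S2 => f p := continuous_iff_continuousAt.mpr fun p =>
  ContinuousAt.comp (g := f) (f := fun p : S2 => (p : E3))
    (hf.radial.smooth _ (coe_S2_ne_zero p)).continuousAt continuous_subtype_val.continuousAt

lemma exists_isMax (e : E3) : ∃ q : S2, ∀ x : S2, inner ℝ (f x) e ≤ inner ℝ (f q) e := by
  obtain ⟨q, -, hq⟩ := isCompact_univ.exists_isMaxOn (univ_nonempty (α := S2))
    (hf.continuous_coe.inner continuous_const).continuousOn (f := fun x : S2 => inner ℝ (f x) e)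
  exact ⟨q, fun x => hq (mem_univ x)⟩

lemma exists_gaussMap_eq {e : E3} (he : ‖e‖ = 1) : ∃ q : S2, gaussMap f q = e :=
  let ⟨q, hq⟩ := hf.exists_isMax e
  ⟨q, hf.gaussMap_eq_of_isMax he hq⟩

/-- **Hadamard's theorem**: an oval lies strictly on one side of each of its tangent planes. -/
theorem strictly_convex {p q : S2} (hpq : q ≠ p) :
    inner ℝ (f q - f p) (gaussMap f p) < 0 := by
  have hn := hf.norm_gaussMap (coe_S2_ne_zero p)
  obtain ⟨m, hm⟩ := hf.exists_isMax (gaussMap f p)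
  have hmp : m = p := hf.gaussMap_injective (hf.gaussMap_eq_of_isMax hn hm)
  subst hmp
  rw [inner_sub_left, sub_neg]
  -- In case of equality the height is also maximal at `q`, where the normal is then the same.
  refine lt_of_le_of_ne (hm q) fun heq => hpq ?_
  exact hf.gaussMap_injective (hf.gaussMap_eq_of_isMax hn fun x => by rw [heq]; exact hm x)

end Oval

/-! ### The rotation field of a pair of isometric surfaces -/

lemma exists_cross_of_skew (S : E3 →L[ℝ] E3) (hS : ∀ x y, inner ℝ (S x) y = - inner ℝ x (S y)) :
    ∃ w, ∀ y, S y = cross w y := by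
  have h : ∀ i j, S (bas i) j = - S (bas j) i := fun i j => by
    have := hS (bas i) (bas j)
    simpa [bas, EuclideanSpace.inner_single_left, EuclideanSpace.inner_single_right] using this
  refine ⟨!₂[S (bas 1) 2, S (bas 2) 0, S (bas 0) 1], fun y => ?_⟩
  conv_lhs => rw [eq_sum_bas y]
  simp only [map_add, map_smul]
  have h00 := h 0 0; have h11 := h 1 1; have h22 := h 2 2
  have h01 := h 0 1; have h12 := h 1 2; have h20 := h 2 0
  apply E3.ext_coord
  · simp; linear_combination y 0 / 2 * h00 + y 1 * h 1 0
  · simp; linear_combination y 1 / 2 * h11 + y 2 * h 2 1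
  · simp; linear_combination y 2 / 2 * h22 + y 0 * h 0 2

/-- The first fundamental forms of two surfaces agree. -/
def SameMetric (f g : E3 → E3) : Prop :=
  ∀ p : E3, ‖p‖ = 1 → ∀ a b : E3,
    inner ℝ (fderiv ℝ f p a) (fderiv ℝ f p b) = inner ℝ (fderiv ℝ g p a) (fderiv ℝ g p b)

/-- The determinants of the second fundamental forms of two surfaces agree. -/
def SameDet (f g : E3 → E3) : Prop :=
  ∀ p : E3, ‖p‖ = 1 → ∀ a b : E3, inner ℝ a p = 0 → inner ℝ b p = 0 →
    secondForm f p a a * secondForm f p b b - secondForm f p a b ^ 2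
      = secondForm g p a a * secondForm g p b b - secondForm g p a b ^ 2

/-- A smooth field of orthogonal maps that takes the tangent planes and normals of the surface `f`
to those of the surface `g`. -/
structure RotationField (f g : E3 → E3) (R : E3 → E3 →L[ℝ] E3) : Prop where
  radial : Radial R
  isometry : ∀ p : E3, ‖p‖ = 1 → ∃ U : E3 ≃ₗᵢ[ℝ] E3, ∀ x, R p x = U x
  tangent : ∀ p : E3, ‖p‖ = 1 → ∀ a, R p (fderiv ℝ f p a) = fderiv ℝ g p a
  normal : ∀ p : E3, ‖p‖ = 1 → R p (normalField f p) = normalField g p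

/-- The differential of `f` completed to an endomorphism by sending the position vector `x` to the
normal of the surface. -/
def fullDifferential (f : E3 → E3) (x : E3) : E3 →L[ℝ] E3 :=
  fderiv ℝ f x + (innerSL ℝ x).smulRight (normalField f x)

lemma inner_normalField_self (f : E3 → E3) {p e₁ e₂ : E3} (hF : OFrame p e₁ e₂) :
    inner ℝ (normalField f p) (normalField f p)
      = inner ℝ (fderiv ℝ f p e₁) (fderiv ℝ f p e₁) * inner ℝ (fderiv ℝ f p e₂) (fderiv ℝ f p e₂)
        - inner ℝ (fderiv ℝ f p e₁) (fderiv ℝ f p e₂) ^ 2 := by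
  rw [normalField_eq f hF, inner_cross_cross, real_inner_comm (fderiv ℝ f p e₁) (fderiv ℝ f p e₂)]
  ring

lemma SameMetric.inner_normalField {f g : E3 → E3} (h : SameMetric f g) {p : E3} (hp : ‖p‖ = 1) :
    inner ℝ (normalField f p) (normalField f p) = inner ℝ (normalField g p) (normalField g p) := by
  obtain ⟨e₁, e₂, hF⟩ := exists_oframe hp
  rw [inner_normalField_self f hF, inner_normalField_self g hF, h p hp, h p hp, h p hp]

lemma inner_fullDifferential {f : E3 → E3} (hf : Radial f) {p : E3} (hp : ‖p‖ = 1) (x y : E3) :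
    inner ℝ (fullDifferential f p x) (fullDifferential f p y)
      = inner ℝ (fderiv ℝ f p x) (fderiv ℝ f p y)
        + inner ℝ p x * inner ℝ p y * inner ℝ (normalField f p) (normalField f p) := by
  simp only [fullDifferential, _root_.add_apply, ContinuousLinearMap.smulRight_apply,
    innerSL_apply_apply, inner_add_left, inner_add_right, real_inner_smul_left,
    real_inner_smul_right, hf.inner_fderiv_normalField hp,
    fun a => (real_inner_comm (fderiv ℝ f p a) (normalField f p)).trans
      (hf.inner_fderiv_normalField hp a)]
  ring

lemma Oval.fullDifferential_injective {f : E3 → E3} (hf : Oval f) {p : E3} (hp : ‖p‖ = 1) :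
    Function.Injective (fullDifferential f p : E3 →ₗ[ℝ] E3) := by
  rw [← LinearMap.ker_eq_bot, LinearMap.ker_eq_bot']
  intro y hy
  have hy' : fullDifferential f p y = 0 := hy
  have h1 := inner_fullDifferential hf.radial hp y y
  rw [hy', inner_zero_left, real_inner_self_eq_norm_sq, real_inner_self_eq_norm_sq] at h1
  have hN : 0 < ‖normalField f p‖ := norm_pos_iff.mpr (hf.normalField_ne_zero hp)
  have h2 : inner ℝ p y = 0 := by
    have : (inner ℝ p y * ‖normalField f p‖) ^ 2 = 0 := by
      nlinarith [sq_nonneg ‖fderiv ℝ f p y‖, sq_nonneg (inner ℝ p y * ‖normalField f p‖)]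
    have := pow_eq_zero_iff (two_ne_zero) |>.mp this
    exact (mul_eq_zero.mp this).resolve_right hN.ne'
  rw [h2] at h1
  have h3 : fderiv ℝ f p y = 0 := by
    rw [← norm_eq_zero]
    have : ‖fderiv ℝ f p y‖ ^ 2 = 0 := by linarith
    exact pow_eq_zero_iff (two_ne_zero) |>.mp this
  exact hf.immersion hp (by rw [real_inner_comm]; exact h2) h3

/-- On the unit sphere the rotation field is the quotient of the completed differentials of the two
surfaces. It is orthogonal because these pull the inner product back to the same form. -/
lemma exists_rotationField {f g : E3 → E3} (hf : Oval f) (hg : Radial g) (h : SameMetric f g) :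
    ∃ R, RotationField f g R := by
  let R₀ : E3 → E3 →L[ℝ] E3 := fun x =>
    (fullDifferential g x).comp (fullDifferential f x).inverse
  have hsm : ∀ {k : E3 → E3}, Radial k → ∀ x ≠ 0, ContDiffAt ℝ ∞ (fullDifferential k) x := by
    intro k hk x hx
    refine (hk.contDiffAt_fderiv hx).add ?_
    have h1 : ContDiffAt ℝ ∞ (fun x : E3 => innerSL ℝ x) x :=
      (innerSL ℝ : E3 →L[ℝ] E3 →L[ℝ] ℝ).contDiff.contDiffAt
    exact h1.smulRight (hk.contDiffAt_normalField hx)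
  have hequiv : ∀ p : E3, ‖p‖ = 1 → ∃ A : E3 ≃L[ℝ] E3, (A : E3 →L[ℝ] E3) = fullDifferential f p :=
    fun p hp => ⟨(LinearEquiv.ofInjectiveEndo _
      (hf.fullDifferential_injective hp)).toContinuousLinearEquiv, by ext y; rfl⟩
  have hR₀ : ∀ p : E3, ‖p‖ = 1 → ∀ x, R₀ p (fullDifferential f p x) = fullDifferential g p x := by
    intro p hp x
    obtain ⟨A, hA⟩ := hequiv p hp
    simp only [R₀, ← hA, ContinuousLinearMap.inverse_equiv, ContinuousLinearMap.comp_apply]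
    simp
  have hR : ∀ p : E3, ‖p‖ = 1 → R₀ (‖p‖⁻¹ • p) = R₀ p := fun p hp => by
    rw [hp, inv_one, one_smul]
  refine ⟨fun x => R₀ (‖x‖⁻¹ • x), radial_normalize fun p hp => ?_, fun p hp => ?_, fun p hp a => ?_,
    fun p hp => ?_⟩
  · have hp0 := ne_zero_of_norm_one hp
    obtain ⟨A, hA⟩ := hequiv p hp
    have hinv : ContDiffAt ℝ ∞ (fun x => (fullDifferential f x).inverse) p :=
      ContDiffAt.comp (g := ContinuousLinearMap.inverse) p
        (by rw [← hA]; exact contDiffAt_map_inverse A) (hsm hf.radial p hp0)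
    exact (hsm hg p hp0).clm_comp hinv
  · rw [hR p hp]
    have hnorm : ∀ y, ‖R₀ p y‖ = ‖y‖ := by
      intro y
      obtain ⟨A, hA⟩ := hequiv p hp
      have hy : fullDifferential f p (A.symm y) = y := by rw [← hA]; simp
      have h1 : inner ℝ (R₀ p y) (R₀ p y) = inner ℝ y y := by
        rw [← hy, hR₀ p hp, inner_fullDifferential hg hp, inner_fullDifferential hf.radial hp,
          h p hp, h.inner_normalField hp]
      rw [real_inner_self_eq_norm_sq, real_inner_self_eq_norm_sq] at h1
      exact (sq_eq_sq₀ (norm_nonneg _) (norm_nonneg _)).mp h1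
    let V : E3 →ₗᵢ[ℝ] E3 := ⟨R₀ p, hnorm⟩
    exact ⟨V.toLinearIsometryEquiv rfl, fun x => rfl⟩
  · rw [hR p hp]
    have h1 := hR₀ p hp (a - inner ℝ p a • p)
    have hin : inner ℝ p (a - inner ℝ p a • p) = 0 := by
      rw [inner_sub_right, real_inner_smul_right, real_inner_self_eq_norm_sq, hp]; ring
    have hp0 := ne_zero_of_norm_one hp
    simpa [fullDifferential, hin, hf.radial.fderiv_self hp0,
      hg.fderiv_self hp0] using h1
  · rw [hR p hp]
    have hp0 := ne_zero_of_norm_one hp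
    simpa [fullDifferential, hp, hf.radial.fderiv_self hp0, hg.fderiv_self hp0] using hR₀ p hp p

/-! ### Herglotz's integral formula -/

/-- The linear term of Herglotz's formula: the two-form `∑ df_i ∧ w_i`, where the one-form `w` with
values in `E3` is the angular velocity `Rᵀ dR` of the rotation field. -/
def herglotzJ (f : E3 → E3) (R : E3 → E3 →L[ℝ] E3) (p : E3) : ℝ :=
  ∑ i : Fin 3, ∑ m : Fin 3, R p (bas (i + 2)) m *
    wedge p (fderiv ℝ (fun x => f x i) p) (fderiv ℝ (fun x => R x (bas (i + 1)) m) p)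

/-- The quadratic term of Herglotz's formula: the two-form `- ∑ f_i dw_i`. -/
def herglotzQ (f : E3 → E3) (R : E3 → E3 →L[ℝ] E3) (p : E3) : ℝ :=
  -∑ i : Fin 3, ∑ m : Fin 3, f p i *
    wedge p (fderiv ℝ (fun x => R x (bas (i + 2)) m) p) (fderiv ℝ (fun x => R x (bas (i + 1)) m) p)

lemma Radial.entry {R : E3 → E3 →L[ℝ] E3} (hR : Radial R) (y : E3) (m : Fin 3) :
    Radial fun x => R x y m :=
  hR.comp (g := fun A : E3 →L[ℝ] E3 => A y m) (by fun_prop)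

lemma Radial.continuous_wedge {α β : E3 → ℝ} (hα : Radial α) (hβ : Radial β) :
    Continuous fun p : S2 => wedge p (fderiv ℝ α p) (fderiv ℝ β p) := by
  have h : ∀ {γ : E3 → ℝ}, Radial γ → ∀ a, Continuous fun p : S2 => fderiv ℝ γ p a := by
    intro γ hγ a
    refine continuous_iff_continuousAt.mpr fun p => ?_
    exact ContinuousAt.comp (g := fun x => fderiv ℝ γ x a) (f := fun p : S2 => (p : E3))
      (((hγ.contDiffAt_fderiv (coe_S2_ne_zero p)).clm_apply contDiffAt_const).continuousAt)
      continuous_subtype_val.continuousAt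
  have hx : ∀ i, Continuous fun p : S2 => (p : E3) i := fun i => by fun_prop
  unfold wedge
  exact ((((hx 0).mul (((h hα _).mul (h hβ _)).sub ((h hα _).mul (h hβ _)))).add
    ((hx 1).mul (((h hα _).mul (h hβ _)).sub ((h hα _).mul (h hβ _))))).add
    ((hx 2).mul (((h hα _).mul (h hβ _)).sub ((h hα _).mul (h hβ _)))))

lemma Radial.continuous_sphere {F : Type*} [NormedAddCommGroup F] [NormedSpace ℝ F] {f : E3 → F}
    (hf : Radial f) : Continuous fun p : S2 => f p := continuous_iff_continuousAt.mpr fun p =>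
  ContinuousAt.comp (g := f) (f := fun p : S2 => (p : E3))
    (hf.smooth _ (coe_S2_ne_zero p)).continuousAt continuous_subtype_val.continuousAt

lemma continuous_integrable {φ : S2 → ℝ} (h : Continuous φ) : Integrable φ sphereMeasure :=
  h.integrable_of_hasCompactSupport (HasCompactSupport.of_compactSpace φ)

section Herglotz

variable {f g : E3 → E3} {R : E3 → E3 →L[ℝ] E3}

lemma continuous_herglotzJ (hf : Radial f) (hR : Radial R) :
    Continuous fun p : S2 => herglotzJ f R p :=
  continuous_finsetSum _ fun i _ => continuous_finsetSum _ fun m _ =>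
    (hR.entry _ m).continuous_sphere.mul ((hf.coord i).continuous_wedge (hR.entry _ m))

lemma continuous_herglotzQ (hf : Radial f) (hR : Radial R) :
    Continuous fun p : S2 => herglotzQ f R p :=
  (continuous_finsetSum _ fun i _ => continuous_finsetSum _ fun m _ =>
    (hf.coord i).continuous_sphere.mul ((hR.entry _ m).continuous_wedge (hR.entry _ m))).neg

lemma wedge_fderiv_mul {α β γ : E3 → ℝ} (hα : Radial α) (hβ : Radial β) (p : S2) :
    wedge p (fderiv ℝ (fun x => α x * β x) p) (fderiv ℝ γ p)
      = β p * wedge p (fderiv ℝ α p) (fderiv ℝ γ p)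
        + α p * wedge p (fderiv ℝ β p) (fderiv ℝ γ p) := by
  have h : HasFDerivAt (fun x => α x * β x) _ (p : E3) :=
    (hα.differentiableAt (coe_S2_ne_zero p)).hasFDerivAt.mul
      (hβ.differentiableAt (coe_S2_ne_zero p)).hasFDerivAt
  rw [h.fderiv]
  simp only [wedge, _root_.add_apply, _root_.smul_apply, smul_eq_mul]
  ring

/-- **Herglotz's integral formula.** -/
lemma integral_herglotz (hf : Radial f) (hR : Radial R) :
    ∫ p : S2, herglotzJ f R p ∂sphereMeasure = ∫ p : S2, herglotzQ f R p ∂sphereMeasure := by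
  rw [← sub_eq_zero, ← integral_sub (continuous_integrable (continuous_herglotzJ hf hR))
    (continuous_integrable (continuous_herglotzQ hf hR))]
  have h : ∀ p : S2, herglotzJ f R p - herglotzQ f R p = ∑ i : Fin 3, ∑ m : Fin 3,
      wedge p (fderiv ℝ (fun x => f x i * R x (bas (i + 2)) m) p)
        (fderiv ℝ (fun x => R x (bas (i + 1)) m) p) := by
    intro p
    simp only [herglotzJ, herglotzQ, sub_neg_eq_add, ← Finset.sum_add_distrib]
    refine Finset.sum_congr rfl fun i _ => Finset.sum_congr rfl fun m _ => ?_
    exact (wedge_fderiv_mul (hf.coord i) (hR.entry _ m) p).symm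
  simp only [h]
  have hc : ∀ i m, Continuous fun p : S2 => wedge p
      (fderiv ℝ (fun x => f x i * R x (bas (i + 2)) m) p)
      (fderiv ℝ (fun x => R x (bas (i + 1)) m) p) := fun i m =>
    ((hf.coord i).mul (hR.entry _ m)).continuous_wedge (hR.entry _ m)
  rw [integral_finsetSum _ fun i _ => continuous_integrable
    (continuous_finsetSum _ fun m _ => hc i m)]
  refine Finset.sum_eq_zero fun i _ => ?_
  rw [integral_finsetSum _ fun m _ => continuous_integrable (hc i m)]
  exact Finset.sum_eq_zero fun m _ =>
    integral_wedge_eq_zero ((hf.coord i).mul (hR.entry _ m)) (hR.entry _ m)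

/-- The angular velocity of a rotation field in a given direction. -/
lemma RotationField.exists_angular (h : RotationField f g R) {p : E3} (hp : ‖p‖ = 1)
    {U : E3 ≃ₗᵢ[ℝ] E3} (hU : ∀ x, R p x = U x) (a : E3) :
    ∃ w, ∀ y, fderiv ℝ R p a y = U (cross w y) := by
  have hp0 := ne_zero_of_norm_one hp
  have hR := (h.radial.differentiableAt hp0).hasFDerivAt
  have hskew : ∀ x y, inner ℝ (fderiv ℝ R p a x) (R p y) + inner ℝ (R p x) (fderiv ℝ R p a y) = 0 := by
    intro x y
    have h1 : ∀ z, HasFDerivAt (fun q => R q z)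
        ((ContinuousLinearMap.apply ℝ E3 z).comp (fderiv ℝ R p)) p := fun z =>
      (ContinuousLinearMap.apply ℝ E3 z).hasFDerivAt.comp p hR
    have h2 := (h1 x).inner ℝ (h1 y)
    have h3 : (fun q => inner ℝ (R q x) (R q y)) =ᶠ[𝓝 p] fun _ => inner ℝ x y := by
      filter_upwards [isOpen_compl_singleton.mem_nhds (show p ∈ ({0}ᶜ : Set E3) from hp0)] with q hq
      obtain ⟨V, hV⟩ := h.isometry _ (norm_normalize hq)
      rw [h.radial.eq_normalize hq, hV, hV, V.inner_map_map]
    have h4 := (h2.congr_of_eventuallyEq h3.symm).unique (hasFDerivAt_const _ p)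
    have h5 := congrArg (fun A : E3 →L[ℝ] ℝ => A a) h4
    simp [fderivInnerCLM_apply] at h5
    linarith
  let S : E3 →L[ℝ] E3 := (U.symm.toContinuousLinearEquiv : E3 →L[ℝ] E3).comp (fderiv ℝ R p a)
  have hS : ∀ y, U (S y) = fderiv ℝ R p a y := fun y => by simp [S]
  obtain ⟨w, hw⟩ := exists_cross_of_skew S (fun x y => by
    rw [← U.inner_map_map, ← U.inner_map_map x, hS, hS, ← hU, ← hU]
    linarith [hskew x y])
  exact ⟨w, fun y => by rw [← hw, hS]⟩

/-- The derivative of the relation `Dg = R ∘ Df`. -/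
lemma RotationField.snd_fderiv (hf : Radial f) (hg : Radial g) (h : RotationField f g R) {p : E3}
    (hp : ‖p‖ = 1) (a b : E3) :
    fderiv ℝ (fderiv ℝ g) p a b
      = fderiv ℝ R p a (fderiv ℝ f p b) + R p (fderiv ℝ (fderiv ℝ f) p a b) := by
  have hp0 := ne_zero_of_norm_one hp
  have hev : fderiv ℝ g =ᶠ[𝓝 p] fun x => (R x).comp (fderiv ℝ f x) := by
    filter_upwards [isOpen_compl_singleton.mem_nhds (show p ∈ ({0}ᶜ : Set E3) from hp0)] with x hx
    have hx0 : x ≠ 0 := hx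
    have hn : 0 < ‖x‖ := norm_pos_iff.mpr hx0
    have h1 : x = ‖x‖ • (‖x‖⁻¹ • x) := by rw [smul_smul, mul_inv_cancel₀ hn.ne', one_smul]
    ext1 y
    have h2 : fderiv ℝ g x = ‖x‖⁻¹ • fderiv ℝ g (‖x‖⁻¹ • x) := by
      conv_lhs => rw [h1]
      exact hg.fderiv_smul hn _
    have h3 : fderiv ℝ f x = ‖x‖⁻¹ • fderiv ℝ f (‖x‖⁻¹ • x) := by
      conv_lhs => rw [h1]
      exact hf.fderiv_smul hn _
    rw [ContinuousLinearMap.comp_apply, h2, h3, h.radial.eq_normalize hx0, _root_.smul_apply,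
      _root_.smul_apply, map_smul, h.tangent _ (norm_normalize hx0)]
  have h1 := (h.radial.differentiableAt hp0).hasFDerivAt.clm_comp
    (hf.differentiableAt_fderiv hp0).hasFDerivAt
  rw [(h1.congr_of_eventuallyEq hev).fderiv]
  simp [add_comm]

/-- If the angular velocities `w₁`, `w₂` satisfy the integrability condition `w₁ × f₂ = w₂ × f₁`,
they are tangent to the surface, with components given by the forms `(w_A × f_B) · N`. -/
lemma angular_eq {f₁ f₂ w₁ w₂ N : E3} (hN : N = cross f₁ f₂) (h : cross w₁ f₂ = cross w₂ f₁) :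
    inner ℝ N N • w₁ = inner ℝ (cross w₁ f₂) N • f₁ - inner ℝ (cross w₁ f₁) N • f₂ ∧
    inner ℝ N N • w₂ = inner ℝ (cross w₂ f₂) N • f₁ - inner ℝ (cross w₁ f₂) N • f₂ := by
  have e1 : inner ℝ w₁ N = 0 := by
    have : inner ℝ w₁ N = - inner ℝ (cross w₁ f₂) f₁ := by
      rw [hN]; simp [inner_eq]; ring
    rw [this, h, inner_cross_right, neg_zero]
  have e2 : inner ℝ w₂ N = 0 := by
    have : inner ℝ w₂ N = inner ℝ (cross w₂ f₁) f₂ := by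
      rw [hN]; simp [inner_eq]; ring
    rw [this, ← h, inner_cross_right]
  have t1 : ∀ w b, inner ℝ w (cross b N) = inner ℝ (cross w b) N := fun w b => by
    simp [inner_eq]; ring
  have t2 : ∀ w b, inner ℝ w (cross N b) = - inner ℝ (cross w b) N := fun w b => by
    simp [inner_eq]; ring
  constructor
  · have := cross_expansion f₁ f₂ w₁
    rw [← hN, e1, t1, t2] at this
    rw [this]; module
  · have := cross_expansion f₁ f₂ w₂
    rw [← hN, e2, t1, t2, ← h] at this
    rw [this]; module

/-- The integrands of Herglotz's formula in terms of the difference of the second fundamental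
forms of the two surfaces. -/
lemma RotationField.herglotz_pointwise (hf : Oval f) (hg : Radial g) (h : RotationField f g R)
    {p e₁ e₂ : E3} (hF : OFrame p e₁ e₂) :
    let d := fun a b => secondForm g p a b - secondForm f p a b
    let n := inner ℝ (normalField f p) (normalField f p)
    n * herglotzJ f R p
        = d e₂ e₂ * inner ℝ (fderiv ℝ f p e₁) (fderiv ℝ f p e₁)
          - 2 * d e₁ e₂ * inner ℝ (fderiv ℝ f p e₁) (fderiv ℝ f p e₂)
          + d e₁ e₁ * inner ℝ (fderiv ℝ f p e₂) (fderiv ℝ f p e₂) ∧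
      n ^ 2 * herglotzQ f R p
        = (d e₁ e₁ * d e₂ e₂ - d e₁ e₂ ^ 2) * inner ℝ (f p) (normalField f p) ∧
      (d e₁ e₁ = 0 → d e₁ e₂ = 0 → d e₂ e₂ = 0 → fderiv ℝ R p = 0) := by
  intro d n
  have hp : ‖p‖ = 1 := by
    have := hF.inner_p_p
    rw [real_inner_self_eq_norm_sq] at this
    exact (pow_eq_one_iff_of_nonneg (norm_nonneg p) two_ne_zero).mp this
  have hp0 := ne_zero_of_norm_one hp
  obtain ⟨U, hU⟩ := h.isometry p hp
  obtain ⟨w₁, hw₁⟩ := h.exists_angular hp hU e₁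
  obtain ⟨w₂, hw₂⟩ := h.exists_angular hp hU e₂
  set N := normalField f p with hNdef
  set f₁ := fderiv ℝ f p e₁ with hf₁
  set f₂ := fderiv ℝ f p e₂ with hf₂
  have hN : N = cross f₁ f₂ := normalField_eq f hF
  have hN0 : 0 < n := by
    simp only [n, real_inner_self_eq_norm_sq]
    have := norm_pos_iff.mpr (hf.normalField_ne_zero hp)
    positivity
  -- The integrability condition is the symmetry of the second derivatives of `f` and of `g`.
  have hint : cross w₁ f₂ = cross w₂ f₁ := by
    have s1 := h.snd_fderiv hf.radial hg hp e₁ e₂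
    have s2 := h.snd_fderiv hf.radial hg hp e₂ e₁
    rw [hg.snd_symm hp0, hf.radial.snd_symm hp0, s2] at s1
    have s3 := add_right_cancel s1
    rw [hw₁, hw₂] at s3
    exact (U.injective s3).symm
  -- The change of the second fundamental form is due to the angular velocity alone.
  have hd : ∀ a b w, (∀ y, fderiv ℝ R p a y = U (cross w y)) →
      d a b = inner ℝ (cross w (fderiv ℝ f p b)) N := by
    intro a b w hw
    simp only [d, secondForm]
    rw [h.snd_fderiv hf.radial hg hp, ← h.normal p hp, hw, hU, hU, ← map_add, U.inner_map_map,
      inner_add_left]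
    ring
  have hd11 := hd e₁ e₁ w₁ hw₁
  have hd12 := hd e₁ e₂ w₁ hw₁
  have hd22 := hd e₂ e₂ w₂ hw₂
  rw [← hf₁] at hd11
  rw [← hf₂] at hd12 hd22
  obtain ⟨hA1, hA2⟩ := angular_eq hN hint
  rw [← hd11, ← hd12] at hA1
  rw [← hd22, ← hd12] at hA2
  have hwedge : ∀ A B, wedge p A B = A e₁ * B e₂ - A e₂ * B e₁ := fun A B => by
    rw [← wedge_cross, hF.cross_eq]
  have hcoord : ∀ i a, fderiv ℝ (fun x => f x i) p a = fderiv ℝ f p a i := fun i a => by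
    have : HasFDerivAt (fun x => f x i) ((EuclideanSpace.proj i : E3 →L[ℝ] ℝ).comp
      (fderiv ℝ f p)) p := (EuclideanSpace.proj i : E3 →L[ℝ] ℝ).hasFDerivAt.comp p
        (hf.radial.differentiableAt hp0).hasFDerivAt
    rw [this.fderiv]; rfl
  have hentry : ∀ y m a, fderiv ℝ (fun x => R x y m) p a = fderiv ℝ R p a y m := fun y m a => by
    have : HasFDerivAt (fun x => R x y m) (((EuclideanSpace.proj m : E3 →L[ℝ] ℝ).comp
      (ContinuousLinearMap.apply ℝ E3 y)).comp (fderiv ℝ R p)) p :=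
      ((EuclideanSpace.proj m : E3 →L[ℝ] ℝ).comp
        (ContinuousLinearMap.apply ℝ E3 y)).hasFDerivAt.comp p
        (h.radial.differentiableAt hp0).hasFDerivAt
    rw [this.fderiv]; rfl
  have hsum : ∀ x y : E3, U x 0 * U y 0 + U x 1 * U y 1 + U x 2 * U y 2
      = x 0 * y 0 + x 1 * y 1 + x 2 * y 2 := fun x y => by
    rw [← inner_eq, ← inner_eq, U.inner_map_map]
  have hJ : herglotzJ f R p = inner ℝ f₁ w₂ - inner ℝ f₂ w₁ := by
    have hi : ∀ i : Fin 3, ∑ m : Fin 3, R p (bas (i + 2)) m *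
        wedge p (fderiv ℝ (fun x => f x i) p) (fderiv ℝ (fun x => R x (bas (i + 1)) m) p)
        = f₁ i * w₂ i - f₂ i * w₁ i := by
      intro i
      simp only [hwedge, hcoord, hentry, hw₁, hw₂, hU, ← hf₁, ← hf₂, Fin.sum_univ_three]
      have s1 := hsum (bas (i + 2)) (cross w₁ (bas (i + 1)))
      have s2 := hsum (bas (i + 2)) (cross w₂ (bas (i + 1)))
      have s3 : ∀ w : E3, (bas (i + 2)) 0 * (cross w (bas (i + 1))) 0
          + (bas (i + 2)) 1 * (cross w (bas (i + 1))) 1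
          + (bas (i + 2)) 2 * (cross w (bas (i + 1))) 2 = w i := by
        intro w
        fin_cases i <;> simp [bas]
      rw [s3] at s1 s2
      linear_combination f₁ i * s2 - f₂ i * s1
    simp only [herglotzJ, hi, Fin.sum_univ_three, inner_eq]
    ring
  have hQ : herglotzQ f R p = inner ℝ (f p) (cross w₁ w₂) := by
    have hi : ∀ i : Fin 3, ∑ m : Fin 3, f p i * wedge p (fderiv ℝ (fun x => R x (bas (i + 2)) m) p)
        (fderiv ℝ (fun x => R x (bas (i + 1)) m) p) = - (f p i * cross w₁ w₂ i) := by
      intro i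
      simp only [hwedge, hentry, hw₁, hw₂, Fin.sum_univ_three]
      have s1 := hsum (cross w₁ (bas (i + 2))) (cross w₂ (bas (i + 1)))
      have s2 := hsum (cross w₂ (bas (i + 2))) (cross w₁ (bas (i + 1)))
      have s3 : ∀ v w : E3, (cross v (bas (i + 2))) 0 * (cross w (bas (i + 1))) 0
          + (cross v (bas (i + 2))) 1 * (cross w (bas (i + 1))) 1
          + (cross v (bas (i + 2))) 2 * (cross w (bas (i + 1))) 2 = - (v (i + 1) * w (i + 2)) := by
        intro v w
        fin_cases i <;> simp [bas]
      have s4 : cross w₁ w₂ i = w₁ (i + 1) * w₂ (i + 2) - w₁ (i + 2) * w₂ (i + 1) := by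
        fin_cases i <;> simp
      rw [s3] at s1 s2
      rw [s4]
      linear_combination f p i * (s1 - s2)
    simp only [herglotzQ, hi, Fin.sum_univ_three, inner_eq]
    ring
  refine ⟨?_, ?_, fun z1 z2 z3 => ?_⟩
  · calc n * herglotzJ f R p = inner ℝ f₁ (n • w₂) - inner ℝ f₂ (n • w₁) := by
          rw [hJ, real_inner_smul_right, real_inner_smul_right]; ring
      _ = _ := by
          rw [hA1, hA2]
          simp only [inner_sub_right, real_inner_smul_right]
          rw [real_inner_comm f₁ f₂]
          ring
  · calc n ^ 2 * herglotzQ f R p = inner ℝ (f p) (cross (n • w₁) (n • w₂)) := by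
          rw [hQ]
          simp only [cross, map_smul, _root_.smul_apply, real_inner_smul_right]
          ring
      _ = _ := by
          rw [hA1, hA2, hN]
          simp [inner_eq]
          ring
  · rw [z1, z2] at hA1
    rw [z2, z3] at hA2
    have k1 : w₁ = 0 := (smul_eq_zero.mp (by rw [hA1]; simp)).resolve_left hN0.ne'
    have k2 : w₂ = 0 := (smul_eq_zero.mp (by rw [hA2]; simp)).resolve_left hN0.ne'
    have q1 : fderiv ℝ R p e₁ = 0 := by ext1 y; rw [hw₁, k1]; simp [cross]
    have q2 : fderiv ℝ R p e₂ = 0 := by ext1 y; rw [hw₂, k2]; simp [cross]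
    ext1 a
    ext1 y
    let E : E3 →L[ℝ] E3 := (ContinuousLinearMap.apply ℝ E3 y).comp (fderiv ℝ R p)
    have E1 : E e₁ = 0 := by simp [E, q1]
    have E2 : E e₂ = 0 := by simp [E, q2]
    have E3' : E p = 0 := by simp [E, h.radial.fderiv_self hp0]
    change E a = 0
    rw [hF.expansion a, map_add, map_add, map_smul, map_smul, map_smul, E1, E2, E3']
    simp

/-- Rigidity of ovals (Cohn-Vossen), for surfaces that are positioned such that the support
functions `f · N` and `g · N` are positive. In Herglotz's formula the linear term changes
sign when the two surfaces are exchanged, and the quadratic terms are nonpositive. -/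
theorem exists_congruence_of_support_pos (hf : Oval f) (hg : Oval g) (hm : SameMetric f g)
    (hd : SameDet f g) (hsf : ∀ p : S2, 0 < inner ℝ (f p) (normalField f p))
    (hsg : ∀ p : S2, 0 < inner ℝ (g p) (normalField g p)) :
    ∃ (U : E3 ≃ₗᵢ[ℝ] E3) (c : E3), ∀ x ≠ 0, g x = U (f x) + c := by
  obtain ⟨R, hR⟩ := exists_rotationField hf hg.radial hm
  have hm' : SameMetric g f := fun p hp a b => (hm p hp a b).symm
  obtain ⟨R', hR'⟩ := exists_rotationField hg hf.radial hm'
  have hpos : ∀ {k : E3 → E3}, Oval k → ∀ p : S2,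
      0 < inner ℝ (normalField k p) (normalField k p) := by
    intro k hk p
    rw [real_inner_self_eq_norm_sq]
    have := norm_pos_iff.mpr (hk.normalField_ne_zero (norm_coe_S2 p))
    positivity
  have hdet : ∀ {k l : E3 → E3}, Oval k → Oval l → SameDet k l → ∀ (p : S2) (e₁ e₂ : E3),
      OFrame (p : E3) e₁ e₂ →
      (secondForm l p e₁ e₁ - secondForm k p e₁ e₁) * (secondForm l p e₂ e₂ - secondForm k p e₂ e₂)
        - (secondForm l p e₁ e₂ - secondForm k p e₁ e₂) ^ 2 ≤ 0 ∧
      ((secondForm l p e₁ e₁ - secondForm k p e₁ e₁) * (secondForm l p e₂ e₂ - secondForm k p e₂ e₂)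
        - (secondForm l p e₁ e₂ - secondForm k p e₁ e₂) ^ 2 = 0 →
        secondForm l p e₁ e₁ = secondForm k p e₁ e₁ ∧ secondForm l p e₁ e₂ = secondForm k p e₁ e₂ ∧
        secondForm l p e₂ e₂ = secondForm k p e₂ e₂) := by
    intro k l hk hl hkl p e₁ e₂ hF
    have hp1 := norm_coe_S2 p
    have hp0 := coe_S2_ne_zero p
    refine det_sub_nonpos (hk.neg p hp1 _ hF.inner_e₁_p hF.e₁_ne)
      (hl.neg p hp1 _ hF.inner_e₁_p hF.e₁_ne) ?_
      (hkl p hp1 e₁ e₂ hF.inner_e₁_p hF.inner_e₂_p).symm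
    -- The determinant of the definite form is positive: evaluate it on `L₁₂ e₁ - L₁₁ e₂`.
    have hv0 : secondForm k p e₁ e₂ • e₁ - secondForm k p e₁ e₁ • e₂ ≠ 0 := by
      intro h0
      have := congrArg (fun v => inner ℝ v e₂) h0
      simp only [inner_sub_left, real_inner_smul_left, hF.orth, hF.n₂, inner_zero_left] at this
      linarith [hk.neg p hp1 _ hF.inner_e₁_p hF.e₁_ne]
    have h1 := hk.neg p hp1 _ (by
      rw [inner_sub_left, real_inner_smul_left, real_inner_smul_left, hF.inner_e₁_p,
        hF.inner_e₂_p]; ring) hv0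
    have h2 := hk.neg p hp1 _ hF.inner_e₁_p hF.e₁_ne
    have h3 : secondForm k p e₂ e₁ = secondForm k p e₁ e₂ := by
      simp only [secondForm, hk.radial.snd_symm hp0 e₂ e₁]
    have h4 : ∀ s t : ℝ, secondForm k p (s • e₁ - t • e₂) (s • e₁ - t • e₂)
        = s ^ 2 * secondForm k p e₁ e₁ - s * t * secondForm k p e₁ e₂
          - s * t * secondForm k p e₂ e₁ + t ^ 2 * secondForm k p e₂ e₂ := by
      intro s t
      simp only [secondForm, map_sub, map_smul, _root_.sub_apply, _root_.smul_apply,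
        inner_sub_left, real_inner_smul_left, smul_sub]
      ring
    rw [h4, h3] at h1
    nlinarith
  have hQ : ∀ {k l : E3 → E3} {T : E3 → E3 →L[ℝ] E3}, Oval k → Oval l → SameDet k l →
      RotationField k l T → (∀ p : S2, 0 < inner ℝ (k p) (normalField k p)) → ∀ p : S2,
      herglotzQ k T p ≤ 0 := by
    intro k l T hk hl hkl hT hs p
    obtain ⟨e₁, e₂, hF⟩ := exists_oframe (norm_coe_S2 p)
    have h1 := (hT.herglotz_pointwise hk hl.radial hF).2.1
    have h2 := (hdet hk hl hkl p e₁ e₂ hF).1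
    have h3 := hpos hk p
    by_contra hcon
    rw [not_le] at hcon
    have h4 := mul_pos (pow_pos h3 2) hcon
    rw [h1] at h4
    exact absurd h4 (not_lt.mpr (mul_nonpos_of_nonpos_of_nonneg h2 (hs p).le))
  have hJ : ∀ p : S2, herglotzJ g R' p = - herglotzJ f R p := by
    intro p
    obtain ⟨e₁, e₂, hF⟩ := exists_oframe (norm_coe_S2 p)
    have h1 := (hR.herglotz_pointwise hf hg.radial hF).1
    have h2 := (hR'.herglotz_pointwise hg hf.radial hF).1
    simp only [hm' p (norm_coe_S2 p), hm'.inner_normalField (norm_coe_S2 p)] at h2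
    refine mul_left_cancel₀ (hpos hf p).ne' ?_
    rw [h2, mul_neg, h1]
    ring
  have hd' : SameDet g f := fun p hp a b ha hb => (hd p hp a b ha hb).symm
  -- The sum of Herglotz's formulas for the two orders has no linear term, and its two quadratic
  -- terms are nonpositive.
  have hI : ∫ p : S2, herglotzQ f R p ∂sphereMeasure = 0 := by
    have h1 := integral_herglotz hf.radial hR.radial
    have h2 := integral_herglotz hg.radial hR'.radial
    simp only [hJ, integral_neg] at h2
    have h3 : ∫ p : S2, herglotzQ f R p ∂sphereMeasure ≤ 0 :=
      integral_nonpos (hQ hf hg hd hR hsf)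
    have h4 : ∫ p : S2, herglotzQ g R' p ∂sphereMeasure ≤ 0 :=
      integral_nonpos (hQ hg hf hd' hR' hsg)
    linarith
  have hQ0 : ∀ p : S2, herglotzQ f R p = 0 := by
    have hc := continuous_herglotzQ hf.radial hR.radial
    have h1 : (fun p : S2 => - herglotzQ f R p) =ᵐ[sphereMeasure] 0 := by
      rw [← integral_eq_zero_iff_of_nonneg (fun p => neg_nonneg.mpr (hQ hf hg hd hR hsf p))
        (continuous_integrable hc.neg), integral_neg, hI, neg_zero]
    have h2 := (Continuous.ae_eq_iff_eq sphereMeasure hc.neg continuous_const).mp h1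
    intro p
    exact neg_eq_zero.mp (congrFun h2 p)
  -- So the second fundamental forms agree, and the rotation field is constant.
  have hDR : ∀ p : E3, ‖p‖ = 1 → fderiv ℝ R p = 0 := by
    intro p hp
    obtain ⟨e₁, e₂, hF⟩ := exists_oframe hp
    let q : S2 := ⟨p, by simpa using hp⟩
    obtain ⟨-, h1, h2⟩ := hR.herglotz_pointwise hf hg.radial hF
    rw [hQ0 q, mul_zero] at h1
    obtain ⟨k1, k2, k3⟩ := (hdet hf hg hd q e₁ e₂ hF).2
      ((mul_eq_zero.mp h1.symm).resolve_right (hsf q).ne')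
    exact h2 (sub_eq_zero.mpr k1) (sub_eq_zero.mpr k2) (sub_eq_zero.mpr k3)
  have hb : ‖bas 0‖ = 1 := by simp
  obtain ⟨U, hU⟩ := hR.isometry _ hb
  have hconst : ∀ x ≠ 0, ∀ y, R x y = U y := fun x hx y => by
    rw [hR.radial.const_of_fderiv_eq_zero hDR hx (ne_zero_of_norm_one hb), hU]
  let UL : E3 →L[ℝ] E3 := (U.toContinuousLinearEquiv : E3 →L[ℝ] E3)
  have hdiff : Radial fun x => g x - UL (f x) :=
    hg.radial.sub (hf.radial.comp (g := fun y => UL y) UL.contDiff)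
  refine ⟨U, g (bas 0) - U (f (bas 0)), fun x hx => ?_⟩
  have := hdiff.const_of_fderiv_eq_zero (fun p hp => ?_) hx (ne_zero_of_norm_one hb)
  · have h2 : g x - U (f x) = g (bas 0) - U (f (bas 0)) := this
    rw [← h2]; abel
  · have hp0 := ne_zero_of_norm_one hp
    have h1 : HasFDerivAt (fun x => g x - UL (f x)) (fderiv ℝ g p - UL.comp (fderiv ℝ f p)) p :=
      (hg.radial.differentiableAt hp0).hasFDerivAt.sub
        (UL.hasFDerivAt.comp p (hf.radial.differentiableAt hp0).hasFDerivAt)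
    rw [h1.fderiv]
    ext1 a
    have h3 := hR.tangent p hp a
    rw [hconst p hp0] at h3
    simp [UL, h3]

end Herglotz

/-- The support function of an oval is positive with respect to a suitable origin, namely the midpoint
of two of its points. -/
lemma Oval.exists_support_pos {f : E3 → E3} (hf : Oval f) :
    ∃ o : E3, ∀ p : S2, 0 < inner ℝ (f p - o) (normalField f p) := by
  let p₁ : S2 := ⟨bas 0, by simp⟩
  let p₂ : S2 := ⟨bas 1, by simp⟩
  have hne : p₁ ≠ p₂ := by
    intro h
    have := congrArg (fun v : S2 => (v : E3) 0) h
    simp [p₁, p₂, bas] at this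
  refine ⟨(1 / 2 : ℝ) • (f p₁ + f p₂), fun q => ?_⟩
  have hN : 0 < ‖normalField f q‖ := norm_pos_iff.mpr (hf.normalField_ne_zero (norm_coe_S2 q))
  have hle : ∀ p : S2, inner ℝ (f p - f q) (gaussMap f q) ≤ 0 := by
    intro p
    by_cases h : p = q
    · simp [h]
    · exact (hf.strictly_convex h).le
  have hlt : inner ℝ (f p₁ - f q) (gaussMap f q) + inner ℝ (f p₂ - f q) (gaussMap f q) < 0 := by
    by_cases h : p₁ = q
    · linarith [hle p₁, hf.strictly_convex (p := q) (q := p₂) (fun h' => hne (h.trans h'.symm))]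
    · linarith [hle p₂, hf.strictly_convex h]
  rw [gaussMap_of_norm_one f (norm_coe_S2 q), real_inner_smul_right, real_inner_smul_right,
    ← mul_add, ← inner_add_left] at hlt
  have h1 : f q - (1 / 2 : ℝ) • (f p₁ + f p₂) = (-(1 / 2) : ℝ) • (f p₁ - f q + (f p₂ - f q)) := by
    module
  rw [h1, real_inner_smul_left]
  have h2 : inner ℝ (f p₁ - f q + (f p₂ - f q)) (normalField f q) < 0 := by
    by_contra hcon
    rw [not_lt] at hcon
    exact absurd hlt (not_lt.mpr (mul_nonneg (by positivity) hcon))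
  linarith

lemma normalField_sub_const (f : E3 → E3) (c : E3) :
    normalField (fun x => f x - c) = normalField f := by
  funext x
  have : fderiv ℝ (fun x => f x - c) = fderiv ℝ f := funext fun x => fderiv_sub_const c
  simp only [normalField, this]

lemma secondForm_sub_const (f : E3 → E3) (c : E3) :
    secondForm (fun x => f x - c) = secondForm f := by
  funext p a b
  have : fderiv ℝ (fun x => f x - c) = fderiv ℝ f := funext fun x => fderiv_sub_const c
  simp only [secondForm, this, normalField_sub_const]

lemma Oval.sub_const {f : E3 → E3} (hf : Oval f) (c : E3) : Oval fun x => f x - c where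
  radial := hf.radial.sub_const c
  neg p hp a ha ha0 := by
    rw [secondForm_sub_const]
    exact hf.neg p hp a ha ha0

/-- **Rigidity of ovals** (Cohn-Vossen): the surfaces are translated such that their support functions
become positive. -/
theorem Oval.exists_congruence {f g : E3 → E3} (hf : Oval f) (hg : Oval g) (hm : SameMetric f g)
    (hd : SameDet f g) : ∃ (U : E3 ≃ₗᵢ[ℝ] E3) (c : E3), ∀ x ≠ 0, g x = U (f x) + c := by
  obtain ⟨o, ho⟩ := hf.exists_support_pos
  obtain ⟨o', ho'⟩ := hg.exists_support_pos
  have hfd : ∀ (k : E3 → E3) (c : E3), fderiv ℝ (fun x => k x - c) = fderiv ℝ k := fun k c =>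
    funext fun x => fderiv_sub_const c
  obtain ⟨U, c, h⟩ := exists_congruence_of_support_pos (hf.sub_const o) (hg.sub_const o')
    (fun p hp a b => by rw [hfd, hfd]; exact hm p hp a b)
    (fun p hp a b ha hb => by rw [secondForm_sub_const, secondForm_sub_const]; exact hd p hp a b ha hb)
    (fun p => by rw [normalField_sub_const]; exact ho p)
    (fun p => by rw [normalField_sub_const]; exact ho' p)
  refine ⟨U, c + o' - U o, fun x hx => ?_⟩
  have h1 := h x hx
  rw [map_sub] at h1
  rw [← sub_add_cancel (g x) o', h1]
  abel

/-! ### Theorema egregium for a parametrized surface -/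

/-- The partial derivatives of a parametrization. -/
def pdV (F : E2 → E3) (A : Fin 2) (z : E2) : E3 := fderiv ℝ F z (EuclideanSpace.single A 1)

lemma contDiff_pdV {F : E2 → E3} (hF : ContDiff ℝ ∞ F) (A : Fin 2) : ContDiff ℝ ∞ (pdV F A) :=
  (hF.fderiv_right (by simp)).clm_apply contDiff_const

lemma pdV_comm {F : E2 → E3} (hF : ContDiff ℝ ∞ F) (A B : Fin 2) (z : E2) :
    pdV (pdV F A) B z = pdV (pdV F B) A z := by
  have h : ∀ A B, pdV (pdV F A) B z
      = fderiv ℝ (fderiv ℝ F) z (EuclideanSpace.single B 1) (EuclideanSpace.single A 1) := by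
    intro A B
    have h1 : HasFDerivAt (pdV F A) ((ContinuousLinearMap.apply ℝ E3
        (EuclideanSpace.single A (1 : ℝ) : E2)).comp (fderiv ℝ (fderiv ℝ F) z)) z :=
      (ContinuousLinearMap.apply ℝ E3 (EuclideanSpace.single A (1 : ℝ) : E2)).hasFDerivAt.comp z
        ((hF.fderiv_right (m := ∞) (by simp)).contDiffAt.differentiableAt (by simp)).hasFDerivAt
    rw [pdV, h1.fderiv]
    rfl
  rw [h, h]
  exact hF.contDiffAt.isSymmSndFDerivAt (by simpa using two_le_infty) _ _

lemma pd_inner {u v : E2 → E3} (hu : ContDiff ℝ ∞ u) (hv : ContDiff ℝ ∞ v) (A : Fin 2) (z : E2) :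
    pd A (fun z => inner ℝ (u z) (v z)) z = inner ℝ (u z) (pdV v A z) + inner ℝ (pdV u A z) (v z) := by
  have h := (hu.contDiffAt.differentiableAt (x := z) (by simp)).hasFDerivAt.inner ℝ
    (hv.contDiffAt.differentiableAt (x := z) (by simp)).hasFDerivAt
  rw [pd, h.fderiv]
  simp [fderivInnerCLM_apply, pdV]

/-- The inner product of two vectors through their components along a basis `f₀`, `f₁` of a plane
and along the normal `f₀ × f₁`. -/
lemma inner_through_plane (f₀ f₁ x y : E3) :
    (inner ℝ f₀ f₀ * inner ℝ f₁ f₁ - inner ℝ f₀ f₁ ^ 2) * inner ℝ x y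
      = inner ℝ f₁ f₁ * (inner ℝ f₀ x * inner ℝ f₀ y)
        - inner ℝ f₀ f₁ * (inner ℝ f₀ x * inner ℝ f₁ y + inner ℝ f₁ x * inner ℝ f₀ y)
        + inner ℝ f₀ f₀ * (inner ℝ f₁ x * inner ℝ f₁ y)
        + inner ℝ x (cross f₀ f₁) * inner ℝ y (cross f₀ f₁) := by
  simp only [inner_eq, cross_0, cross_1, cross_2]
  ring

/-- **Theorema egregium**: the curvature component of the induced metric, times its determinant, is
the determinant of the second fundamental form with respect to the normal `∂₀F × ∂₁F`. -/
theorem riemann0101_mul_det {F : E2 → E3} (hF : ContDiff ℝ ∞ F) (z : E2)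
    {Q : E2 → Matrix (Fin 2) (Fin 2) ℝ}
    (hQ : ∀ z A B, Q z A B = inner ℝ (pdV F A z) (pdV F B z)) (hdet : (Q z).det ≠ 0) :
    riemann0101 Q z * (Q z).det
      = inner ℝ (pdV (pdV F 0) 0 z) (cross (pdV F 0 z) (pdV F 1 z))
          * inner ℝ (pdV (pdV F 1) 1 z) (cross (pdV F 0 z) (pdV F 1 z))
        - inner ℝ (pdV (pdV F 1) 0 z) (cross (pdV F 0 z) (pdV F 1 z)) ^ 2 := by
  have h1 := contDiff_pdV hF
  have h2 : ∀ A B, ContDiff ℝ ∞ (pdV (pdV F A) B) := fun A B => contDiff_pdV (h1 A) B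
  have hQ' : ∀ A B, (fun z => Q z A B) = fun z => inner ℝ (pdV F A z) (pdV F B z) :=
    fun A B => funext fun z => hQ z A B
  have hpd : ∀ A B C, (pd C fun z => Q z A B) = fun z =>
      inner ℝ (pdV F A z) (pdV (pdV F B) C z) + inner ℝ (pdV (pdV F A) C z) (pdV F B z) := by
    intro A B C
    funext z
    rw [hQ', pd_inner (h1 A) (h1 B)]
  have hpdpd : ∀ A B C D, pd D (pd C fun z => Q z A B) z =
      inner ℝ (pdV F A z) (pdV (pdV (pdV F B) C) D z)
      + inner ℝ (pdV (pdV F A) D z) (pdV (pdV F B) C z)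
      + (inner ℝ (pdV (pdV F A) C z) (pdV (pdV F B) D z)
      + inner ℝ (pdV (pdV (pdV F A) C) D z) (pdV F B z)) := by
    intro A B C D
    have e1 : DifferentiableAt ℝ (fun z => inner ℝ (pdV F A z) (pdV (pdV F B) C z)) z :=
      ((h1 A).inner ℝ (h2 B C)).contDiffAt.differentiableAt (by simp)
    have e2 : DifferentiableAt ℝ (fun z => inner ℝ (pdV (pdV F A) C z) (pdV F B z)) z :=
      ((h2 A C).inner ℝ (h1 B)).contDiffAt.differentiableAt (by simp)
    rw [hpd, ← pd_inner (h1 A) (h2 B C), ← pd_inner (h2 A C) (h1 B)]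
    simp only [pd]
    rw [fderiv_fun_add e1 e2]
    rfl
  have hsymm : ∀ A B, pdV (pdV F A) B = pdV (pdV F B) A := fun A B => funext fun z =>
    pdV_comm hF A B z
  have hgamma : ∀ C A B, gamma Q C A B z = inner ℝ (pdV F C z) (pdV (pdV F B) A z) := by
    intro C A B
    simp only [gamma, hpd]
    rw [hsymm C A, hsymm C B, hsymm A B, real_inner_comm (pdV F A z) (pdV (pdV F B) C z),
      real_inner_comm (pdV F B z)]
    ring
  have hT1 : pdV (pdV (pdV F 0) 1) 1 z = pdV (pdV (pdV F 1) 1) 0 z := by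
    rw [hsymm 0 1]; exact pdV_comm (h1 1) 0 1 z
  have hT2 : pdV (pdV (pdV F 1) 0) 0 z = pdV (pdV (pdV F 0) 1) 0 z := by rw [hsymm 1 0]
  set a := pdV (pdV F 1) 0 z with ha
  set b := pdV (pdV F 0) 0 z with hb
  set c := pdV (pdV F 1) 1 z with hc
  have ha' : pdV (pdV F 0) 1 z = a := by rw [hsymm 0 1]
  have hdet' : (Q z).det = inner ℝ (pdV F 0 z) (pdV F 0 z) * inner ℝ (pdV F 1 z) (pdV F 1 z)
      - inner ℝ (pdV F 0 z) (pdV F 1 z) ^ 2 := by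
    rw [Matrix.det_fin_two, hQ, hQ, hQ, hQ, real_inner_comm (pdV F 0 z) (pdV F 1 z)]
    ring
  have hinv : ∀ x y : E3, (∑ C, ∑ D, (Q z)⁻¹ C D * (inner ℝ (pdV F C z) x * inner ℝ (pdV F D z) y))
      * (Q z).det = inner ℝ (pdV F 1 z) (pdV F 1 z)
          * (inner ℝ (pdV F 0 z) x * inner ℝ (pdV F 0 z) y)
        - inner ℝ (pdV F 0 z) (pdV F 1 z) * (inner ℝ (pdV F 0 z) x * inner ℝ (pdV F 1 z) y
          + inner ℝ (pdV F 1 z) x * inner ℝ (pdV F 0 z) y)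
        + inner ℝ (pdV F 0 z) (pdV F 0 z) * (inner ℝ (pdV F 1 z) x * inner ℝ (pdV F 1 z) y) := by
    intro x y
    rw [Matrix.inv_def, Matrix.adjugate_fin_two]
    simp only [Fin.sum_univ_two, Ring.inverse_eq_inv', Matrix.smul_apply, Matrix.of_apply,
      Matrix.cons_val_zero, Matrix.cons_val_one, Matrix.cons_val', hQ, smul_eq_mul,
      Matrix.cons_val_fin_one]
    rw [real_inner_comm (pdV F 0 z) (pdV F 1 z)]
    field_simp
    ring
  have hsplit : (∑ C, ∑ D, (Q z)⁻¹ C D *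
      (gamma Q C 0 1 z * gamma Q D 0 1 z - gamma Q C 0 0 z * gamma Q D 1 1 z))
      = (∑ C, ∑ D, (Q z)⁻¹ C D * (inner ℝ (pdV F C z) a * inner ℝ (pdV F D z) a))
        - ∑ C, ∑ D, (Q z)⁻¹ C D * (inner ℝ (pdV F C z) b * inner ℝ (pdV F D z) c) := by
    simp only [hgamma, mul_sub, Finset.sum_sub_distrib]
    rfl
  rw [riemann0101, hsplit, add_mul, sub_mul, hinv, hinv, hdet']
  have i1 := inner_through_plane (pdV F 0 z) (pdV F 1 z) a a
  have i2 := inner_through_plane (pdV F 0 z) (pdV F 1 z) b c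
  -- The third derivatives of `F` cancel. The second derivatives of the metric leave
  -- `⟪∂₀∂₀F, ∂₁∂₁F⟫ - ‖∂₀∂₁F‖ ^ 2`, and the Christoffel symbols remove the tangential part of this.
  rw [hpdpd, hpdpd, hpdpd, hT1, hT2, ← hc, ← hb, ← ha, ha',
    real_inner_comm (pdV F 0 z) (pdV (pdV (pdV F 1) 1) 0 z),
    real_inner_comm (pdV F 1 z) (pdV (pdV (pdV F 0) 1) 0 z)]
  linear_combination i2 - i1

/-! ### Smooth maps on the sphere and their radial extensions -/

/-- The radially constant extension of a map on the unit sphere. -/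
def radialExt (f : S2 → E3) (x : E3) : E3 := f (sphereProj x)

lemma radialExt_coe (f : S2 → E3) (p : S2) : radialExt f p = f p := by
  rw [radialExt, sphereProj_coe]

lemma contMDiffAt_sphereProj {x : E3} (hx : x ≠ 0) :
    ContMDiffAt 𝓘(ℝ, E3) (𝓡 2) ∞ sphereProj x := by
  have : Fact (Module.finrank ℝ E3 = 2 + 1) := ⟨by simp⟩
  let U : TopologicalSpace.Opens E3 := ⟨{0}ᶜ, isOpen_compl_singleton⟩
  have h1 : ContMDiff 𝓘(ℝ, E3) 𝓘(ℝ, E3) ∞ (fun y : U => (‖(y : E3)‖⁻¹ • (y : E3) : E3)) := by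
    intro y
    have hy : (y : E3) ≠ 0 := y.2
    have h : ContMDiffAt 𝓘(ℝ, E3) 𝓘(ℝ, E3) ∞ (fun z : E3 => ‖z‖⁻¹ • z) (y : E3) :=
      contMDiffAt_iff_contDiffAt.mpr <| (radial_normalize (g := fun z : E3 => z) fun _ _ => contDiffAt_id).smooth (y : E3) hy
    exact contMDiffAt_subtype_iff.mpr h
  have h2 := h1.codRestrict_sphere (n := 2) (fun y => by
    have hy : (y : E3) ≠ 0 := y.2
    simpa using norm_normalize hy)
  have h3 : ContMDiffAt 𝓘(ℝ, E3) (𝓡 2) ∞ (fun y : U => sphereProj y) ⟨x, hx⟩ := by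
    refine (h2 ⟨x, hx⟩).congr_of_eventuallyEq (Eventually.of_forall fun y => ?_)
    exact Subtype.ext (coe_sphereProj y.2)
  exact contMDiffAt_subtype_iff.mp h3

lemma radial_radialExt {f : S2 → E3} (hf : ContMDiff (𝓡 2) 𝓘(ℝ, E3) ∞ f) :
    Radial (radialExt f) where
  smooth x hx := contMDiffAt_iff_contDiffAt.mp ((hf _).comp x (contMDiffAt_sphereProj hx))
  homog r hr x := by rw [radialExt, sphereProj_smul hr, radialExt]

lemma contMDiff_coe_S2 {n : WithTop ℕ∞} :
    ContMDiff (𝓡 2) 𝓘(ℝ, E3) n (fun p : S2 => (p : E3)) := by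
  have : Fact (Module.finrank ℝ E3 = 2 + 1) := ⟨by simp⟩
  exact contMDiff_coe_sphere

/-- The inclusion of the tangent space of the unit sphere into `E3`. -/
def tangentIncl (p : S2) : TS p →L[ℝ] E3 := mvfderiv (𝓡 2) (fun p : S2 => (p : E3)) p

lemma tangentIncl_injective (p : S2) : Function.Injective (tangentIncl p) := by
  have : Fact (Module.finrank ℝ E3 = 2 + 1) := ⟨by simp⟩
  exact injective_mvfderiv_subtypeVal_sphere p

lemma exists_tangentIncl_eq_iff {p : S2} {x : E3} :
    (∃ a, tangentIncl p a = x) ↔ inner ℝ x (p : E3) = 0 := by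
  have : Fact (Module.finrank ℝ E3 = 2 + 1) := ⟨by simp⟩
  have h := range_mvfderiv_subtypeVal (E := E3) (n := 2) p
  have h2 : x ∈ (tangentIncl p).range ↔ x ∈ (ℝ ∙ (p : E3))ᗮ := by rw [← h]; rfl
  rw [Submodule.mem_orthogonal_singleton_iff_inner_left] at h2
  exact h2

lemma inner_tangentIncl (p : S2) (a : TS p) : inner ℝ (tangentIncl p a) (p : E3) = 0 :=
  exists_tangentIncl_eq_iff.mp ⟨a, rfl⟩

lemma mvfderiv_eq_fderiv {f : S2 → E3} {g : E3 → E3} (hg : Radial g) (h : ∀ p : S2, f p = g p)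
    (p : S2) (a : TS p) : mvfderiv (𝓡 2) f p a = fderiv ℝ g p (tangentIncl p a) := by
  have hfg : f = g ∘ fun p : S2 => (p : E3) := funext h
  have h1 : MDifferentiableAt (𝓡 2) 𝓘(ℝ, E3) (fun p : S2 => (p : E3)) p :=
    (contMDiff_coe_S2 (n := 1) p).mdifferentiableAt one_ne_zero
  have h2 : MDifferentiableAt 𝓘(ℝ, E3) 𝓘(ℝ, E3) g (p : E3) :=
    (hg.differentiableAt (coe_S2_ne_zero p)).mdifferentiableAt
  have h3 := mfderiv_comp_apply p h2 h1 a
  rw [mfderiv_eq_fderiv] at h3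
  rw [hfg]
  exact h3

lemma mvfderiv_eq {f : S2 → E3} (hf : ContMDiff (𝓡 2) 𝓘(ℝ, E3) ∞ f) (p : S2) (a : TS p) :
    mvfderiv (𝓡 2) f p a = fderiv ℝ (radialExt f) p (tangentIncl p a) :=
  mvfderiv_eq_fderiv (radial_radialExt hf) (fun p => (radialExt_coe f p).symm) p a

lemma pullback_eq {f : S2 → E3} (hf : ContMDiff (𝓡 2) 𝓘(ℝ, E3) ∞ f) (p : S2) (a b : TS p) :
    pullback f p a b = inner ℝ (fderiv ℝ (radialExt f) p (tangentIncl p a))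
      (fderiv ℝ (radialExt f) p (tangentIncl p b)) := by
  rw [pullback, mvfderiv_eq hf, mvfderiv_eq hf]

lemma cross_fderiv_tangent (f : E3 → E3) {p a b : E3} (hp : ‖p‖ = 1) (ha : inner ℝ a p = 0)
    (hb : inner ℝ b p = 0) :
    cross (fderiv ℝ f p a) (fderiv ℝ f p b) = inner ℝ (cross a b) p • normalField f p := by
  obtain ⟨e₁, e₂, hF⟩ := exists_oframe hp
  rw [normalField_eq f hF, hF.expansion_tangent ha, hF.expansion_tangent hb]
  generalize inner ℝ a e₁ = a1
  generalize inner ℝ a e₂ = a2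
  generalize inner ℝ b e₁ = b1
  generalize inner ℝ b e₂ = b2
  have h1 : ∀ x y : E3, cross (a1 • x + a2 • y) (b1 • x + b2 • y)
      = (a1 * b2 - a2 * b1) • cross x y := fun x y => by
    apply E3.ext_coord <;> simp <;> ring
  simp only [map_add (fderiv ℝ f p), map_smul (fderiv ℝ f p)]
  rw [h1, h1, hF.cross_eq, real_inner_smul_left, hF.inner_p_p, mul_one]

lemma cross_tangent {p a b : E3} (hp : ‖p‖ = 1) (ha : inner ℝ a p = 0) (hb : inner ℝ b p = 0) :
    cross a b = inner ℝ (cross a b) p • p := by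
  obtain ⟨e₁, e₂, hF⟩ := exists_oframe hp
  rw [hF.expansion_tangent ha, hF.expansion_tangent hb]
  generalize inner ℝ a e₁ = a1
  generalize inner ℝ a e₂ = a2
  generalize inner ℝ b e₁ = b1
  generalize inner ℝ b e₂ = b2
  have h1 : ∀ x y : E3, cross (a1 • x + a2 • y) (b1 • x + b2 • y)
      = (a1 * b2 - a2 * b1) • cross x y := fun x y => by
    apply E3.ext_coord <;> simp <;> ring
  rw [h1, hF.cross_eq, real_inner_smul_left, hF.inner_p_p, mul_one]

lemma Radial.secondForm_det {f : E3 → E3} (hf : Radial f) {p e₁ e₂ a b : E3}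
    (hF : OFrame p e₁ e₂) (hp : ‖p‖ = 1) (ha : inner ℝ a p = 0) (hb : inner ℝ b p = 0) :
    secondForm f p a a * secondForm f p b b - secondForm f p a b ^ 2
      = inner ℝ (cross a b) p ^ 2
        * (secondForm f p e₁ e₁ * secondForm f p e₂ e₂ - secondForm f p e₁ e₂ ^ 2) := by
  have hs : secondForm f p e₂ e₁ = secondForm f p e₁ e₂ := by
    rw [secondForm, hf.snd_symm (ne_zero_of_norm_one hp), secondForm]
  rw [hF.expansion_tangent ha, hF.expansion_tangent hb]
  generalize inner ℝ a e₁ = a1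
  generalize inner ℝ a e₂ = a2
  generalize inner ℝ b e₁ = b1
  generalize inner ℝ b e₂ = b2
  have h1 : ∀ x y : E3, cross (a1 • x + a2 • y) (b1 • x + b2 • y)
      = (a1 * b2 - a2 * b1) • cross x y := fun x y => by
    apply E3.ext_coord <;> simp <;> ring
  have h2 : ∀ c1 c2 d1 d2 : ℝ, secondForm f p (c1 • e₁ + c2 • e₂) (d1 • e₁ + d2 • e₂)
      = c1 * d1 * secondForm f p e₁ e₁ + (c1 * d2 + c2 * d1) * secondForm f p e₁ e₂
        + c2 * d2 * secondForm f p e₂ e₂ := by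
    intro c1 c2 d1 d2
    have hs' := hs
    simp only [secondForm] at hs' ⊢
    simp only [map_add, map_smul, _root_.add_apply, _root_.smul_apply, inner_add_left,
      real_inner_smul_left, hs']
    ring
  rw [h1, hF.cross_eq, real_inner_smul_left, hF.inner_p_p, h2, h2, h2]
  ring

lemma inner_cross_tangentIncl_ne_zero (p : S2) :
    inner ℝ (cross (tangentIncl p (EuclideanSpace.single 0 (1 : ℝ) : E2))
      (tangentIncl p (EuclideanSpace.single 1 (1 : ℝ) : E2))) (p : E3) ≠ 0 := by
  set x : TS p := (EuclideanSpace.single 0 (1 : ℝ) : E2) with hx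
  set y : TS p := (EuclideanSpace.single 1 (1 : ℝ) : E2) with hy
  intro h0
  have h1 := cross_tangent (norm_coe_S2 p) (inner_tangentIncl p x) (inner_tangentIncl p y)
  rw [h0, zero_smul] at h1
  have h2 := cross_cross (tangentIncl p x) (tangentIncl p x) (tangentIncl p y)
  rw [h1, show cross (tangentIncl p x) 0 = 0 by simp [cross], ← map_smul, ← map_smul,
    ← map_sub] at h2
  have h3 := tangentIncl_injective p (h2.symm.trans (map_zero _).symm)
  have h4 : inner ℝ (tangentIncl p x) (tangentIncl p x) = 0 := by
    have h : (inner ℝ (tangentIncl p x) (tangentIncl p y) • EuclideanSpace.single 0 (1 : ℝ)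
      - inner ℝ (tangentIncl p x) (tangentIncl p x) • EuclideanSpace.single 1 (1 : ℝ) : E2) = 0 := h3
    generalize inner ℝ (tangentIncl p x) (tangentIncl p x) = c at h
    simpa using congrArg (fun v : E2 => v 1) h
  have h5 := tangentIncl_injective p ((inner_self_eq_zero.mp h4).trans (map_zero _).symm)
  have h6 : (EuclideanSpace.single 0 (1 : ℝ) : E2) = 0 := h5
  simpa using congrArg (fun v : E2 => v 0) h6

lemma areaDensity_eq {f : S2 → E3} (hf : ContMDiff (𝓡 2) 𝓘(ℝ, E3) ∞ f) (p : S2) :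
    areaDensity f p = ‖normalField (radialExt f) p‖ := by
  have hne := inner_cross_tangentIncl_ne_zero p
  have hdet : ∀ G : Fin 2 → E3, (Matrix.of fun A B : Fin 2 => inner ℝ (G A) (G B)).det
      = inner ℝ (cross (G 0) (G 1)) (cross (G 0) (G 1)) := by
    intro G
    rw [Matrix.det_fin_two, inner_cross_cross]
    simp [real_inner_comm (G 0) (G 1)]
  have hn := norm_coe_S2 p
  let E : Fin 2 → E3 := fun A => tangentIncl p (EuclideanSpace.single A (1 : ℝ) : E2)
  have h1 := hdet fun A => fderiv ℝ (radialExt f) p (E A)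
  have h2 := hdet E
  have k1 := cross_fderiv_tangent (radialExt f) hn (a := E 0) (b := E 1) (inner_tangentIncl p _)
    (inner_tangentIncl p _)
  have k2 := cross_tangent hn (a := E 0) (b := E 1) (inner_tangentIncl p _)
    (inner_tangentIncl p _)
  have hne : inner ℝ (cross (E 0) (E 1)) (p : E3) ≠ 0 := hne
  rw [k1, real_inner_smul_left, real_inner_smul_right] at h1
  rw [k2, real_inner_smul_left, real_inner_smul_right] at h2
  have hpp : inner ℝ (p : E3) (p : E3) = 1 := by rw [real_inner_self_eq_norm_sq, hn]; norm_num
  have m1 : (Matrix.of fun A B : Fin 2 => pullback f p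
      (EuclideanSpace.single A (1 : ℝ) : E2) (EuclideanSpace.single B (1 : ℝ) : E2))
      = Matrix.of fun A B : Fin 2 => inner ℝ (fderiv ℝ (radialExt f) p (E A))
        (fderiv ℝ (radialExt f) p (E B)) := by
    ext A B
    exact pullback_eq hf p _ _
  rw [areaDensity, m1, h1]
  refine (congrArg Real.sqrt (congrArg₂ (· / ·) rfl h2)).trans ?_
  rw [hpp, real_inner_self_eq_norm_sq, ← mul_assoc, mul_one, mul_div_cancel_left₀ _
    (mul_ne_zero hne hne), Real.sqrt_sq (norm_nonneg _)]

/-! ### The scalar curvature of an embedded sphere -/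

/-- The charts of the sphere, being stereographic projections, have the whole plane as target. -/
lemma contMDiff_extChartAt_symm_S2 (p : S2) :
    ContMDiff (𝓡 2) (𝓡 2) ∞ (extChartAt (𝓡 2) p).symm := by
  have h := contMDiffOn_extChartAt_symm (I := 𝓡 2) (n := ∞) p
  have ht : (extChartAt (𝓡 2) p).target = univ := by
    have : Fact (Module.finrank ℝ E3 = 2 + 1) := ⟨by simp⟩
    have h2 : (chartAt E2 p).target = univ := stereographic'_target (-p)
    rw [extChartAt_target, h2]
    simp
  rw [ht] at h
  exact contMDiffOn_univ.mp h

/-- The partial derivatives of a surface in a chart of the sphere. -/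
lemma pdV_chart {f : S2 → E3} (hf : ContMDiff (𝓡 2) 𝓘(ℝ, E3) ∞ f) (p : S2) (A : Fin 2) (z : E2) :
    pdV (fun z => f ((extChartAt (𝓡 2) p).symm z)) A z
      = mvfderiv (𝓡 2) f ((extChartAt (𝓡 2) p).symm z)
        (mfderiv (𝓡 2) (𝓡 2) (extChartAt (𝓡 2) p).symm z (EuclideanSpace.single A (1 : ℝ) : E2)) := by
  have h1 : MDifferentiableAt (𝓡 2) (𝓡 2) (extChartAt (𝓡 2) p).symm z :=
    (contMDiff_extChartAt_symm_S2 p z).mdifferentiableAt (by simp)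
  have h2 : MDifferentiableAt (𝓡 2) 𝓘(ℝ, E3) f ((extChartAt (𝓡 2) p).symm z) :=
    (hf _).mdifferentiableAt (by simp)
  have h3 := mfderiv_comp_apply z h2 h1 (EuclideanSpace.single A (1 : ℝ) : E2)
  rw [pdV]
  refine Eq.trans ?_ h3
  rw [mfderiv_eq_fderiv]
  rfl

lemma contDiff_chart {f : S2 → E3} (hf : ContMDiff (𝓡 2) 𝓘(ℝ, E3) ∞ f) (p : S2) :
    ContDiff ℝ ∞ (fun z => f ((extChartAt (𝓡 2) p).symm z)) :=
  contMDiff_iff_contDiff.mp (hf.comp (contMDiff_extChartAt_symm_S2 p))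

lemma chartGram_pullback {f : S2 → E3} (hf : ContMDiff (𝓡 2) 𝓘(ℝ, E3) ∞ f) (p : S2) (z : E2)
    (A B : Fin 2) : chartGram (pullback f) p z A B
      = inner ℝ (pdV (fun z => f ((extChartAt (𝓡 2) p).symm z)) A z)
        (pdV (fun z => f ((extChartAt (𝓡 2) p).symm z)) B z) := by
  rw [pdV_chart hf, pdV_chart hf]
  rfl

/-- **Theorema egregium**, for the radial extension of a surface. -/
lemma scalarCurvature_pullback {f : S2 → E3} (hf : ContMDiff (𝓡 2) 𝓘(ℝ, E3) ∞ f) (p : S2)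
    (hne : scalarCurvature (pullback f) p ≠ 0) {e₁ e₂ : E3} (hF : OFrame p e₁ e₂) :
    normalField (radialExt f) p ≠ 0 ∧
    scalarCurvature (pullback f) p * ‖normalField (radialExt f) p‖ ^ 4
      = 2 * (secondForm (radialExt f) p e₁ e₁ * secondForm (radialExt f) p e₂ e₂
        - secondForm (radialExt f) p e₁ e₂ ^ 2) := by
  set s := (extChartAt (𝓡 2) p).symm with hs
  set z₀ := extChartAt (𝓡 2) p p with hz₀
  have hsz : s z₀ = p := extChartAt_to_inv p
  set F : E2 → E3 := fun z => f (s z) with hFdef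
  set S : E2 → E3 := fun z => (s z : E3) with hSdef
  set g := radialExt f with hg
  have hgr : Radial g := radial_radialExt hf
  have hFs : ContDiff ℝ ∞ F := contDiff_chart hf p
  have hSs : ContDiff ℝ ∞ S := contDiff_chart contMDiff_coe_S2 p
  have hS0 : ∀ z, S z ≠ 0 := fun z => coe_S2_ne_zero _
  have hFS : ∀ z, F z = g (S z) := fun z => (radialExt_coe f _).symm
  have hSt : ∀ A z, inner ℝ (pdV S A z) (S z) = 0 := by
    intro A z
    have h := pdV_chart contMDiff_coe_S2 p A z
    rw [hSdef, h]
    exact inner_tangentIncl _ _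
  have hFA : ∀ A, pdV F A = fun z => fderiv ℝ g (S z) (pdV S A z) := by
    intro A
    funext z
    have h : HasFDerivAt F ((fderiv ℝ g (S z)).comp (fderiv ℝ S z)) z := by
      have := (hgr.differentiableAt (hS0 z)).hasFDerivAt.comp z
        (hSs.contDiffAt.differentiableAt (by simp)).hasFDerivAt
      exact this.congr_of_eventuallyEq (Eventually.of_forall hFS)
    rw [pdV, h.fderiv]
    rfl
  have hFAB : ∀ A B z, pdV (pdV F A) B z = fderiv ℝ (fderiv ℝ g) (S z) (pdV S B z) (pdV S A z)
      + fderiv ℝ g (S z) (pdV (pdV S A) B z) := by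
    intro A B z
    have h1 : HasFDerivAt (fun z => fderiv ℝ g (S z))
        ((fderiv ℝ (fderiv ℝ g) (S z)).comp (fderiv ℝ S z)) z :=
      (hgr.differentiableAt_fderiv (hS0 z)).hasFDerivAt.comp z
        (hSs.contDiffAt.differentiableAt (by simp)).hasFDerivAt
    have h2 := h1.clm_apply
      ((contDiff_pdV hSs A).contDiffAt.differentiableAt (x := z) (by simp)).hasFDerivAt
    rw [hFA, pdV, h2.fderiv]
    simp [pdV, add_comm]
  have hSp : S z₀ = p := congrArg Subtype.val hsz
  have hp := norm_coe_S2 p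
  set a := pdV S 0 z₀ with ha
  set b := pdV S 1 z₀ with hb
  have hat : inner ℝ a (p : E3) = 0 := by rw [← hSp]; exact hSt 0 z₀
  have hbt : inner ℝ b (p : E3) = 0 := by rw [← hSp]; exact hSt 1 z₀
  -- `l` is the area of the parallelogram of the coordinate vectors, and `hn` compares the normals.
  set l := inner ℝ (cross a b) (p : E3) with hl
  have hn : cross (pdV F 0 z₀) (pdV F 1 z₀) = l • normalField g p := by
    rw [hFA, hFA]
    simp only [hSp]
    exact cross_fderiv_tangent g hp hat hbt
  have hII : ∀ A B, inner ℝ (pdV (pdV F A) B z₀) (cross (pdV F 0 z₀) (pdV F 1 z₀))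
      = l * secondForm g p (pdV S B z₀) (pdV S A z₀) := by
    intro A B
    rw [hn, hFAB, real_inner_smul_right, hSp, inner_add_left, hgr.inner_fderiv_normalField hp,
      add_zero, secondForm]
  -- For a degenerate metric the scalar curvature, as a quotient by zero, would be zero.
  have hdet0 : (chartGram (pullback f) p z₀).det ≠ 0 := by
    intro h
    apply hne
    rw [scalarCurvature, ← hz₀, h, div_zero]
  have hR := riemann0101_mul_det hFs z₀ (chartGram_pullback hf p) hdet0
  rw [hII, hII, hII] at hR
  have hdet : (chartGram (pullback f) p z₀).det = l ^ 2 * ‖normalField g p‖ ^ 2 := by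
    rw [Matrix.det_fin_two]
    simp only [chartGram_pullback hf]
    have h := inner_cross_cross (pdV F 0 z₀) (pdV F 1 z₀) (pdV F 0 z₀) (pdV F 1 z₀)
    rw [hn, real_inner_smul_left, real_inner_smul_right, real_inner_self_eq_norm_sq] at h
    rw [real_inner_comm (pdV F 0 z₀) (pdV F 1 z₀)] at h ⊢
    linear_combination -h
  have hN : ‖normalField g p‖ ≠ 0 := fun h => hdet0 (by rw [hdet, h]; ring)
  have hl0 : l ≠ 0 := fun h => hdet0 (by rw [hdet, h]; ring)
  refine ⟨norm_ne_zero_iff.mp hN, ?_⟩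
  have hsd := hgr.secondForm_det hF hp hat hbt
  have hsym : secondForm g p b a = secondForm g p a b := by
    rw [secondForm, hgr.snd_symm (ne_zero_of_norm_one hp), secondForm]
  rw [scalarCurvature, ← hz₀]
  have e1 : 2 * riemann0101 (chartGram (pullback f) p) z₀ / (chartGram (pullback f) p z₀).det
      = 2 * (riemann0101 (chartGram (pullback f) p) z₀ * (chartGram (pullback f) p z₀).det)
        / (chartGram (pullback f) p z₀).det ^ 2 := by
    field_simp
  rw [e1, hR, hdet]
  have e2 : l * secondForm g p a a * (l * secondForm g p b b) - (l * secondForm g p a b) ^ 2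
      = l ^ 4 * (secondForm g p e₁ e₁ * secondForm g p e₂ e₂ - secondForm g p e₁ e₂ ^ 2) := by
    rw [← hl] at hsd
    linear_combination l ^ 2 * hsd
  rw [← ha, ← hb, e2]
  field_simp

lemma pullback_const_smul {f : S2 → E3} (hf : ContMDiff (𝓡 2) 𝓘(ℝ, E3) ∞ f) {ε : ℝ}
    (hε : ε * ε = 1) : pullback (fun p => ε • f p) = pullback f := by
  have hg := radial_radialExt hf
  funext p a b
  have h := mvfderiv_eq_fderiv (f := fun p => ε • f p) (hg.const_smul ε)
    (fun p => by rw [radialExt_coe])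
  rw [pullback, h, h, pullback_eq hf, fderiv_fun_const_smul (hg.differentiableAt (coe_S2_ne_zero p))]
  simp only [_root_.smul_apply, real_inner_smul_left, real_inner_smul_right]
  rw [← mul_assoc, hε, one_mul]

lemma Radial.fderiv_fderiv_self {f : E3 → E3} (hf : Radial f) {x : E3} (hx : x ≠ 0) (b : E3) :
    fderiv ℝ (fderiv ℝ f) x b x = - fderiv ℝ f x b := by
  have h1 := (hf.differentiableAt_fderiv hx).hasFDerivAt.clm_apply (hasFDerivAt_id x)
  have h2 : (fun y => fderiv ℝ f y (id y)) =ᶠ[𝓝 x] fun _ => (0 : E3) := by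
    filter_upwards [isOpen_compl_singleton.mem_nhds (show x ∈ ({0}ᶜ : Set E3) from hx)] with y hy
    exact hf.fderiv_self hy
  have h3 := (h1.congr_of_eventuallyEq h2.symm).unique (hasFDerivAt_const (0 : E3) x)
  have h4 := congrArg (fun L : E3 →L[ℝ] E3 => L b) h3
  simp at h4
  exact eq_neg_of_add_eq_zero_right h4

lemma secondForm_const_smul {f : E3 → E3} (hf : Radial f) {p : E3} (hp : ‖p‖ = 1) {ε : ℝ}
    (hε : ε * ε = 1) (a b : E3) :
    secondForm (fun x => ε • f x) p a b = ε * secondForm f p a b := by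
  have h1 : ∀ x ≠ 0, fderiv ℝ (fun x => ε • f x) x = ε • fderiv ℝ f x := fun x hx =>
    fderiv_fun_const_smul (hf.differentiableAt hx) ε
  have hp0 := ne_zero_of_norm_one hp
  have h2 : fderiv ℝ (fderiv ℝ fun x => ε • f x) p = ε • fderiv ℝ (fderiv ℝ f) p := by
    rw [← fderiv_fun_const_smul (hf.differentiableAt_fderiv hp0)]
    refine Filter.EventuallyEq.fderiv_eq ?_
    filter_upwards [isOpen_compl_singleton.mem_nhds (show p ∈ ({0}ᶜ : Set E3) from hp0)] with y hy
    exact h1 y hy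
  have h3 : normalField (fun x => ε • f x) p = normalField f p := by
    obtain ⟨e₁, e₂, hF⟩ := exists_oframe hp
    rw [normalField_eq _ hF, normalField_eq _ hF, h1 p hp0]
    simp [cross, smul_smul, hε]
  rw [secondForm, secondForm, h2, h3]
  simp [real_inner_smul_left]

lemma trace_frame (B : E3 →L[ℝ] E3 →L[ℝ] ℝ) {p e₁ e₂ : E3} (hF : OFrame p e₁ e₂) :
    ∑ i, B (bas i) (bas i) = B e₁ e₁ + B e₂ e₂ + B p p := by
  have h : ∀ i j, e₁ i * e₁ j + e₂ i * e₂ j + p i * p j = if i = j then 1 else 0 := by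
    intro i j
    have h1 := congrArg (fun v : E3 => v j) (hF.expansion (bas i))
    have h2 : (bas i : E3) j = if i = j then 1 else 0 := by
      simp [bas, eq_comm]
    rw [← h2, h1]
    simp [bas, EuclideanSpace.inner_single_left]
  have hB : ∀ e : E3, B e e = ∑ i, ∑ j, e i * e j * B (bas i) (bas j) := by
    intro e
    conv_lhs => rw [eq_sum_bas e]
    simp only [Fin.sum_univ_three, map_add, map_smul, _root_.add_apply, _root_.smul_apply,
      smul_eq_mul]
    ring
  rw [hB e₁, hB e₂, hB p]
  simp only [← Finset.sum_add_distrib, ← add_mul, h, ite_mul, one_mul, zero_mul,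
    Finset.sum_ite_eq, Finset.mem_univ, if_true]

/-- A binary quadratic form with positive determinant and negative trace is negative definite. -/
lemma quadratic_neg {l m n x y : ℝ} (hT : l + n < 0) (hd : 0 < l * n - m ^ 2)
    (hxy : 0 < x ^ 2 + y ^ 2) : x ^ 2 * l + 2 * x * y * m + y ^ 2 * n < 0 := by
  have hl : l < 0 := by
    by_contra h
    push Not at h
    nlinarith [sq_nonneg m, sq_nonneg l]
  have hq : l * (x ^ 2 * l + 2 * x * y * m + y ^ 2 * n) = (x * l + y * m) ^ 2
      + y ^ 2 * (l * n - m ^ 2) := by ring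
  have hpos : 0 < (x * l + y * m) ^ 2 + y ^ 2 * (l * n - m ^ 2) := by
    by_cases hy : y = 0
    · have hx : x ≠ 0 := by rintro h; rw [h, hy] at hxy; simp at hxy
      have := mul_ne_zero hx hl.ne
      rw [hy, zero_mul, add_zero]
      positivity
    · have := mul_pos (pow_pos (abs_pos.mpr hy) 2) hd
      rw [sq_abs] at this
      nlinarith [sq_nonneg (x * l + y * m)]
  rw [← hq] at hpos
  by_contra h
  push Not at h
  exact hpos.not_ge (mul_nonpos_of_nonpos_of_nonneg hl.le h)

/-- A surface of positive curvature is, up to a point reflection, an oval. -/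
theorem exists_sign_oval {f : S2 → E3} (hf : ContMDiff (𝓡 2) 𝓘(ℝ, E3) ∞ f)
    (hpos : ∀ p, 0 < scalarCurvature (pullback f) p) :
    ∃ ε : ℝ, ε * ε = 1 ∧ Oval (radialExt fun p => ε • f p) := by
  set g := radialExt f with hg
  have hgr : Radial g := radial_radialExt hf
  have hdet : ∀ p : S2, ∀ e₁ e₂, OFrame p e₁ e₂ →
      0 < secondForm g p e₁ e₁ * secondForm g p e₂ e₂ - secondForm g p e₁ e₂ ^ 2 := by
    intro p e₁ e₂ hF
    obtain ⟨h1, h2⟩ := scalarCurvature_pullback hf p (hpos p).ne' hF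
    have : 0 < ‖normalField g p‖ := norm_pos_iff.mpr h1
    have := mul_pos (hpos p) (pow_pos this 4)
    linarith
  -- The trace of the second fundamental form over the tangent plane. The radial direction does not
  -- contribute to it, so it may be taken over the standard basis, which makes it continuous.
  set τ : S2 → ℝ := fun p => ∑ i, secondForm g p (bas i) (bas i) with hτ
  have hτF : ∀ p : S2, ∀ e₁ e₂, OFrame p e₁ e₂ →
      τ p = secondForm g p e₁ e₁ + secondForm g p e₂ e₂ := by
    intro p e₁ e₂ hF
    let B : E3 →L[ℝ] E3 →L[ℝ] ℝ :=
      ((ContinuousLinearMap.compL ℝ E3 E3 ℝ (innerSL ℝ (normalField g p))).comp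
        (fderiv ℝ (fderiv ℝ g) p))
    have hB : ∀ a b, B a b = secondForm g p a b := fun a b => by
      simp [B, secondForm, real_inner_comm]
    have h := trace_frame B hF
    simp only [hB] at h
    have h0 : secondForm g p p p = 0 := by
      rw [secondForm, hgr.fderiv_fderiv_self (coe_S2_ne_zero p),
        hgr.fderiv_self (coe_S2_ne_zero p)]
      simp
    rw [hτ]
    simp only
    rw [h, h0, add_zero]
  have hτc : Continuous τ := by
    refine continuous_finsetSum _ fun i _ => ?_
    have h2 : ContinuousOn (fun x : E3 => secondForm g x (bas i) (bas i)) {0}ᶜ := fun x hx =>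
      ((((hgr.contDiffAt_fderiv_fderiv hx).continuousAt.clm_apply continuousAt_const).clm_apply
        continuousAt_const).inner (𝕜 := ℝ)
        (hgr.contDiffAt_normalField hx).continuousAt).continuousWithinAt
    exact h2.comp_continuous continuous_subtype_val fun p => coe_S2_ne_zero p
  -- A trace-free symmetric form on a plane has nonpositive determinant.
  have hτ0 : ∀ p, τ p ≠ 0 := by
    intro p h0
    obtain ⟨e₁, e₂, hF⟩ := exists_oframe (norm_coe_S2 p)
    have h1 := hdet p _ _ hF
    rw [hτF p _ _ hF] at h0
    rw [eq_neg_of_add_eq_zero_right h0] at h1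
    nlinarith [sq_nonneg (secondForm g p e₁ e₁), sq_nonneg (secondForm g p e₁ e₂)]
  have hsign : ∃ ε : ℝ, ε * ε = 1 ∧ ∀ p, ε * τ p < 0 := by
    have : PreconnectedSpace S2 :=
      ⟨by simpa using isPreconnected_compl_finite (Set.finite_empty (α := S2))⟩
    obtain ⟨p₀⟩ : Nonempty S2 := inferInstance
    rcases lt_or_gt_of_ne (hτ0 p₀) with h | h
    · refine ⟨1, by norm_num, fun p => ?_⟩
      by_contra hp
      obtain ⟨q, hq⟩ := mem_range_of_exists_le_of_exists_ge hτc ⟨p₀, h.le⟩ ⟨p, by linarith⟩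
      exact hτ0 q hq
    · refine ⟨-1, by norm_num, fun p => ?_⟩
      by_contra hp
      obtain ⟨q, hq⟩ := mem_range_of_exists_le_of_exists_ge hτc ⟨p, by linarith⟩ ⟨p₀, h.le⟩
      exact hτ0 q hq
  obtain ⟨ε, hε, hετ⟩ := hsign
  refine ⟨ε, hε, hgr.const_smul ε, fun p hp a ha ha0 => ?_⟩
  obtain ⟨e₁, e₂, hF⟩ := exists_oframe hp
  have hL := hdet ⟨p, by simpa using hp⟩ _ _ hF
  have hT := hετ ⟨p, by simpa using hp⟩
  rw [hτF ⟨p, by simpa using hp⟩ _ _ hF] at hT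
  change secondForm (fun x => ε • g x) p a a < 0
  rw [secondForm_const_smul hgr hp hε]
  dsimp only at hL hT
  have hs : secondForm g p e₂ e₁ = secondForm g p e₁ e₂ := by
    rw [secondForm, hgr.snd_symm (ne_zero_of_norm_one hp), secondForm]
  have hexp := hF.expansion_tangent ha
  set x := inner ℝ a e₁
  set y := inner ℝ a e₂
  have hxy : 0 < x ^ 2 + y ^ 2 := by
    by_contra h
    have hx : x = 0 := by nlinarith [sq_nonneg x, sq_nonneg y]
    have hy : y = 0 := by nlinarith [sq_nonneg x, sq_nonneg y]
    exact ha0 (by rw [hexp, hx, hy]; simp)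
  have hquad : secondForm g p a a = x ^ 2 * secondForm g p e₁ e₁
      + 2 * x * y * secondForm g p e₁ e₂ + y ^ 2 * secondForm g p e₂ e₂ := by
    rw [hexp]
    simp only [secondForm] at hs ⊢
    simp only [map_add, map_smul, _root_.add_apply, _root_.smul_apply, inner_add_left,
      real_inner_smul_left, hs]
    ring
  rw [hquad]
  have hd' : 0 < (ε * secondForm g p e₁ e₁) * (ε * secondForm g p e₂ e₂)
      - (ε * secondForm g p e₁ e₂) ^ 2 := by
    have : (ε * secondForm g p e₁ e₁) * (ε * secondForm g p e₂ e₂) - (ε * secondForm g p e₁ e₂) ^ 2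
      = (ε * ε) * (secondForm g p e₁ e₁ * secondForm g p e₂ e₂ - secondForm g p e₁ e₂ ^ 2) := by
      ring
    rw [this, hε, one_mul]; exact hL
  rw [mul_add] at hT
  have := quadratic_neg hT hd' hxy
  linarith

lemma sameMetric_of_pullback {f g : S2 → E3} (hf : ContMDiff (𝓡 2) 𝓘(ℝ, E3) ∞ f)
    (hg : ContMDiff (𝓡 2) 𝓘(ℝ, E3) ∞ g) (h : pullback f = pullback g) :
    SameMetric (radialExt f) (radialExt g) := by
  intro p hp a b
  have hp0 := ne_zero_of_norm_one hp
  have key : ∀ {k : S2 → E3}, ContMDiff (𝓡 2) 𝓘(ℝ, E3) ∞ k → ∀ a,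
      fderiv ℝ (radialExt k) p a = fderiv ℝ (radialExt k) p (a - inner ℝ a p • p) := by
    intro k hk a
    rw [map_sub, map_smul, (radial_radialExt hk).fderiv_self hp0, smul_zero, sub_zero]
  have ht : ∀ a : E3, inner ℝ (a - inner ℝ a p • p) p = 0 := fun a => by
    rw [inner_sub_left, real_inner_smul_left, real_inner_self_eq_norm_sq, hp]
    ring
  obtain ⟨a', ha'⟩ := (exists_tangentIncl_eq_iff (p := ⟨p, by simpa using hp⟩)).mpr (ht a)
  obtain ⟨b', hb'⟩ := (exists_tangentIncl_eq_iff (p := ⟨p, by simpa using hp⟩)).mpr (ht b)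
  have h' := congrFun (congrFun (congrFun h ⟨p, by simpa using hp⟩) a') b'
  rw [pullback_eq hf, pullback_eq hg, ha', hb'] at h'
  rw [key hf a, key hf b, key hg a, key hg b]
  exact h'

/-- The theorema egregium in the affine parametrization `z ↦ p + z₀ e₁ + z₁ e₂` of the tangent
plane of the sphere at `p`, which is composed with the radial extension of the surface. -/
lemma SameMetric.sameDet {f g : E3 → E3} (hf : Radial f) (hg : Radial g) (h : SameMetric f g)
    (hN : ∀ p : E3, ‖p‖ = 1 → normalField f p ≠ 0) : SameDet f g := by
  intro p hp a b ha hb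
  obtain ⟨e₁, e₂, hF⟩ := exists_oframe hp
  rw [hf.secondForm_det hF hp ha hb, hg.secondForm_det hF hp ha hb]
  congr 1
  let σ : E2 →L[ℝ] E3 := (EuclideanSpace.proj 0 : E2 →L[ℝ] ℝ).smulRight e₁
    + (EuclideanSpace.proj 1 : E2 →L[ℝ] ℝ).smulRight e₂
  have hσ0 : σ (EuclideanSpace.single 0 1) = e₁ := by simp [σ]
  have hσ1 : σ (EuclideanSpace.single 1 1) = e₂ := by simp [σ]
  have hne : ∀ z, p + σ z ≠ 0 := by
    intro z h0
    have := congrArg (fun x => inner ℝ x p) h0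
    simp [σ, inner_add_left, real_inner_smul_left, hF.inner_e₁_p, hF.inner_e₂_p, hp] at this
  have hs : ContDiff ℝ ∞ fun z => p + σ z := contDiff_const.add σ.contDiff
  have hd : ∀ z, HasFDerivAt (fun z => p + σ z) σ z := fun z => σ.hasFDerivAt.const_add p
  have hsmooth : ∀ {k : E3 → E3}, Radial k → ContDiff ℝ ∞ fun z => k (p + σ z) := fun {k} hk =>
    contDiff_iff_contDiffAt.mpr fun z => ContDiffAt.comp (g := k) (f := fun z => p + σ z) z
      (hk.smooth _ (hne z)) hs.contDiffAt
  have h1 : ∀ {k : E3 → E3}, Radial k → ∀ A, pdV (fun z => k (p + σ z)) A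
      = fun z => fderiv ℝ k (p + σ z) (σ (EuclideanSpace.single A 1)) := by
    intro k hk A
    funext z
    have h : HasFDerivAt (fun z => k (p + σ z)) _ z :=
      (hk.differentiableAt (hne z)).hasFDerivAt.comp z (hd z)
    rw [pdV, h.fderiv]
    rfl
  have h2 : ∀ {k : E3 → E3}, Radial k → ∀ A B, pdV (pdV (fun z => k (p + σ z)) A) B 0
      = fderiv ℝ (fderiv ℝ k) p (σ (EuclideanSpace.single B 1))
        (σ (EuclideanSpace.single A 1)) := by
    intro k hk A B
    have h : HasFDerivAt (fun z => fderiv ℝ k (p + σ z) (σ (EuclideanSpace.single A 1))) _ 0 :=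
      (ContinuousLinearMap.apply ℝ E3 (σ (EuclideanSpace.single A 1))).hasFDerivAt.comp 0
        ((hk.differentiableAt_fderiv (hne 0)).hasFDerivAt.comp 0 (hd 0))
    rw [h1 hk, pdV, h.fderiv]
    simp
  have hmet : ∀ z a b, inner ℝ (fderiv ℝ f (p + σ z) a) (fderiv ℝ f (p + σ z) b)
      = inner ℝ (fderiv ℝ g (p + σ z) a) (fderiv ℝ g (p + σ z) b) := by
    intro z a b
    have hx := hne z
    have hn := norm_pos_iff.mpr hx
    have hx' : p + σ z = ‖p + σ z‖ • (‖p + σ z‖⁻¹ • (p + σ z)) := by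
      rw [smul_smul, mul_inv_cancel₀ hn.ne', one_smul]
    rw [hx', hf.fderiv_smul hn, hg.fderiv_smul hn]
    simp only [_root_.smul_apply, real_inner_smul_left, real_inner_smul_right]
    rw [h _ (norm_normalize hx)]
  let Q : E2 → Matrix (Fin 2) (Fin 2) ℝ := fun z => Matrix.of fun A B =>
    inner ℝ (pdV (fun z => f (p + σ z)) A z) (pdV (fun z => f (p + σ z)) B z)
  have hQf : ∀ z A B, Q z A B
      = inner ℝ (pdV (fun z => f (p + σ z)) A z) (pdV (fun z => f (p + σ z)) B z) :=
    fun z A B => rfl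
  have hQg : ∀ z A B, Q z A B
      = inner ℝ (pdV (fun z => g (p + σ z)) A z) (pdV (fun z => g (p + σ z)) B z) := by
    intro z A B
    rw [hQf, h1 hf, h1 hf, h1 hg, h1 hg]
    exact hmet z _ _
  have hdet : (Q 0).det ≠ 0 := by
    have hI := inner_normalField_self f hF
    rw [Matrix.det_fin_two, hQf, hQf, hQf, hQf, h1 hf, h1 hf]
    simp only [map_zero, add_zero, hσ0, hσ1]
    rw [real_inner_comm (fderiv ℝ f p e₁) (fderiv ℝ f p e₂), ← pow_two, ← hI]
    exact inner_self_ne_zero.mpr (hN p hp)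
  have key : ∀ {k : E3 → E3}, Radial k → (∀ z A B, Q z A B
      = inner ℝ (pdV (fun z => k (p + σ z)) A z) (pdV (fun z => k (p + σ z)) B z)) →
      secondForm k p e₁ e₁ * secondForm k p e₂ e₂ - secondForm k p e₁ e₂ ^ 2
        = riemann0101 Q 0 * (Q 0).det := by
    intro k hk hQ
    rw [riemann0101_mul_det (hsmooth hk) 0 hQ hdet, h2 hk, h2 hk, h2 hk, h1 hk, h1 hk]
    simp only [map_zero, add_zero, hσ0, hσ1]
    rw [← normalField_eq k hF]
    rfl
  rw [key hf hQf, key hg hQg]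

/-- **Rigidity** of ovals given by embeddings of the sphere with the same induced metric. -/
theorem exists_congruence_of_pullback {f g : S2 → E3} (hf : ContMDiff (𝓡 2) 𝓘(ℝ, E3) ∞ f)
    (hg : ContMDiff (𝓡 2) 𝓘(ℝ, E3) ∞ g) (hfo : Oval (radialExt f)) (hgo : Oval (radialExt g))
    (h : pullback f = pullback g) :
    ∃ (U : E3 ≃ₗᵢ[ℝ] E3) (c : E3), ∀ p, g p = U (f p) + c := by
  have hm := sameMetric_of_pullback hf hg h
  obtain ⟨U, c, hU⟩ := hfo.exists_congruence hgo hm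
    (hm.sameDet hfo.radial hgo.radial fun p hp => hfo.normalField_ne_zero hp)
  refine ⟨U, c, fun p => ?_⟩
  have := hU p (coe_S2_ne_zero p)
  rwa [radialExt_coe, radialExt_coe] at this

/-! ### The convex body bounded by an oval -/

/-- The intersection of the open half-spaces bounded by the tangent planes of an oval. -/
def body (f : E3 → E3) : Set E3 := {x | ∀ q : S2, inner ℝ (x - f q) (gaussMap f q) < 0}

lemma closure_body_subset {f : E3 → E3} (x : E3) (hx : x ∈ closure (body f)) (q : S2) :
    inner ℝ (x - f q) (gaussMap f q) ≤ 0 := by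
  have h : IsClosed {x : E3 | inner ℝ (x - f q) (gaussMap f q) ≤ 0} :=
    isClosed_le ((continuous_id.sub continuous_const).inner continuous_const) continuous_const
  exact closure_minimal (fun y hy => (hy q).le) h hx

namespace Oval

variable {f : E3 → E3} (hf : Oval f)
include hf

lemma exists_fderiv_eq {p w : E3} (hp : ‖p‖ = 1) (hw : inner ℝ w (normalField f p) = 0) :
    ∃ b, inner ℝ b p = 0 ∧ fderiv ℝ f p b = w := by
  obtain ⟨e₁, e₂, hF⟩ := exists_oframe hp
  have hN := hf.normalField_ne_zero hp
  have hexp := cross_expansion (fderiv ℝ f p e₁) (fderiv ℝ f p e₂) w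
  rw [← normalField_eq f hF, hw, zero_smul, add_zero, ← map_smul, ← map_smul, ← map_add] at hexp
  have hNN : inner ℝ (normalField f p) (normalField f p) ≠ 0 := inner_self_ne_zero.mpr hN
  refine ⟨(inner ℝ (normalField f p) (normalField f p))⁻¹ •
    (inner ℝ w (cross (fderiv ℝ f p e₂) (normalField f p)) • e₁
      + inner ℝ w (cross (normalField f p) (fderiv ℝ f p e₁)) • e₂), ?_, ?_⟩
  · simp [inner_add_left, real_inner_smul_left, hF.inner_e₁_p, hF.inner_e₂_p]
  · rw [map_smul, ← hexp, smul_smul, inv_mul_cancel₀ hNN, one_smul]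

lemma eq_smul_gaussMap {p m : E3} (hp : ‖p‖ = 1)
    (hm : ∀ b, inner ℝ b p = 0 → inner ℝ m (fderiv ℝ f p b) = 0) :
    m = inner ℝ m (gaussMap f p) • gaussMap f p := by
  have hp0 := ne_zero_of_norm_one hp
  have hn := hf.norm_gaussMap hp0
  have hnn : inner ℝ (gaussMap f p) (gaussMap f p) = 1 := by
    rw [real_inner_self_eq_norm_sq, hn]; norm_num
  have hNg : normalField f p = ‖normalField f p‖ • gaussMap f p := by
    rw [gaussMap_of_norm_one f hp, smul_smul,
      mul_inv_cancel₀ (norm_ne_zero_iff.mpr (hf.normalField_ne_zero hp)), one_smul]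
  obtain ⟨b, hb, hb'⟩ := hf.exists_fderiv_eq hp
    (w := m - inner ℝ m (gaussMap f p) • gaussMap f p) (by
      rw [hNg, real_inner_smul_right, inner_sub_left, real_inner_smul_left, hnn]; ring)
  have h1 := hm b hb
  have h2 := hf.inner_fderiv_gaussMap hp0 b
  rw [hb'] at h1 h2
  have h3 : inner ℝ (m - inner ℝ m (gaussMap f p) • gaussMap f p)
      (m - inner ℝ m (gaussMap f p) • gaussMap f p) = 0 := by
    rw [inner_sub_left, h1, real_inner_smul_left,
      real_inner_comm (m - inner ℝ m (gaussMap f p) • gaussMap f p), h2]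
    ring
  exact sub_eq_zero.mp (inner_self_eq_zero.mp h3)

lemma continuous_gaussMap_coe : Continuous fun q : S2 => gaussMap f q :=
  hf.radial_gaussMap.continuous_sphere

lemma continuous_support : Continuous fun z : S2 × E3 =>
    inner ℝ (z.2 - f z.1) (gaussMap f z.1) :=
  (continuous_snd.sub (hf.continuous_coe.comp continuous_fst)).inner
    (hf.continuous_gaussMap_coe.comp continuous_fst)

lemma inner_sub_le (p q : S2) : inner ℝ (f q - f p) (gaussMap f p) ≤ 0 := by
  by_cases h : q = p
  · simp [h]
  · exact (hf.strictly_convex h).le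

/-- A point on the inner side of all tangent planes that lies on the tangent plane at `f q` is
`f q`: the function `x ↦ ⟪y - f x, n x⟫` is maximal at `q`, and its derivative there is the second
fundamental form paired with `y - f q`. -/
lemma eq_of_inner_eq_zero {y : E3} {q : S2}
    (h : ∀ x : S2, inner ℝ (y - f x) (gaussMap f x) ≤ 0)
    (hq : inner ℝ (y - f q) (gaussMap f q) = 0) : y = f q := by
  have hq0 := coe_S2_ne_zero q
  have hq1 := norm_coe_S2 q
  have hder : HasFDerivAt (fun x : E3 => inner ℝ (y - f x) (gaussMap f x)) _ (q : E3) :=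
    ((hf.radial.differentiableAt hq0).hasFDerivAt.const_sub y).inner ℝ
      (hf.radial_gaussMap.differentiableAt hq0).hasFDerivAt
  have hmax : IsLocalMax (fun x : E3 => inner ℝ (y - f x) (gaussMap f x)) (q : E3) := by
    filter_upwards [isOpen_compl_singleton.mem_nhds
      (show (q : E3) ∈ ({0}ᶜ : Set E3) from hq0)] with x hx
    rw [hq, hf.radial.eq_normalize hx, hf.radial_gaussMap.eq_normalize hx]
    exact h ⟨_, by simpa using norm_normalize hx⟩
  have hzero := hmax.fderiv_eq_zero
  rw [hder.fderiv] at hzero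
  have hkey : ∀ a, inner ℝ (y - f q) (fderiv ℝ (gaussMap f) q a) = 0 := by
    intro a
    have h1 := congrArg (fun L : E3 →L[ℝ] ℝ => L a) hzero
    simp only [ContinuousLinearMap.comp_apply, ContinuousLinearMap.prod_apply,
      fderivInnerCLM_apply, _root_.neg_apply, inner_neg_left, hf.inner_fderiv_gaussMap hq0,
      _root_.zero_apply] at h1
    linarith
  obtain ⟨b, hb, hb'⟩ := hf.exists_fderiv_eq hq1 (w := y - f q) (by
    rw [gaussMap_of_norm_one f hq1, real_inner_smul_right] at hq
    exact (mul_eq_zero.mp hq).resolve_left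
      (inv_ne_zero (norm_ne_zero_iff.mpr (hf.normalField_ne_zero hq1))))
  have h2 := hkey b
  rw [← hb'] at h2
  have h3 := hf.secondForm_eq hq1 b b
  rw [h2, mul_zero] at h3
  have hb0 : b = 0 := by
    by_contra hne
    exact (hf.neg q hq1 b hb hne).ne h3
  rw [hb0, map_zero] at hb'
  exact (sub_eq_zero.mp hb'.symm)

lemma isOpen_body : IsOpen (body f) := by
  have h : IsClosed {z : S2 × E3 | 0 ≤ inner ℝ (z.2 - f z.1) (gaussMap f z.1)} :=
    isClosed_le continuous_const hf.continuous_support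
  have h2 := isClosedMap_snd_of_compactSpace _ h
  rw [← isOpen_compl_iff] at h2
  convert! h2
  ext x
  simp [body]

lemma isBounded_body : Bornology.IsBounded (body f) := by
  obtain ⟨R, hR⟩ := (isCompact_range hf.continuous_coe).isBounded.exists_norm_le
  refine (Metric.isBounded_iff_subset_closedBall 0).mpr ⟨R, fun x hx => ?_⟩
  rw [mem_closedBall_zero_iff]
  by_cases hx0 : x = 0
  · obtain ⟨p⟩ : Nonempty S2 := inferInstance
    rw [hx0, norm_zero]
    exact (norm_nonneg _).trans (hR _ ⟨p, rfl⟩)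
  obtain ⟨q, hq⟩ := hf.exists_gaussMap_eq (norm_normalize hx0)
  have h1 := hx q
  rw [inner_sub_left, hq, real_inner_smul_right, real_inner_self_eq_norm_sq] at h1
  have h2 : inner ℝ (f q) (‖x‖⁻¹ • x) ≤ R := by
    refine (real_inner_le_norm _ _).trans ?_
    rw [norm_normalize hx0, mul_one]
    exact hR _ ⟨q, rfl⟩
  have h3 : ‖x‖⁻¹ * ‖x‖ ^ 2 = ‖x‖ := by
    field_simp [norm_ne_zero_iff.mpr hx0]
  linarith

/-- The region enclosed by an oval is the intersection of the inner sides of its tangent planes. -/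
theorem enclosed_eq : enclosed (range fun p : S2 => f p) = body f := by
  apply Subset.antisymm
  · rintro x ⟨hxK, hb⟩ q₀
    by_contra hcon
    push Not at hcon
    obtain ⟨q, hq⟩ : ∃ q : S2, 0 < inner ℝ (x - f q) (gaussMap f q) := by
      by_contra hno
      push Not at hno
      exact hxK ⟨q₀, (hf.eq_of_inner_eq_zero hno (le_antisymm (hno q₀) hcon)).symm⟩
    -- The ray from `x` in the direction of the normal at `f q` misses the surface.
    let ray : ℝ → E3 := fun s => x + s • gaussMap f q
    have hn := hf.norm_gaussMap (coe_S2_ne_zero q)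
    have hray : ray '' Ici 0 ⊆ (range fun p : S2 => f p)ᶜ := by
      rintro _ ⟨s, hs, rfl⟩ ⟨p, hp⟩
      have h1 := hf.inner_sub_le q p
      have h2 : inner ℝ (f p - f q) (gaussMap f q) = inner ℝ (x - f q) (gaussMap f q) + s := by
        dsimp only at hp
        rw [hp]
        simp only [ray]
        rw [add_sub_right_comm, inner_add_left, real_inner_smul_left,
          real_inner_self_eq_norm_sq, hn]
        ring
      have : 0 ≤ s := hs
      linarith
    have hconn : IsPreconnected (ray '' Ici 0) :=
      (convex_Ici (0 : ℝ)).isPreconnected.image _ (by fun_prop)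
    have hsub := hconn.subset_connectedComponentIn
      (show x ∈ ray '' Ici 0 from ⟨0, by simp, by simp [ray]⟩) hray
    obtain ⟨R, hR⟩ := (hb.subset hsub).exists_norm_le
    have hs : 0 ≤ |R| + ‖x‖ + 1 := by positivity
    have h1 := hR (ray (|R| + ‖x‖ + 1)) ⟨_, hs, rfl⟩
    have h2 : ‖(|R| + ‖x‖ + 1) • gaussMap f q‖ ≤ ‖ray (|R| + ‖x‖ + 1)‖ + ‖x‖ := by
      have : (|R| + ‖x‖ + 1) • gaussMap f q = ray (|R| + ‖x‖ + 1) - x := by simp [ray]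
      rw [this]
      exact norm_sub_le _ _
    rw [norm_smul, hn, mul_one, Real.norm_of_nonneg hs] at h2
    linarith [le_abs_self R]
  · intro x hx
    have hxK : x ∉ range fun p : S2 => f p := by
      rintro ⟨p, hp⟩
      have := hx p
      simp [← hp] at this
    -- The frontier of the body lies on the surface, so a component of the complement of the surface
    -- that meets the body is contained in it.
    refine ⟨hxK, hf.isBounded_body.subset ?_⟩
    refine isPreconnected_connectedComponentIn.subset_of_closure_inter_subset hf.isOpen_body
      ⟨x, mem_connectedComponentIn hxK, hx⟩ ?_
    rintro y ⟨hy, hyC⟩ q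
    refine lt_of_le_of_ne (closure_body_subset y hy q) fun h0 => ?_
    have := hf.eq_of_inner_eq_zero (closure_body_subset y hy) h0
    exact connectedComponentIn_subset _ _ hyC ⟨q, this.symm⟩

lemma eventually_sub_smul_mem_body (p : S2) :
    ∀ᶠ s : ℝ in 𝓝[>] 0, f p - s • gaussMap f p ∈ body f := by
  have hn := hf.norm_gaussMap (coe_S2_ne_zero p)
  have key : ∀ᶠ s : ℝ in 𝓝 0, ∀ q ∈ (univ : Set S2), 0 < s →
      inner ℝ (f p - s • gaussMap f p - f q) (gaussMap f q) < 0 := by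
    refine isCompact_univ.eventually_forall_of_forall_eventually fun q _ => ?_
    -- Near `p` the normals form acute angles with the normal at `p`; away from `p` strict convexity
    -- leaves room for a small displacement.
    by_cases hqp : q = p
    · subst hqp
      have hc : Continuous fun z : ℝ × S2 => inner ℝ (gaussMap f q) (gaussMap f z.2) :=
        continuous_const.inner (hf.continuous_gaussMap_coe.comp continuous_snd)
      have h0 : (0 : ℝ) < inner ℝ (gaussMap f q) (gaussMap f q) := by
        rw [real_inner_self_eq_norm_sq, hn]; norm_num
      filter_upwards [hc.continuousAt (x := ((0 : ℝ), q)) (Ioi_mem_nhds h0)] with z hz hs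
      have h1 := hf.inner_sub_le z.2 q
      rw [sub_right_comm, inner_sub_left, real_inner_smul_left]
      have := mul_pos hs (show 0 < inner ℝ (gaussMap f q) (gaussMap f z.2) from hz)
      linarith
    · have hc : Continuous fun z : ℝ × S2 =>
          inner ℝ (f p - z.1 • gaussMap f p - f z.2) (gaussMap f z.2) :=
        (((continuous_const.sub (continuous_fst.smul continuous_const)).sub
          (hf.continuous_coe.comp continuous_snd))).inner
          (hf.continuous_gaussMap_coe.comp continuous_snd)
      have h0 : inner ℝ (f p - (0 : ℝ) • gaussMap f p - f q) (gaussMap f q) < 0 := by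
        simpa using hf.strictly_convex (Ne.symm hqp)
      filter_upwards [hc.continuousAt (x := ((0 : ℝ), q)) (Iio_mem_nhds h0)] with z hz _
      exact hz
  filter_upwards [nhdsWithin_le_nhds key, self_mem_nhdsWithin] with s hs hs0 q
  exact hs q (mem_univ q) hs0

end Oval

/-- The outward unit normal of an oval is its Gauss map. -/
theorem isOutwardNormal_iff {k : S2 → E3} (hk : ContMDiff (𝓡 2) 𝓘(ℝ, E3) ∞ k)
    (ho : Oval (radialExt k)) {p : S2} {m : E3} :
    IsOutwardNormal k p m ↔ m = gaussMap (radialExt k) p := by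
  have hp0 := coe_S2_ne_zero p
  have hn := ho.norm_gaussMap hp0
  have hnn : inner ℝ (gaussMap (radialExt k) p) (gaussMap (radialExt k) p) = 1 := by
    rw [real_inner_self_eq_norm_sq, hn]; norm_num
  have henc : enclosed (range k) = body (radialExt k) := by
    rw [← ho.enclosed_eq]
    congr
    funext p
    exact (radialExt_coe k p).symm
  have hout : ∀ s : ℝ, 0 < s → k p + s • gaussMap (radialExt k) p ∉ enclosed (range k) := by
    intro s hs hmem
    rw [henc] at hmem
    have := hmem p
    rw [radialExt_coe, add_sub_cancel_left, real_inner_smul_left, hnn] at this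
    linarith
  constructor
  · rintro ⟨h1, h2, h3⟩
    have h4 := ho.eq_smul_gaussMap (norm_coe_S2 p) (m := m) (fun b hb => by
      obtain ⟨a, rfl⟩ := exists_tangentIncl_eq_iff.mpr hb
      rw [← mvfderiv_eq hk]
      exact h2 a)
    have h5 : |inner ℝ m (gaussMap (radialExt k) p)| = 1 := by
      have := congrArg norm h4
      rw [norm_smul, hn, h1, mul_one, Real.norm_eq_abs] at this
      exact this.symm
    rcases eq_or_eq_neg_of_abs_eq h5 with h | h
    · rw [h4, h, one_smul]
    · exfalso
      obtain ⟨s, hs1, hs2⟩ := (h3.and (ho.eventually_sub_smul_mem_body p)).exists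
      rw [h4, h, henc] at hs1
      apply hs1
      rw [radialExt_coe] at hs2
      rwa [neg_one_smul, smul_neg, ← sub_eq_add_neg]
  · rintro rfl
    refine ⟨hn, fun a => ?_, ?_⟩
    · rw [mvfderiv_eq hk, real_inner_comm, ho.inner_fderiv_gaussMap hp0]
    · filter_upwards [self_mem_nhdsWithin] with s hs
      exact hout s hs

/-! ### The volume enclosed by an oval -/

lemma inner_cross_map (L : E3 →L[ℝ] E3) (a b c : E3) :
    inner ℝ (cross (L a) (L b)) (L c) = L.det * inner ℝ (cross a b) c := by
  have hdet : L.det = (Matrix.of fun i j => (L (bas j)) i).det := by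
    rw [ContinuousLinearMap.det, ← LinearMap.det_toMatrix (EuclideanSpace.basisFun (Fin 3) ℝ).toBasis]
    rfl
  rw [hdet, Matrix.det_fin_three, eq_sum_bas a, eq_sum_bas b, eq_sum_bas c]
  simp only [map_add, map_smul, inner_eq, Matrix.of_apply, bas,
    PiLp.add_apply, PiLp.smul_apply, smul_eq_mul]
  simp
  ring

lemma hasFDerivAt_norm_E3 {x : E3} (hx : x ≠ 0) :
    HasFDerivAt (fun x : E3 => ‖x‖) (‖x‖⁻¹ • innerSL ℝ x) x := by
  have h1 := ((hasStrictFDerivAt_norm_sq x).hasFDerivAt).sqrt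
    (pow_ne_zero 2 (norm_ne_zero_iff.mpr hx))
  simp only [Real.sqrt_sq (norm_nonneg _)] at h1
  convert! h1 using 1
  ext y
  simp
  field_simp

/-- The cone over a surface: radial segments are mapped to radial segments. -/
def conePt (f : E3 → E3) (x : E3) : E3 := ‖x‖ • f x

/-- The derivative of `conePt f`. -/
def coneDeriv (f : E3 → E3) (x : E3) : E3 →L[ℝ] E3 :=
  ‖x‖ • fderiv ℝ f x + (‖x‖⁻¹ • innerSL ℝ x).smulRight (f x)

lemma Radial.hasFDerivAt_conePt {f : E3 → E3} (hf : Radial f) {x : E3} (hx : x ≠ 0) :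
    HasFDerivAt (conePt f) (coneDeriv f x) x :=
  (hasFDerivAt_norm_E3 hx).smul (hf.differentiableAt hx).hasFDerivAt

/-- The Jacobian determinant of the cone over a surface is the support function `f · N`. -/
lemma Radial.det_coneDeriv {f : E3 → E3} (hf : Radial f) (p : S2) {r : ℝ} (hr : 0 < r) :
    (coneDeriv f (r • (p : E3))).det = inner ℝ (f p) (normalField f p) := by
  obtain ⟨e₁, e₂, hF⟩ := exists_oframe (norm_coe_S2 p)
  have hn : ‖r • (p : E3)‖ = r := by rw [norm_smul, norm_coe_S2, mul_one, Real.norm_of_nonneg hr.le]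
  have h : ∀ a, coneDeriv f (r • (p : E3)) a = fderiv ℝ f p a + inner ℝ (p : E3) a • f p := by
    intro a
    simp only [coneDeriv, hn, hf.fderiv_smul hr, hf.homog r hr, _root_.add_apply,
      _root_.smul_apply, ContinuousLinearMap.smulRight_apply, innerSL_apply_apply,
      real_inner_smul_left, smul_smul, smul_eq_mul]
    rw [mul_inv_cancel₀ hr.ne', one_smul, ← mul_assoc, inv_mul_cancel₀ hr.ne', one_mul]
  have h1 := inner_cross_map (coneDeriv f (r • (p : E3))) e₁ e₂ p
  rw [hF.cross_eq, hF.inner_p_p, mul_one, h, h, h, hF.inner_p_e₁, hF.inner_p_e₂, hF.inner_p_p,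
    hf.fderiv_self (coe_S2_ne_zero p)] at h1
  rw [← h1]
  simp only [zero_smul, one_smul, add_zero, zero_add]
  rw [← normalField_eq f hF, real_inner_comm]

lemma integral_sq_mul_indicator :
    ∫ r in Ioi (0 : ℝ), r ^ 2 * (if r < 1 then 1 else 0) = 1 / 3 := by
  have h1 : ∀ r : ℝ, r ^ 2 * (if r < 1 then 1 else 0) = (Iio (1 : ℝ)).indicator (fun r => r ^ 2) r := by
    intro r
    by_cases h : r < 1 <;> simp [h]
  simp only [h1]
  rw [setIntegral_indicator measurableSet_Iio, Ioi_inter_Iio, ← integral_Ioc_eq_integral_Ioo,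
    ← intervalIntegral.integral_of_le zero_le_one, integral_pow]
  norm_num

namespace Oval

variable {f : E3 → E3} (hf : Oval f)
include hf

lemma inner_gaussMap_pos (h : ∀ p : S2, 0 < inner ℝ (f p) (normalField f p)) (p : S2) :
    0 < inner ℝ (f p) (gaussMap f p) := by
  have hp := norm_coe_S2 p
  rw [gaussMap_of_norm_one f hp, real_inner_smul_right]
  exact mul_pos (inv_pos.mpr (norm_pos_iff.mpr (hf.normalField_ne_zero hp))) (h p)

/-- The body bounded by an oval around the origin is the cone over it. -/
lemma image_conePt (h : ∀ p : S2, 0 < inner ℝ (f p) (normalField f p)) :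
    conePt f '' (Metric.ball 0 1 \ {0}) = body f \ {0} := by
  have hpos := hf.inner_gaussMap_pos h
  apply Subset.antisymm
  · rintro _ ⟨x, ⟨hx1, hx0⟩, rfl⟩
    have hx0 : x ≠ 0 := hx0
    have hn : 0 < ‖x‖ := norm_pos_iff.mpr hx0
    have hx1 : ‖x‖ < 1 := by simpa using hx1
    have hfx := hf.radial.eq_normalize hx0
    let p : S2 := ⟨‖x‖⁻¹ • x, by simpa using norm_normalize hx0⟩
    have hfp : f x = f p := hfx
    refine ⟨fun q => ?_, ?_⟩
    · have h1 := hf.inner_sub_le q p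
      rw [inner_sub_left] at h1 ⊢
      rw [conePt, hfp, real_inner_smul_left]
      have h2 := hpos q
      nlinarith
    · rw [mem_singleton_iff, conePt, hfp, smul_eq_zero, not_or]
      refine ⟨hn.ne', fun h0 => ?_⟩
      have := hpos p
      simp [h0] at this
  · rintro y ⟨hy, hy0⟩
    have hy0 : y ≠ 0 := hy0
    -- The maximum `r` of this quotient is the gauge of the body at `y`, and the ray through `y` meets
    -- the surface at the point `f q` where the maximum is attained.
    have hc : Continuous fun q : S2 => inner ℝ y (gaussMap f q) / inner ℝ (f q) (gaussMap f q) :=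
      (continuous_const.inner hf.continuous_gaussMap_coe).div
        (hf.continuous_coe.inner hf.continuous_gaussMap_coe) fun q => (hpos q).ne'
    obtain ⟨q, -, hq⟩ := isCompact_univ.exists_isMaxOn (univ_nonempty (α := S2)) hc.continuousOn
    set r := inner ℝ y (gaussMap f q) / inner ℝ (f q) (gaussMap f q) with hr
    have hle : ∀ x : S2, inner ℝ y (gaussMap f x) ≤ r * inner ℝ (f x) (gaussMap f x) := fun x =>
      (div_le_iff₀ (hpos x)).mp (hq (mem_univ x))
    have hr1 : r < 1 := by
      rw [hr, div_lt_one (hpos q)]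
      have := hy q
      rw [inner_sub_left] at this
      linarith
    have hr0 : 0 < r := by
      obtain ⟨x, hx⟩ := hf.exists_gaussMap_eq (norm_normalize hy0)
      have h1 := hle x
      have h2 : 0 < inner ℝ y (gaussMap f x) := by
        rw [hx, real_inner_smul_right, real_inner_self_eq_norm_sq]
        have := norm_pos_iff.mpr hy0
        positivity
      exact pos_of_mul_pos_left (h2.trans_le h1) (hpos x).le
    have hyq : r⁻¹ • y = f q := by
      refine hf.eq_of_inner_eq_zero (fun x => ?_) ?_
      · rw [inner_sub_left, real_inner_smul_left]
        have := mul_le_mul_of_nonneg_left (hle x) (inv_pos.mpr hr0).le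
        rw [← mul_assoc, inv_mul_cancel₀ hr0.ne', one_mul] at this
        linarith
      · rw [inner_sub_left, real_inner_smul_left]
        have : r * inner ℝ (f q) (gaussMap f q) = inner ℝ y (gaussMap f q) :=
          div_mul_cancel₀ _ (hpos q).ne'
        rw [← this, ← mul_assoc, inv_mul_cancel₀ hr0.ne', one_mul, sub_self]
    refine ⟨r • (q : E3), ⟨?_, ?_⟩, ?_⟩
    · rw [mem_ball_zero_iff, norm_smul, norm_coe_S2, mul_one, Real.norm_of_nonneg hr0.le]
      exact hr1
    · exact smul_ne_zero hr0.ne' (coe_S2_ne_zero q)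
    · rw [conePt, hf.radial.homog r hr0, norm_smul, norm_coe_S2, mul_one,
        Real.norm_of_nonneg hr0.le, ← hyq, smul_smul, mul_inv_cancel₀ hr0.ne', one_smul]

lemma injOn_conePt (h : ∀ p : S2, 0 < inner ℝ (f p) (normalField f p)) :
    InjOn (conePt f) (Metric.ball 0 1 \ {0}) := by
  have hpos := hf.inner_gaussMap_pos h
  have key : ∀ (r s : ℝ) (p q : S2), 0 < r → 0 < s → r • f p = s • f q → p ≠ q → r < s := by
    intro r s p q hr hs heq hne
    have h1 := hf.strictly_convex hne.symm
    have h2 := congrArg (fun v => inner ℝ v (gaussMap f p)) heq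
    simp only [real_inner_smul_left] at h2
    rw [inner_sub_left] at h1
    have := hpos p
    nlinarith
  have hx : ∀ x : E3, x ≠ 0 → ∃ (r : ℝ) (p : S2), 0 < r ∧ x = r • (p : E3) ∧ conePt f x = r • f p := by
    intro x hx0
    have hn : 0 < ‖x‖ := norm_pos_iff.mpr hx0
    refine ⟨‖x‖, ⟨‖x‖⁻¹ • x, by simpa using norm_normalize hx0⟩, hn, ?_, ?_⟩
    · rw [smul_smul, mul_inv_cancel₀ hn.ne', one_smul]
    · rw [conePt, hf.radial.eq_normalize hx0]
  rintro x ⟨-, hx0⟩ y ⟨-, hy0⟩ hxy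
  obtain ⟨r, p, hr, hxr, hfx⟩ := hx x hx0
  obtain ⟨s, q, hs, hys, hfy⟩ := hx y hy0
  rw [hfx, hfy] at hxy
  by_cases hpq : p = q
  · subst hpq
    have hfp : f p ≠ 0 := fun h0 => by simpa [h0] using hpos p
    have : r = s := smul_left_injective ℝ hfp hxy
    rw [hxr, hys, this]
  · exact absurd (key r s p q hr hs hxy hpq) (key s r q p hs hr hxy.symm (Ne.symm hpq)).not_gt

lemma volume_body_of_support_pos (h : ∀ p : S2, 0 < inner ℝ (f p) (normalField f p)) :
    (volume (body f)).toReal = (∫ p : S2, inner ℝ (f p) (normalField f p) ∂sphereMeasure) / 3 := by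
  have hU : MeasurableSet (Metric.ball (0 : E3) 1 \ {0}) :=
    Metric.isOpen_ball.measurableSet.diff (measurableSet_singleton 0)
  have hv : volume (body f) = volume (conePt f '' (Metric.ball 0 1 \ {0})) := by
    rw [hf.image_conePt h, measure_sdiff_null (measure_singleton 0)]
  have hI := integral_image_eq_integral_abs_det_fderiv_smul volume hU
    (fun x hx => (hf.radial.hasFDerivAt_conePt hx.2).hasFDerivWithinAt) (hf.injOn_conePt h)
    (fun _ => (1 : ℝ))
  rw [setIntegral_const, smul_eq_mul, mul_one] at hI
  rw [hv]
  refine Eq.trans hI ?_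
  rw [← integral_indicator hU, integral_polar
    (φ := fun p : S2 => inner ℝ (f p) (normalField f p)) (g := fun r => if r < 1 then 1 else 0),
    integral_sq_mul_indicator]
  · ring
  intro p r hr
  have hmem : r • (p : E3) ∈ Metric.ball (0 : E3) 1 \ {0} ↔ r < 1 := by
    rw [Set.mem_sdiff, mem_ball_zero_iff, norm_smul, norm_coe_S2, mul_one, Real.norm_of_nonneg hr.le,
      mem_singleton_iff]
    exact and_iff_left (smul_ne_zero hr.ne' (coe_S2_ne_zero p))
  by_cases hr1 : r < 1
  · rw [indicator_of_mem (hmem.mpr hr1), hf.radial.det_coneDeriv p hr, if_pos hr1, abs_of_pos (h p),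
      smul_eq_mul]
  · rw [indicator_of_notMem (mt hmem.mp hr1), if_neg hr1, mul_zero]

lemma volume_body_pos : 0 < (volume (body f)).toReal := by
  obtain ⟨o, ho⟩ := hf.exists_support_pos
  refine ENNReal.toReal_pos (hf.isOpen_body.measure_pos volume ⟨o, fun q => ?_⟩).ne'
    hf.isBounded_body.measure_lt_top.ne
  have hq := norm_coe_S2 q
  rw [← neg_sub, inner_neg_left, gaussMap_of_norm_one f hq, real_inner_smul_right, neg_lt_zero]
  exact mul_pos (inv_pos.mpr (norm_pos_iff.mpr (hf.normalField_ne_zero hq))) (ho q)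

end Oval

/-! ### Flux integrals over an oval -/

/-- The components of the normal field are the area forms of the coordinate projections. -/
lemma normalField_coord {f : E3 → E3} (hf : Radial f) (p : S2) (b : Fin 3) :
    normalField f p b = wedge p (fderiv ℝ (fun x => f x (b + 1)) p)
      (fderiv ℝ (fun x => f x (b + 2)) p) := by
  obtain ⟨e₁, e₂, hF⟩ := exists_oframe (norm_coe_S2 p)
  have hc : ∀ i a, fderiv ℝ (fun x => f x i) p a = fderiv ℝ f p a i := by
    intro i a
    have h : HasFDerivAt (fun x => f x i) ((EuclideanSpace.proj i : E3 →L[ℝ] ℝ).comp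
        (fderiv ℝ f p)) (p : E3) := (EuclideanSpace.proj i : E3 →L[ℝ] ℝ).hasFDerivAt.comp (p : E3)
        (hf.differentiableAt (coe_S2_ne_zero p)).hasFDerivAt
    rw [h.fderiv]
    rfl
  have hw : ∀ A B, wedge (p : E3) A B = A e₁ * B e₂ - A e₂ * B e₁ := fun A B => by
    rw [← wedge_cross, hF.cross_eq]
  rw [normalField_eq f hF, hw, hc, hc, hc, hc]
  fin_cases b <;> simp <;> ring

/-- The integral of the two-form `α dβ ∧ dγ` over the sphere. -/
def tripleIntegral (α β γ : E3 → ℝ) : ℝ :=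
  ∫ p : S2, α p * wedge p (fderiv ℝ β p) (fderiv ℝ γ p) ∂sphereMeasure

lemma tripleIntegral_swap_right (α β γ : E3 → ℝ) :
    tripleIntegral α γ β = - tripleIntegral α β γ := by
  rw [tripleIntegral, tripleIntegral, ← integral_neg]
  refine integral_congr_ae (Eventually.of_forall fun p => ?_)
  simp only [wedge]
  ring

/-- Stokes' theorem for `d(αβ) ∧ dγ`. -/
lemma tripleIntegral_swap_left {α β γ : E3 → ℝ} (hα : Radial α) (hβ : Radial β) (hγ : Radial γ) :
    tripleIntegral β α γ = - tripleIntegral α β γ := by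
  have h := integral_wedge_eq_zero (hα.mul hβ) hγ
  simp only [wedge_fderiv_mul hα hβ] at h
  have h2 := integral_add
    (continuous_integrable (hβ.continuous_sphere.mul (hα.continuous_wedge hγ)))
    (continuous_integrable (hα.continuous_sphere.mul (hβ.continuous_wedge hγ)))
  exact eq_neg_of_add_eq_zero_left (h2.symm.trans h)

lemma integral_add_add {a : Fin 3 → S2 → ℝ} (h : ∀ i, Continuous (a i)) :
    ∫ p, a 0 p + a 1 p + a 2 p ∂sphereMeasure
      = (∫ p, a 0 p ∂sphereMeasure) + (∫ p, a 1 p ∂sphereMeasure) + ∫ p, a 2 p ∂sphereMeasure := by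
  have h0 := fun i => continuous_integrable (h i)
  rw [integral_add (f := fun p => a 0 p + a 1 p) ((h0 0).add (h0 1)) (h0 2),
    integral_add (h0 0) (h0 1)]

lemma integral_normalField {f : E3 → E3} (hf : Radial f) (b : Fin 3) :
    ∫ p : S2, normalField f p b ∂sphereMeasure = 0 := by
  simp only [normalField_coord hf]
  exact integral_wedge_eq_zero (hf.coord _) (hf.coord _)

/-- The integrals of the two-forms `f_i df_j ∧ df_k` are totally antisymmetric, so all of them are
multiples of the one with `i, j, k = 0, 1, 2`. -/
lemma integral_coord_mul_normalField {f : E3 → E3} (hf : Radial f) (j b : Fin 3) :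
    ∫ p : S2, f p j * normalField f p b ∂sphereMeasure
      = if j = b then (∫ p : S2, inner ℝ (f p) (normalField f p) ∂sphereMeasure) / 3 else 0 := by
  let T : Fin 3 → Fin 3 → Fin 3 → ℝ := fun i j k =>
    tripleIntegral (fun x => f x i) (fun x => f x j) (fun x => f x k)
  have hT : ∀ j b, ∫ p : S2, f p j * normalField f p b ∂sphereMeasure = T j (b + 1) (b + 2) := by
    intro j b
    simp only [normalField_coord hf]
    rfl
  have h1 : ∀ i j k, T i k j = - T i j k := fun i j k => tripleIntegral_swap_right _ _ _
  have h2 : ∀ i j k, T j i k = - T i j k := fun i j k =>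
    tripleIntegral_swap_left (hf.coord i) (hf.coord j) (hf.coord k)
  have hc : ∀ b, Continuous fun p : S2 => f p b * normalField f p b := fun b => by
    simp only [normalField_coord hf]
    exact (hf.coord b).continuous_sphere.mul ((hf.coord _).continuous_wedge (hf.coord _))
  have hsum : ∫ p : S2, inner ℝ (f p) (normalField f p) ∂sphereMeasure
      = T 0 1 2 + T 1 2 0 + T 2 0 1 := by
    simp only [inner_eq]
    rw [integral_add_add (a := fun b p => f p b * normalField f p b) hc, hT, hT, hT]
    rfl
  have e1 : T 1 2 0 = T 0 1 2 := by rw [h1 1 0 2, h2 0 1 2, neg_neg]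
  have e2 : T 2 0 1 = T 0 1 2 := by rw [h2 0 2 1, h1 0 1 2, neg_neg]
  have hz1 : ∀ i k, T i i k = 0 := fun i k => by linarith [h2 i i k]
  have hz2 : ∀ i k, T i k i = 0 := fun i k => by linarith [h1 i i k, hz1 i k]
  rw [hT, hsum, e1, e2]
  have e3 : T 0 1 2 + T 0 1 2 + T 0 1 2 = 3 * T 0 1 2 := by ring
  rw [e3, mul_div_cancel_left₀ _ (by norm_num)]
  fin_cases j <;> fin_cases b <;> simp [e1, e2, hz1, hz2]

/-- **The volume enclosed by an oval** as a flux integral. The normal field has mean zero, so the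
integral does not depend on the origin, which may be chosen inside the oval. -/
theorem Oval.volume_body {f : E3 → E3} (hf : Oval f) :
    (volume (body f)).toReal = (∫ p : S2, inner ℝ (f p) (normalField f p) ∂sphereMeasure) / 3 := by
  obtain ⟨o, ho⟩ := hf.exists_support_pos
  have hg := hf.sub_const o
  have hgN : gaussMap (fun x => f x - o) = gaussMap f := by
    funext x
    simp only [gaussMap, normalField_sub_const]
  have hvol : volume (body f) = volume (body fun x => f x - o) := by
    have h := measure_preimage_add_right volume (-o) (body fun x => f x - o)
    rw [← h]
    congr 1
    ext x
    simp only [body, hgN, mem_ofPred_eq, mem_preimage]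
    refine forall_congr' fun q => ?_
    rw [show x + -o - (f q - o) = x - f q by abel]
  have hc : ∀ b, Continuous fun p : S2 => normalField f p b := fun b => by
    simp only [normalField_coord hf.radial]
    exact (hf.radial.coord _).continuous_wedge (hf.radial.coord _)
  have hN : ∫ p : S2, inner ℝ o (normalField f p) ∂sphereMeasure = 0 := by
    simp only [inner_eq]
    rw [integral_add_add (a := fun b p => o b * normalField f p b)
      fun b => continuous_const.mul (hc b)]
    simp only [integral_const_mul, integral_normalField hf.radial]
    ring
  have hcN : Continuous fun p : S2 => normalField f p := continuous_iff_continuousAt.mpr fun p =>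
    ContinuousAt.comp (g := normalField f) (f := fun p : S2 => (p : E3))
      (hf.radial.contDiffAt_normalField (coe_S2_ne_zero p)).continuousAt
      continuous_subtype_val.continuousAt
  rw [hvol, hg.volume_body_of_support_pos (by simpa only [normalField_sub_const] using ho)]
  simp only [normalField_sub_const, inner_sub_left]
  rw [integral_sub (continuous_integrable (hf.continuous_coe.inner hcN))
    (continuous_integrable (continuous_const.inner hcN)), hN, sub_zero]

/-! ### The flux matrix of an affine field -/

lemma neg_mem_enclosed {K : Set E3} {x : E3} (hx : x ∈ enclosed K) :
    -x ∈ enclosed ((fun y : E3 => -y) '' K) := by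
  obtain ⟨h1, h2⟩ := hx
  refine ⟨fun ⟨y, hy, hyx⟩ => h1 (neg_injective hyx ▸ hy), ?_⟩
  have h3 := (Homeomorph.neg E3).image_connectedComponentIn (s := Kᶜ) (x := x) h1
  rw [image_compl_eq (Homeomorph.neg E3).bijective] at h3
  change Bornology.IsBounded (connectedComponentIn ((Homeomorph.neg E3 '' K)ᶜ) (Homeomorph.neg E3 x))
  rw [← h3]
  obtain ⟨R, hR⟩ := h2.exists_norm_le
  refine isBounded_iff_forall_norm_le.mpr ⟨R, ?_⟩
  rintro _ ⟨y, hy, rfl⟩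
  simpa using hR y hy

lemma enclosed_range_neg (k : S2 → E3) :
    enclosed (range fun p => -k p) = (fun y : E3 => -y) ⁻¹' enclosed (range k) := by
  have h : ∀ k : S2 → E3, (fun y : E3 => -y) '' range k = range fun p => -k p := fun k =>
    (range_comp _ _).symm
  ext x
  constructor
  · intro hx
    have := neg_mem_enclosed hx
    rw [h] at this
    simpa using this
  · intro hx
    have := neg_mem_enclosed hx
    rw [h] at this
    simpa using this

lemma enclosedVolume_neg (k : S2 → E3) : enclosedVolume (fun p => -k p) = enclosedVolume k := by
  rw [enclosedVolume, enclosed_range_neg, enclosedVolume, Measure.measure_preimage_neg]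

lemma mvfderiv_neg_S2 {k : S2 → E3} (hk : ContMDiff (𝓡 2) 𝓘(ℝ, E3) ∞ k) (p : S2) (a : TS p) :
    mvfderiv (𝓡 2) (fun p => -k p) p a = - mvfderiv (𝓡 2) k p a := by
  have hg := radial_radialExt hk
  have h := mvfderiv_eq_fderiv (f := fun p => -k p) (hg.const_smul (-1))
    (fun p => by rw [radialExt_coe, neg_one_smul])
  rw [h, mvfderiv_eq hk, fderiv_fun_const_smul (hg.differentiableAt (coe_S2_ne_zero p))]
  simp

lemma isOutwardNormal_neg {k : S2 → E3} (hk : ContMDiff (𝓡 2) 𝓘(ℝ, E3) ∞ k) (p : S2) (m : E3) :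
    IsOutwardNormal (fun p => -k p) p m ↔ IsOutwardNormal k p (-m) := by
  rw [IsOutwardNormal, IsOutwardNormal, norm_neg, enclosed_range_neg]
  simp only [mvfderiv_neg_S2 hk, inner_neg_left, inner_neg_right, mem_preimage, neg_add, neg_neg,
    smul_neg]

lemma outwardNormal_eq {k : S2 → E3} (hk : ContMDiff (𝓡 2) 𝓘(ℝ, E3) ∞ k)
    (ho : Oval (radialExt k)) (p : S2) : outwardNormal k p = gaussMap (radialExt k) p :=
  (isOutwardNormal_iff hk ho).mp
    (Classical.epsilon_spec ⟨_, (isOutwardNormal_iff hk ho).mpr rfl⟩)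

lemma outwardNormal_neg {k : S2 → E3} (hk : ContMDiff (𝓡 2) 𝓘(ℝ, E3) ∞ k)
    (ho : Oval (radialExt k)) (p : S2) :
    outwardNormal (fun p => -k p) p = - gaussMap (radialExt k) p := by
  have h : ∀ m, IsOutwardNormal (fun p => -k p) p m ↔ m = - gaussMap (radialExt k) p := fun m => by
    rw [isOutwardNormal_neg hk, isOutwardNormal_iff hk ho, neg_eq_iff_eq_neg]
  exact (h _).mp (Classical.epsilon_spec ⟨_, (h _).mpr rfl⟩)

lemma fluxMatrix_apply_of_oval {k : S2 → E3} (hk : ContMDiff (𝓡 2) 𝓘(ℝ, E3) ∞ k)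
    (ho : Oval (radialExt k)) (Y : S2 → E3) (a b : Fin 3) :
    fluxMatrix k Y a b = (volume (body (radialExt k))).toReal⁻¹ *
      ∫ p : S2, Y p a * normalField (radialExt k) p b ∂sphereMeasure := by
  have henc : enclosedVolume k = (volume (body (radialExt k))).toReal := by
    rw [enclosedVolume, ← ho.enclosed_eq]
    simp only [radialExt_coe]
  rw [fluxMatrix, Matrix.of_apply, henc]
  congr 1
  refine integral_congr_ae (Eventually.of_forall fun p => ?_)
  have hn : ‖normalField (radialExt k) p‖ ≠ 0 :=
    norm_ne_zero_iff.mpr (ho.normalField_ne_zero (norm_coe_S2 p))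
  dsimp only
  rw [outwardNormal_eq hk ho, areaDensity_eq hk, gaussMap_of_norm_one _ (norm_coe_S2 p)]
  simp only [PiLp.smul_apply, smul_eq_mul]
  field_simp

lemma fluxMatrix_neg {k : S2 → E3} (hk : ContMDiff (𝓡 2) 𝓘(ℝ, E3) ∞ k)
    (ho : Oval (radialExt k)) (Y : S2 → E3) :
    fluxMatrix (fun p => -k p) Y = fluxMatrix k (fun p => -Y p) := by
  have hpb : pullback (fun p => -k p) = pullback k := by
    have := pullback_const_smul hk (ε := -1) (by norm_num)
    simpa using this
  have harea : areaDensity (fun p => -k p) = areaDensity k := by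
    funext p
    rw [areaDensity, hpb, areaDensity]
  ext a b
  rw [fluxMatrix, fluxMatrix, Matrix.of_apply, Matrix.of_apply, enclosedVolume_neg, harea]
  congr 1
  refine integral_congr_ae (Eventually.of_forall fun p => ?_)
  simp [outwardNormal_neg hk ho, outwardNormal_eq hk ho]

/-- The matrix of a linear map with respect to the standard basis. -/
def toMat (A : E3 →L[ℝ] E3) : Matrix (Fin 3) (Fin 3) ℝ := Matrix.of fun a b => A (bas b) a

/-- **The flux theorem**: the flux matrix of an affine field is its linear part. -/
lemma fluxMatrix_affine_of_oval {k : S2 → E3} (hk : ContMDiff (𝓡 2) 𝓘(ℝ, E3) ∞ k)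
    (ho : Oval (radialExt k)) (A : E3 →L[ℝ] E3) (c : E3) :
    fluxMatrix k (fun p => A (k p) + c) = toMat A := by
  set f := radialExt k with hf
  have hr : Radial f := ho.radial
  have hV := ho.volume_body_pos
  ext a b
  rw [fluxMatrix_apply_of_oval hk ho, ← hf]
  have h1 : ∀ p : S2, (A (k p) + c) a * normalField f p b
      = (A (bas 0) a * (f p 0 * normalField f p b) + A (bas 1) a * (f p 1 * normalField f p b)
        + A (bas 2) a * (f p 2 * normalField f p b)) + c a * normalField f p b := by
    intro p
    rw [hf, radialExt_coe, ← hf]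
    conv_lhs => rw [eq_sum_bas (k p)]
    simp only [map_add, map_smul, PiLp.add_apply, PiLp.smul_apply, smul_eq_mul]
    ring
  have hN : Continuous fun p : S2 => normalField f p b := by
    simp only [normalField_coord hr]
    exact (hr.coord _).continuous_wedge (hr.coord _)
  have hc : ∀ j : Fin 3, Continuous fun p : S2 => A (bas j) a * (f p j * normalField f p b) :=
    fun j => continuous_const.mul ((hr.coord j).continuous_sphere.mul hN)
  simp only [h1]
  rw [integral_add (f := fun p : S2 => A (bas 0) a * (f p 0 * normalField f p b)
      + A (bas 1) a * (f p 1 * normalField f p b) + A (bas 2) a * (f p 2 * normalField f p b))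
    (g := fun p : S2 => c a * normalField f p b)
    (continuous_integrable (((hc 0).add (hc 1)).add (hc 2)))
    (continuous_integrable (continuous_const.mul hN)),
    integral_add_add (a := fun j p => A (bas j) a * (f p j * normalField f p b)) hc]
  simp only [integral_const_mul, integral_normalField hr, integral_coord_mul_normalField hr,
    ← ho.volume_body]
  rw [toMat, Matrix.of_apply]
  fin_cases b <;> simp <;> field_simp

/-- The flux theorem for a surface which is an oval up to a point reflection. -/
theorem fluxMatrix_affine {f : S2 → E3} (hf : ContMDiff (𝓡 2) 𝓘(ℝ, E3) ∞ f) {ε : ℝ}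
    (hε : ε * ε = 1) (ho : Oval (radialExt fun p => ε • f p)) (A : E3 →L[ℝ] E3) (c : E3) :
    fluxMatrix f (fun p => A (f p) + c) = toMat A := by
  rcases mul_self_eq_one_iff.mp hε with rfl | rfl
  · simp only [one_smul] at ho
    exact fluxMatrix_affine_of_oval hf ho A c
  · simp only [neg_one_smul] at ho
    have hk : ContMDiff (𝓡 2) 𝓘(ℝ, E3) ∞ fun p => -f p := hf.neg
    have h1 := fluxMatrix_neg hk ho fun p => A (f p) + c
    simp only [neg_neg] at h1
    have h2 := fluxMatrix_affine_of_oval hk ho A (-c)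
    rw [← h2]
    refine h1.trans ?_
    congr 1
    funext p
    rw [map_neg, neg_add]

/-! ### Infinitesimal rigidity of ovals -/

/-- The normal field of `f + s w`, written out as a function of `s` and of the point. -/
lemma normalField_add_smul {f w : E3 → E3} (hf : Radial f) (hw : Radial w) (s : ℝ) {p : E3}
    (hp : p ≠ 0) : normalField (fun x => f x + s • w x) p
      = p 0 • cross (fderiv ℝ f p (bas 1) + s • fderiv ℝ w p (bas 1))
          (fderiv ℝ f p (bas 2) + s • fderiv ℝ w p (bas 2))
        + p 1 • cross (fderiv ℝ f p (bas 2) + s • fderiv ℝ w p (bas 2))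
          (fderiv ℝ f p (bas 0) + s • fderiv ℝ w p (bas 0))
        + p 2 • cross (fderiv ℝ f p (bas 0) + s • fderiv ℝ w p (bas 0))
          (fderiv ℝ f p (bas 1) + s • fderiv ℝ w p (bas 1)) := by
  have h : HasFDerivAt (fun x => f x + s • w x) (fderiv ℝ f p + s • fderiv ℝ w p) p :=
    (hf.differentiableAt hp).hasFDerivAt.add ((hw.differentiableAt hp).hasFDerivAt.const_smul s)
  rw [normalField, h.fderiv]
  rfl

lemma fderiv_fderiv_add_smul {f w : E3 → E3} (hf : Radial f) (hw : Radial w) (s : ℝ) {p : E3}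
    (hp : p ≠ 0) : fderiv ℝ (fderiv ℝ fun x => f x + s • w x) p
      = fderiv ℝ (fderiv ℝ f) p + s • fderiv ℝ (fderiv ℝ w) p := by
  have h : fderiv ℝ (fun x => f x + s • w x) =ᶠ[𝓝 p] fun x => fderiv ℝ f x + s • fderiv ℝ w x := by
    filter_upwards [isOpen_compl_singleton.mem_nhds (show p ∈ ({0}ᶜ : Set E3) from hp)] with x hx
    exact ((hf.differentiableAt hx).hasFDerivAt.add
      ((hw.differentiableAt hx).hasFDerivAt.const_smul s)).fderiv
  rw [h.fderiv_eq]
  exact ((hf.differentiableAt_fderiv hp).hasFDerivAt.add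
    ((hw.differentiableAt_fderiv hp).hasFDerivAt.const_smul s)).fderiv

/-- Ovals are stable under small smooth perturbations. -/
lemma Oval.eventually_add_smul {f w : E3 → E3} (hf : Oval f) (hw : Radial w) :
    ∀ᶠ s : ℝ in 𝓝 0, Oval fun x => f x + s • w x := by
  have hfr := hf.radial
  -- The unit tangent bundle of the sphere.
  let K : Set (E3 × E3) := {z | ‖z.1‖ = 1 ∧ ‖z.2‖ = 1 ∧ inner ℝ z.2 z.1 = 0}
  have hK : IsCompact K := by
    refine ((isCompact_sphere (0 : E3) 1).prod (isCompact_sphere (0 : E3) 1)).of_isClosed_subset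
      ?_ ?_
    · exact (isClosed_eq continuous_fst.norm continuous_const).inter
        ((isClosed_eq continuous_snd.norm continuous_const).inter
          (isClosed_eq (continuous_snd.inner continuous_fst) continuous_const))
    · rintro z ⟨h1, h2, -⟩
      exact ⟨by simpa using h1, by simpa using h2⟩
  have key : ∀ᶠ s : ℝ in 𝓝 0, ∀ z ∈ K, secondForm (fun x => f x + s • w x) z.1 z.2 z.2 < 0 := by
    refine hK.eventually_forall_of_forall_eventually fun z hz => ?_
    obtain ⟨p, a⟩ := z
    obtain ⟨hp, ha, hap⟩ := hz
    have hp0 : p ≠ 0 := ne_zero_of_norm_one hp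
    have ha0 : a ≠ 0 := ne_zero_of_norm_one ha
    let y₀ : ℝ × E3 × E3 := ((0 : ℝ), p, a)
    have c1 : ∀ {k : E3 → E3}, Radial k → ∀ i, ContinuousAt
        (fun y : ℝ × E3 × E3 => fderiv ℝ k y.2.1 (bas i)) y₀ := fun {k} hk i =>
      (ContinuousAt.comp (g := fderiv ℝ k) (f := fun y : ℝ × E3 × E3 => y.2.1)
        (hk.contDiffAt_fderiv hp0).continuousAt (by fun_prop)).clm_apply continuousAt_const
    have c2 : ∀ i, ContinuousAt (fun y : ℝ × E3 × E3 =>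
        fderiv ℝ f y.2.1 (bas i) + y.1 • fderiv ℝ w y.2.1 (bas i)) y₀ := fun i =>
      (c1 hfr i).add (continuousAt_fst.smul (c1 hw i))
    have c3 : ∀ i j, ContinuousAt (fun y : ℝ × E3 × E3 =>
        cross (fderiv ℝ f y.2.1 (bas i) + y.1 • fderiv ℝ w y.2.1 (bas i))
          (fderiv ℝ f y.2.1 (bas j) + y.1 • fderiv ℝ w y.2.1 (bas j))) y₀ := fun i j =>
      ((continuousAt_const (y := crossL)).clm_apply (c2 i)).clm_apply (c2 j)
    have c4 : ∀ i, ContinuousAt (fun y : ℝ × E3 × E3 => y.2.1 i) y₀ := fun i => by fun_prop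
    have c5 : ∀ {k : E3 → E3}, Radial k → ContinuousAt (fun y : ℝ × E3 × E3 =>
        fderiv ℝ (fderiv ℝ k) y.2.1 y.2.2 y.2.2) y₀ := fun {k} hk =>
      ((ContinuousAt.comp (g := fderiv ℝ (fderiv ℝ k)) (f := fun y : ℝ × E3 × E3 => y.2.1)
        (hk.contDiffAt_fderiv_fderiv hp0).continuousAt (by fun_prop)).clm_apply
        (by fun_prop)).clm_apply (by fun_prop)
    have c6 := (((c4 0).smul (c3 1 2)).add ((c4 1).smul (c3 2 0))).add ((c4 2).smul (c3 0 1))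
    have c7 := ((c5 hfr).add (continuousAt_fst.smul (c5 hw))).inner (𝕜 := ℝ) c6
    have hform : ∀ y : ℝ × E3 × E3, y.2.1 ≠ 0 →
        secondForm (fun x => f x + y.1 • w x) y.2.1 y.2.2 y.2.2 = _ := fun y hy => by
      rw [secondForm, fderiv_fderiv_add_smul hfr hw _ hy, normalField_add_smul hfr hw _ hy]
    have hcont : ContinuousAt (fun y : ℝ × E3 × E3 =>
        secondForm (fun x => f x + y.1 • w x) y.2.1 y.2.2 y.2.2) y₀ := by
      refine c7.congr ?_
      have : ∀ᶠ y : ℝ × E3 × E3 in 𝓝 y₀, y.2.1 ≠ 0 :=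
        (show ContinuousAt (fun y : ℝ × E3 × E3 => y.2.1) y₀ by fun_prop).eventually_ne hp0
      filter_upwards [this] with y hy
      rw [hform y hy]
      rfl
    have hneg : secondForm (fun x => f x + (0 : ℝ) • w x) p a a < 0 := by
      simpa using hf.neg p hp a hap ha0
    filter_upwards [hcont (Iio_mem_nhds hneg)] with y hy
    exact hy
  filter_upwards [key] with s hs
  refine ⟨hfr.add (hw.const_smul s), fun p hp a hap ha => ?_⟩
  have hn : 0 < ‖a‖ := norm_pos_iff.mpr ha
  have h1 := hs (p, ‖a‖⁻¹ • a) ⟨hp, norm_normalize ha, by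
    simp [real_inner_smul_left, hap]⟩
  simp only [secondForm, map_smul, _root_.smul_apply, real_inner_smul_left] at h1 ⊢
  have h2 : 0 < ‖a‖⁻¹ := inv_pos.mpr hn
  by_contra hcon
  push Not at hcon
  have := mul_nonneg h2.le (mul_nonneg h2.le hcon)
  linarith

/-- An oval is not contained in a plane. -/
lemma Oval.exists_inner_ne {f : E3 → E3} (hf : Oval f) {u : E3} (hu : u ≠ 0) :
    ∃ p q : S2, inner ℝ (f p) u ≠ inner ℝ (f q) u := by
  by_contra hno
  push Not at hno
  have hp : ∀ p : S2, gaussMap f p = ‖u‖⁻¹ • u := fun p =>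
    hf.gaussMap_eq_of_isMax (norm_normalize hu) fun x => by
      rw [real_inner_smul_right, real_inner_smul_right, hno x p]
  have := hf.gaussMap_injective ((hp ⟨bas 0, by simp⟩).trans (hp ⟨bas 1, by simp⟩).symm)
  have := congrArg (fun v : S2 => (v : E3) 0) this
  simp [bas] at this

lemma contMDiff_const_smul_S2 {v : S2 → E3} (hv : ContMDiff (𝓡 2) 𝓘(ℝ, E3) ∞ v) (s : ℝ) :
    ContMDiff (𝓡 2) 𝓘(ℝ, E3) ∞ fun p => s • v p :=
  (show ContDiff ℝ ∞ fun y : E3 => s • y from contDiff_const_smul s).contMDiff.comp hv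

/-- **Infinitesimal rigidity of ovals**: an infinitesimal isometric deformation `v` of an oval `f`
is the velocity field of a rigid motion. For small `s` the surfaces `f + s v` and `f - s v` are
isometric ovals, so they are congruent; the infinitesimal motion is the Cayley transform of the
congruence. -/
theorem exists_skew_of_oval {f v : S2 → E3} (hf : ContMDiff (𝓡 2) 𝓘(ℝ, E3) ∞ f)
    (hv : ContMDiff (𝓡 2) 𝓘(ℝ, E3) ∞ v) (ho : Oval (radialExt f))
    (h : ∀ p (a b : TS p), inner ℝ (mvfderiv (𝓡 2) v p a) (mvfderiv (𝓡 2) f p b)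
      + inner ℝ (mvfderiv (𝓡 2) f p a) (mvfderiv (𝓡 2) v p b) = 0) :
    ∃ (A : E3 →L[ℝ] E3) (c : E3), (∀ x y, inner ℝ (A x) y + inner ℝ x (A y) = 0) ∧
      ∀ p, v p = A (f p) + c := by
  have hvr := radial_radialExt hv
  have hev := ho.eventually_add_smul hvr
  have hev2 : ∀ᶠ s : ℝ in 𝓝 0, Oval fun x => radialExt f x + (-s) • radialExt v x := by
    have : Tendsto (fun s : ℝ => -s) (𝓝 0) (𝓝 0) := by
      simpa using (continuous_neg (G := ℝ)).tendsto 0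
    exact this.eventually hev
  obtain ⟨s, ⟨h1, h2⟩, hs⟩ := (((hev.and hev2).filter_mono nhdsWithin_le_nhds).and
    (self_mem_nhdsWithin (s := Ioi (0 : ℝ)))).exists
  have hs0 : s ≠ 0 := ne_of_gt hs
  have hsm : ∀ s : ℝ, ContMDiff (𝓡 2) 𝓘(ℝ, E3) ∞ fun p => f p + s • v p := fun s =>
    hf.add (contMDiff_const_smul_S2 hv s)
  have hpb : pullback (fun p => f p + s • v p) = pullback fun p => f p + (-s) • v p := by
    have hd : ∀ (s : ℝ) p (a : TS p), mvfderiv (𝓡 2) (fun p => f p + s • v p) p a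
        = mvfderiv (𝓡 2) f p a + s • mvfderiv (𝓡 2) v p a := by
      intro s p a
      have hp0 := coe_S2_ne_zero p
      have hfd := ho.radial.differentiableAt hp0
      have hvd := hvr.differentiableAt hp0
      have hd : HasFDerivAt (fun x => radialExt f x + s • radialExt v x)
          (fderiv ℝ (radialExt f) p + s • fderiv ℝ (radialExt v) p) (p : E3) :=
        hfd.hasFDerivAt.add (hvd.hasFDerivAt.const_smul s)
      rw [mvfderiv_eq hf, mvfderiv_eq hv, mvfderiv_eq_fderiv (f := fun p => f p + s • v p)
        (ho.radial.add (hvr.const_smul s)) (fun p => by rw [radialExt_coe, radialExt_coe]),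
        hd.fderiv]
      rfl
    funext p a b
    rw [pullback, pullback, hd, hd, hd, hd]
    simp only [inner_add_left, inner_add_right, real_inner_smul_left, real_inner_smul_right]
    linear_combination (2 * s) * h p a b
  obtain ⟨U, c, hU⟩ := exists_congruence_of_pullback (hsm s) (hsm (-s)) h1 h2 hpb
  have hrel : ∀ p, s • (v p + U (v p)) = f p - U (f p) - c := by
    intro p
    have := hU p
    rw [map_add, map_smul] at this
    rw [smul_add]
    have e : f p = U (f p) + s • U (v p) + c + s • v p := by
      rw [← this]; module
    nth_rewrite 1 [e]
    module
  let B : E3 →ₗ[ℝ] E3 := LinearMap.id + U.toLinearEquiv.toLinearMap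
  have hB : ∀ x, B x = x + U x := fun x => rfl
  -- If `U u = -u`, then the relation `hrel` makes the component of `f` along `u` constant.
  have hBinj : Function.Injective B := by
    rw [injective_iff_map_eq_zero]
    intro u hu
    by_contra hu0
    rw [hB] at hu
    have hUu : U u = -u := eq_neg_of_add_eq_zero_right hu
    have hin : ∀ x, inner ℝ (U x) u = - inner ℝ x u := fun x => by
      rw [← U.inner_map_map x u, hUu, inner_neg_right, neg_neg]
    obtain ⟨p, q, hpq⟩ := ho.exists_inner_ne hu0
    rw [radialExt_coe, radialExt_coe] at hpq
    have hp : ∀ p, 2 * inner ℝ (f p) u = inner ℝ c u := by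
      intro p
      have := congrArg (fun x => inner ℝ x u) (hrel p)
      simp only [real_inner_smul_left, inner_add_left, inner_sub_left, hin] at this
      linarith
    exact hpq (by linarith [hp p, hp q])
  let e : E3 ≃ₗ[ℝ] E3 := LinearEquiv.ofInjectiveEndo B hBinj
  have he : ∀ x, e x = x + U x := fun x => rfl
  let A : E3 →ₗ[ℝ] E3 := s⁻¹ • e.symm.toLinearMap.comp (LinearMap.id - U.toLinearEquiv.toLinearMap)
  have hA : ∀ x, A x = s⁻¹ • e.symm (x - U x) := fun x => rfl
  refine ⟨A.toContinuousLinearMap, -(s⁻¹ • e.symm c), ?_, ?_⟩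
  · intro x y
    change inner ℝ (A x) y + inner ℝ x (A y) = 0
    -- For `T = (1 + U)⁻¹ (1 - U)` the isometry `U` takes `x + T x` to `x - T x`, so `T` is skew.
    have hC : ∀ x, x - e.symm (x - U x) = U (x + e.symm (x - U x)) := by
      intro x
      have h3 := he (e.symm (x - U x))
      rw [e.apply_symm_apply] at h3
      rw [map_add]
      have : U (e.symm (x - U x)) = x - U x - e.symm (x - U x) := eq_sub_of_add_eq' h3.symm
      rw [this]; abel
    have h3 := U.inner_map_map (x + e.symm (x - U x)) (y + e.symm (y - U y))
    rw [← hC, ← hC] at h3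
    simp only [inner_add_left, inner_add_right, inner_sub_left, inner_sub_right] at h3
    rw [hA, hA, real_inner_smul_left, real_inner_smul_right]
    linear_combination (-s⁻¹ / 2) * h3
  · intro p
    change v p = A (f p) + _
    have h3 : e (s • v p) = f p - U (f p) - c := by
      rw [he, map_smul, ← smul_add, hrel]
    have h4 : s • v p = e.symm (f p - U (f p)) - e.symm c := by
      rw [← map_sub, ← h3, e.symm_apply_apply]
    rw [hA, ← sub_eq_add_neg, ← smul_sub, ← h4, smul_smul, inv_mul_cancel₀ hs0, one_smul]

/-! ### Existence and uniqueness of the coarse-grained velocity gradient -/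

lemma toMat_apply (A : E3 →L[ℝ] E3) (a b : Fin 3) :
    toMat A a b = inner ℝ (bas a) (A (bas b)) := by
  simp [toMat, bas, EuclideanSpace.inner_single_left]

lemma toMat_add (A B : E3 →L[ℝ] E3) : toMat (A + B) = toMat A + toMat B := rfl

lemma toMat_add_transpose_of_skew {A : E3 →L[ℝ] E3}
    (hA : ∀ x y, inner ℝ (A x) y + inner ℝ x (A y) = 0) : toMat A + (toMat A).transpose = 0 := by
  ext a b
  rw [Matrix.add_apply, Matrix.transpose_apply, toMat_apply, toMat_apply,
    ← real_inner_comm (bas b), add_comm]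
  exact hA _ _

lemma mvfderiv_affine {f : S2 → E3} (hf : ContMDiff (𝓡 2) 𝓘(ℝ, E3) ∞ f) (A : E3 →L[ℝ] E3) (c : E3)
    (p : S2) (a : TS p) :
    mvfderiv (𝓡 2) (fun p => A (f p) + c) p a = A (mvfderiv (𝓡 2) f p a) := by
  have hg := radial_radialExt hf
  have h : HasFDerivAt (fun x => A (radialExt f x) + c) _ (p : E3) :=
    (A.hasFDerivAt.comp (p : E3)
      (hg.differentiableAt (coe_S2_ne_zero p)).hasFDerivAt).add_const c
  rw [mvfderiv_eq_fderiv (f := fun p => A (f p) + c)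
    (hg.comp (g := fun y => A y + c) (A.contDiff.add contDiff_const))
    (fun p => by rw [radialExt_coe]), mvfderiv_eq hf, h.fderiv]
  rfl

lemma contMDiff_affine {f : S2 → E3} (hf : ContMDiff (𝓡 2) 𝓘(ℝ, E3) ∞ f) (A : E3 →L[ℝ] E3)
    (c : E3) : ContMDiff (𝓡 2) 𝓘(ℝ, E3) ∞ fun p => A (f p) + c :=
  (show ContDiff ℝ ∞ fun y => A y + c from A.contDiff.add contDiff_const).contMDiff.comp hf

/-- Infinitesimal rigidity of a surface which is an oval up to a point reflection. -/
lemma exists_skew {f v : S2 → E3} (hf : ContMDiff (𝓡 2) 𝓘(ℝ, E3) ∞ f)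
    (hv : ContMDiff (𝓡 2) 𝓘(ℝ, E3) ∞ v) {ε : ℝ} (ho : Oval (radialExt fun p => ε • f p))
    (h : ∀ p (a b : TS p), inner ℝ (mvfderiv (𝓡 2) v p a) (mvfderiv (𝓡 2) f p b)
      + inner ℝ (mvfderiv (𝓡 2) f p a) (mvfderiv (𝓡 2) v p b) = 0) :
    ∃ (A : E3 →L[ℝ] E3) (c : E3), (∀ x y, inner ℝ (A x) y + inner ℝ x (A y) = 0) ∧
      ∀ p, v p = A (f p) + c := by
  have hd : ∀ p (a : TS p), mvfderiv (𝓡 2) (fun p => ε • f p) p a = ε • mvfderiv (𝓡 2) f p a := by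
    intro p a
    have := mvfderiv_affine hf (ε • ContinuousLinearMap.id ℝ E3) 0 p a
    simpa using this
  obtain ⟨A, c, hA, hvA⟩ := exists_skew_of_oval (contMDiff_const_smul_S2 hf ε) hv ho (by
    intro p a b
    rw [hd, hd, real_inner_smul_right, real_inner_smul_left, ← mul_add, h, mul_zero])
  refine ⟨ε • A, c, fun x y => ?_, fun p => by rw [hvA, map_smul]; rfl⟩
  rw [_root_.smul_apply, _root_.smul_apply, real_inner_smul_left, real_inner_smul_right, ← mul_add,
    hA, mul_zero]

/-- If the shift vanishes along the boundary and some affine field `A ∘ f + c` induces the right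
change of metric, then the coarse-grained velocity gradient is the symmetric part of `A`: by
infinitesimal rigidity any other admissible field differs from this one by an infinitesimal rigid
motion, whose flux matrix is antisymmetric. -/
theorem isCoarseGrained_iff {X : Type*} [TopologicalSpace X] [ChartedSpace E3 X]
    {M : ComovingSpacetime X} {C : Domain X} {t : ℝ} {f : S2 → E3} (hadm : IsAdmissible M C t)
    (hf : IsIsometricEmbedding M C t f)
    (hshift : ∀ p (w : TX (C.ξ p)), M.g (t, C.ξ p) (1, 0) (0, w) = 0)
    {A : E3 →L[ℝ] E3} {c : E3} (hA : InducesMetricChange M C t f fun p => A (f p) + c)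
    (Q : Matrix (Fin 3) (Fin 3) ℝ) :
    IsCoarseGrained M C t f Q ↔ Q = (1 / 2 : ℝ) • (toMat A + (toMat A).transpose) := by
  have hpb : boundaryMetric M C t = pullback f := by
    funext p a b
    exact (hf.isometric p a b).symm
  obtain ⟨ε, hε, ho⟩ := exists_sign_oval hf.contMDiff (fun p => by rw [← hpb]; exact hadm.2 p)
  have hflux := fluxMatrix_affine hf.contMDiff hε ho
  have hflux0 : fluxMatrix f (fun _ => 0) = 0 := by
    have := hflux 0 0
    simp only [_root_.zero_apply, add_zero] at this
    rw [this]
    ext a b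
    simp [toMat]
  have hN : ∀ p (N : TX (C.ξ p)), M.IsShift t (C.ξ p) N → N = 0 := by
    intro p N hN
    by_contra hne
    have h1 := M.spacelike _ (hadm.1 p) N hne
    have h2 := hN N
    rw [hshift] at h2
    exact h1.ne' h2
  have h0 : ∀ p (w : TX (C.ξ p)), M.h t (C.ξ p) 0 w = 0 := by
    intro p w
    have : ((0, 0) : ℝ × TX (C.ξ p)) = 0 := rfl
    rw [ComovingSpacetime.h, this, map_zero]
    rfl
  constructor
  · rintro ⟨v, G, hv, hG, rfl⟩
    -- The shift vanishes. So its tangential part vanishes as well, whatever the slice normal is.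
    have hG0 : G = fun _ => 0 := by
      funext p
      obtain ⟨N, a, hN1, hN2, hN3⟩ := hG p
      have hN0 := hN p N hN1
      rw [hN0, h0, zero_smul, add_zero] at hN2
      rw [hN0, h0, zero_smul, add_zero] at hN3
      have ha : a = 0 := C.immersion_ξ p (hN2.symm.trans (map_zero _).symm)
      rw [hN3, ha, map_zero]
    have hw : ContMDiff (𝓡 2) 𝓘(ℝ, E3) ∞ fun p => v p - (A (f p) + c) := hv.1.sub hA.1
    have hdw : ∀ p (a : TS p), mvfderiv (𝓡 2) (fun p => v p - (A (f p) + c)) p a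
        = mvfderiv (𝓡 2) v p a - mvfderiv (𝓡 2) (fun p => A (f p) + c) p a := by
      intro p a
      have h := mvfderiv_sub (x := p) ((hv.1 p).mdifferentiableAt (by simp))
        ((hA.1 p).mdifferentiableAt (by simp))
      exact congrArg (fun L : TS p →L[ℝ] E3 => L a) h
    obtain ⟨B, d, hB, hvB⟩ := exists_skew hf.contMDiff hw ho (fun p a b => by
      have h1 := (hv.2 p a b).unique (hA.2 p a b)
      rw [hdw, hdw, inner_sub_left, inner_sub_right]
      linarith)
    have hv' : v = fun p => (A + B) (f p) + (c + d) := by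
      funext p
      have := hvB p
      rw [sub_eq_iff_eq_add] at this
      rw [this, _root_.add_apply]
      abel
    rw [hG0, hflux0, hv', hflux, toMat_add, Matrix.transpose_add]
    have := toMat_add_transpose_of_skew hB
    rw [add_add_add_comm, this]
    simp
  · rintro rfl
    refine ⟨fun p => A (f p) + c, fun _ => 0, hA, fun p => ⟨0, 0, ?_, ?_, ?_⟩, ?_⟩
    · intro w
      rw [h0, hshift]
    · rw [h0, zero_smul, add_zero, map_zero]
    · rw [h0, zero_smul, add_zero, map_zero]
    · rw [hflux0, hflux]
      simp

/-! ### Conformally static boundaries: FLRW and Swiss cheese -/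

/-- If the metric of the boundary evolves by the scale factor `a` and the shift vanishes, the
coarse-grained velocity gradient is the Hubble parameter times the identity. -/
theorem isCoarseGrained_iff_of_scaling {X : Type*} [TopologicalSpace X] [ChartedSpace E3 X]
    {M : ComovingSpacetime X} {C : Domain X} {t : ℝ} {f : S2 → E3} (hadm : IsAdmissible M C t)
    (hf : IsIsometricEmbedding M C t f)
    (hshift : ∀ p (w : TX (C.ξ p)), M.g (t, C.ξ p) (1, 0) (0, w) = 0)
    {a : ℝ → ℝ} (ha : DifferentiableAt ℝ a t)
    {I : Set ℝ} (hI : IsOpen I) (ht : t ∈ I)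
    (hscale : ∀ p (x y : TS p), ∃ β, ∀ s ∈ I, boundaryMetric M C s p x y = a s ^ 2 * β)
    (Q : Matrix (Fin 3) (Fin 3) ℝ) :
    (IsCoarseGrained M C t f Q ↔ Q = (deriv a t / a t) • 1) ∧
      (IsCoarseGrained M C t f Q →
        expansion Q = 3 * (deriv a t / a t) ∧ shear Q = 0 ∧ vorticity Q = 0) := by
  set H := deriv a t / a t with hH
  have hA : InducesMetricChange M C t f
      fun p => (H • ContinuousLinearMap.id ℝ E3) (f p) + 0 := by
    refine ⟨contMDiff_affine hf.contMDiff _ _, fun p x y => ?_⟩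
    rw [mvfderiv_affine hf.contMDiff, mvfderiv_affine hf.contMDiff]
    simp only [_root_.smul_apply, ContinuousLinearMap.id_apply, real_inner_smul_left,
      real_inner_smul_right]
    obtain ⟨β, hβ⟩ := hscale p x y
    have hpb := (hf.isometric p x y).trans (hβ t ht)
    rw [pullback] at hpb
    rw [hpb]
    have h1 := (ha.hasDerivAt.fun_pow 2).mul_const β
    have h2 : (fun s => boundaryMetric M C s p x y) =ᶠ[𝓝 t] fun s => a s ^ 2 * β := by
      filter_upwards [hI.mem_nhds ht] with s hs
      exact hβ s hs
    refine (h1.congr_of_eventuallyEq h2).congr_deriv ?_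
    rw [hH]
    field_simp
    ring
  have hiff := isCoarseGrained_iff hadm hf hshift hA Q
  have hmat : (1 / 2 : ℝ) • (toMat (H • ContinuousLinearMap.id ℝ E3)
      + (toMat (H • ContinuousLinearMap.id ℝ E3)).transpose) = H • 1 := by
    have h1 : toMat (H • ContinuousLinearMap.id ℝ E3) = H • 1 := by
      ext i j
      simp [toMat, bas, Matrix.one_apply]
    rw [h1, Matrix.transpose_smul, Matrix.transpose_one, ← two_smul ℝ, smul_smul]
    norm_num
  rw [hmat] at hiff
  refine ⟨hiff, fun h => ?_⟩
  have he : expansion (H • (1 : Matrix (Fin 3) (Fin 3) ℝ)) = 3 * H := by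
    simp [expansion, Matrix.trace_smul]
    ring
  rw [hiff.mp h]
  refine ⟨he, ?_, ?_⟩
  · rw [shear, he, Matrix.transpose_smul, Matrix.transpose_one, ← two_smul ℝ (H • _), smul_smul,
      mul_div_cancel_left₀ H (by norm_num)]
    norm_num
  · simp [vorticity, Matrix.transpose_smul]

lemma IsFLRW.differentiableAt {X : Type*} [TopologicalSpace X] [ChartedSpace E3 X]
    {M : ComovingSpacetime X} {I : Set ℝ} {k : ℝ} {a : ℝ → ℝ} (h : IsFLRW M I k a) {t : ℝ}
    (ht : t ∈ I) : DifferentiableAt ℝ a t :=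
  (h.smooth.contDiffAt (h.isOpen.mem_nhds ht)).differentiableAt (by simp)

lemma IsFLRW.g_one_zero {X : Type*} [TopologicalSpace X] [ChartedSpace E3 X]
    {M : ComovingSpacetime X} {I : Set ℝ} {k : ℝ} {a : ℝ → ℝ} (h : IsFLRW M I k a) {t : ℝ}
    (ht : t ∈ I) (y : X) (w : TX y) : M.g (t, y) (1, 0) (0, w) = 0 := by
  obtain ⟨γ, -, hγ⟩ := h.metric_eq
  have h1 := hγ t ht y (1, 0) (0, w)
  have h2 := hγ t ht y (0, 0) (0, w)
  have h3 : ((0, 0) : ℝ × TX y) = 0 := rfl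
  rw [h3, map_zero] at h2
  rw [h1]
  simpa using h2.symm

lemma IsFLRW.exists_scaling {X : Type*} [TopologicalSpace X] [ChartedSpace E3 X]
    {M : ComovingSpacetime X} {I : Set ℝ} {k : ℝ} {a : ℝ → ℝ} (h : IsFLRW M I k a) (y : X)
    (v w : TX y) : ∃ β, ∀ s ∈ I, M.h s y v w = a s ^ 2 * β := by
  obtain ⟨γ, -, hγ⟩ := h.metric_eq
  refine ⟨γ y v w, fun s hs => ?_⟩
  rw [ComovingSpacetime.h, hγ s hs]
  simp

/-- Where a Swiss-cheese model agrees with its background, every tangent vector of a slice comes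
from the background, since the identification preserves the positive definite spatial metric. -/
lemma IsSwissCheese.exists_mfderiv_eq {X₀ X : Type*} [TopologicalSpace X₀] [ChartedSpace E3 X₀]
    [TopologicalSpace X] [ChartedSpace E3 X] {ι : Type*} {M₀ : ComovingSpacetime X₀} {I : Set ℝ}
    {B : ι → Set X₀} {ψ : X₀ → X} {M : ComovingSpacetime X} {k : ℝ} {a : ℝ → ℝ}
    (h₀ : IsFLRW M₀ I k a) (h : IsSwissCheese M₀ I B ψ M) {t : ℝ} (ht : t ∈ I) {y : X₀}
    (hy : y ∉ ⋃ i, B i) (w : TX (ψ y)) : ∃ v : TX y, mfderiv (𝓡 3) (𝓡 3) ψ y v = w := by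
  let D : E3 →ₗ[ℝ] E3 := (mfderiv (𝓡 3) (𝓡 3) ψ y).toLinearMap
  have hinj : Function.Injective D := by
    rw [injective_iff_map_eq_zero]
    intro v hv
    by_contra hne
    have h1 := M₀.spacelike (t, y) (by rw [h₀.dom_eq]; exact ⟨ht, mem_univ y⟩) v hne
    have h2 := h.metric_eq t ht y hy (0, v) (0, v)
    have h3 : mfderiv (𝓡 3) (𝓡 3) ψ y v = 0 := hv
    have h4 : ((0, 0) : ℝ × TX (ψ y)) = 0 := rfl
    dsimp only at h2
    rw [h3, h4, map_zero] at h2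
    exact h1.ne h2
  exact LinearMap.injective_iff_surjective.mp hinj w

lemma IsSwissCheese.exists_scaling {X₀ X : Type*} [TopologicalSpace X₀] [ChartedSpace E3 X₀]
    [TopologicalSpace X] [ChartedSpace E3 X] {ι : Type*} {M₀ : ComovingSpacetime X₀} {I : Set ℝ}
    {B : ι → Set X₀} {ψ : X₀ → X} {M : ComovingSpacetime X} {k : ℝ} {a : ℝ → ℝ}
    (h₀ : IsFLRW M₀ I k a) (h : IsSwissCheese M₀ I B ψ M) {t : ℝ} (ht : t ∈ I) {x : X}
    (hx : x ∈ ψ '' (⋃ i, B i)ᶜ) (v w : TX x) :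
    (∃ β, ∀ s ∈ I, M.h s x v w = a s ^ 2 * β) ∧ M.g (t, x) (1, 0) (0, w) = 0 := by
  obtain ⟨y, hy, rfl⟩ := hx
  obtain ⟨v', rfl⟩ := h.exists_mfderiv_eq h₀ ht hy v
  obtain ⟨w', rfl⟩ := h.exists_mfderiv_eq h₀ ht hy w
  constructor
  · obtain ⟨β, hβ⟩ := h₀.exists_scaling y v' w'
    exact ⟨β, fun s hs => (h.metric_eq s hs y hy (0, v') (0, w')).trans (hβ s hs)⟩
  · have h1 := h.metric_eq t ht y hy (1, 0) (0, w')
    dsimp only at h1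
    rw [map_zero, h₀.g_one_zero ht] at h1
    exact h1

/-! ### Kasner spacetimes: local quantities -/

/-- The diagonal endomorphism of `E3` with the given entries. -/
def diagMap (d : Fin 3 → ℝ) : E3 →L[ℝ] E3 :=
  ∑ i, d i • (EuclideanSpace.proj i : E3 →L[ℝ] ℝ).smulRight (bas i)

lemma diagMap_apply (d : Fin 3 → ℝ) (x : E3) (i : Fin 3) : diagMap d x i = d i * x i := by
  simp only [diagMap, Fin.sum_univ_three]
  fin_cases i <;> simp [bas]

lemma diagMap_comp (d d' : Fin 3 → ℝ) (x : E3) :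
    diagMap d (diagMap d' x) = diagMap (fun i => d i * d' i) x := by
  apply PiLp.ext
  intro i
  simp only [diagMap_apply]
  ring

lemma inner_eq_sum (x y : E3) : inner ℝ x y = ∑ i, x i * y i := by
  rw [inner_eq, Fin.sum_univ_three]

namespace IsKasner

variable {M : ComovingSpacetime E3} {κ : Fin 3 → ℝ} (hK : IsKasner M κ) {t : ℝ} (ht : 0 < t)
include hK ht

lemma h_eq (y : E3) (v w : E3) : M.h t y v w = ∑ i, t ^ (2 * κ i) * v i * w i := by
  refine (hK.metric_eq t ht y (0, v) (0, w)).trans ?_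
  simp [comp]

lemma chartMetric_eq (y : E3) (z : E3) (a b : ℝ × E3) :
    M.chartMetric y (t, z) a b = -(a.1 * b.1) + ∑ i, t ^ (2 * κ i) * a.2 i * b.2 i := by
  have hid : ((extChartAt (𝓡 3) y).symm : E3 → E3) = id := rfl
  have hd : ∀ v : E3, mfderiv (𝓡 3) (𝓡 3) (extChartAt (𝓡 3) y).symm z v = v := by
    intro v
    have := congrArg (fun L : E3 →L[ℝ] E3 => L v) (mfderiv_id (I := 𝓡 3) (x := z))
    rw [← hid] at this
    exact this
  rw [ComovingSpacetime.chartMetric]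
  refine (hK.metric_eq t ht _ _ _).trans ?_
  simp only [comp, hd]

lemma fderiv_chartMetric (y : E3) (z : E3) (a b c : ℝ × E3) :
    fderiv ℝ (fun z' => M.chartMetric y z' a b) (t, z) c
      = c.1 * ∑ i, 2 * (κ i / t) * t ^ (2 * κ i) * a.2 i * b.2 i := by
  have h1 : HasDerivAt (fun s : ℝ => -(a.1 * b.1) + ∑ i, s ^ (2 * κ i) * a.2 i * b.2 i)
      (∑ i, 2 * (κ i / t) * t ^ (2 * κ i) * a.2 i * b.2 i) t := by
    refine (HasDerivAt.fun_sum fun i _ => ?_).const_add _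
    refine (((Real.hasDerivAt_rpow_const (p := 2 * κ i) (Or.inl ht.ne')).mul_const _).mul_const
      _).congr_deriv ?_
    rw [Real.rpow_sub_one ht.ne']
    ring
  have h2 : HasFDerivAt (fun z' : ℝ × E3 =>
      -(a.1 * b.1) + ∑ i, z'.1 ^ (2 * κ i) * a.2 i * b.2 i) _ (t, z) :=
    HasFDerivAt.comp (g := fun s : ℝ => -(a.1 * b.1) + ∑ i, s ^ (2 * κ i) * a.2 i * b.2 i)
      (f := Prod.fst) (t, z) h1.hasFDerivAt (hasFDerivAt_fst (𝕜 := ℝ) (p := ((t, z) : ℝ × E3)))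
  have h3 : (fun z' => M.chartMetric y z' a b) =ᶠ[𝓝 (t, z)] fun z' : ℝ × E3 =>
      -(a.1 * b.1) + ∑ i, z'.1 ^ (2 * κ i) * a.2 i * b.2 i := by
    have : ∀ᶠ z' : ℝ × E3 in 𝓝 (t, z), 0 < z'.1 :=
      continuous_fst.continuousAt (Ioi_mem_nhds ht)
    filter_upwards [this] with z' hz'
    exact hK.chartMetric_eq hz' y z'.2 a b
  rw [h3.fderiv_eq, h2.fderiv]
  simp

lemma Z_eq (y : E3) (a b : ℝ × E3) :
    M.Z t y a b = ∑ i, κ i / t * t ^ (2 * κ i) * a.2 i * b.2 i := by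
  rw [ComovingSpacetime.Z, ComovingSpacetime.christoffel, hK.fderiv_chartMetric ht,
    hK.fderiv_chartMetric ht, hK.fderiv_chartMetric ht, hK.fderiv_chartMetric ht]
  simp only [Fin.sum_univ_three, PiLp.zero_apply]
  ring

lemma localExpansion_eq (y : E3) : M.localExpansion t y = ∑ i, κ i / t := by
  have hpos : ∀ i, t ^ (2 * κ i) ≠ 0 := fun i => (Real.rpow_pos_of_pos ht _).ne'
  have hf0 : ComovingSpacetime.frame 0 = (1, 0) := rfl
  have hf : ∀ j : Fin 3, ComovingSpacetime.frame j.succ = (0, EuclideanSpace.single j 1) :=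
    fun _ => rfl
  have h1 : (Matrix.of fun μ ν => M.metricAt t y (ComovingSpacetime.frame μ)
      (ComovingSpacetime.frame ν))
      = Matrix.diagonal (Matrix.vecCons (-1) fun i => t ^ (2 * κ i)) := by
    ext μ ν
    rw [Matrix.of_apply, ComovingSpacetime.metricAt, hK.chartMetric_eq ht, Matrix.diagonal_apply]
    refine Fin.cases ?_ (fun i => ?_) μ <;> refine Fin.cases ?_ (fun j => ?_) ν <;>
      simp [hf0, hf, (Fin.succ_ne_zero _).symm]
    split_ifs <;> simp_all
  have h2 : (Matrix.of fun μ ν => M.Z t y (ComovingSpacetime.frame μ) (ComovingSpacetime.frame ν))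
      = Matrix.diagonal (Matrix.vecCons 0 fun i => κ i / t * t ^ (2 * κ i)) := by
    ext μ ν
    rw [Matrix.of_apply, hK.Z_eq ht, Matrix.diagonal_apply]
    refine Fin.cases ?_ (fun i => ?_) μ <;> refine Fin.cases ?_ (fun j => ?_) ν <;>
      simp [hf0, hf, (Fin.succ_ne_zero _).symm]
    split_ifs <;> simp_all
  have hinv : (Matrix.diagonal (Matrix.vecCons (-1) fun i => t ^ (2 * κ i)))⁻¹
      = Matrix.diagonal (Matrix.vecCons (-1) fun i => (t ^ (2 * κ i))⁻¹) := by
    apply Matrix.inv_eq_left_inv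
    rw [Matrix.diagonal_mul_diagonal, ← Matrix.diagonal_one]
    congr 1
    funext μ
    refine Fin.cases ?_ (fun i => ?_) μ <;> simp [hpos]
  rw [ComovingSpacetime.localExpansion, h1, h2, hinv, Matrix.diagonal_mul_diagonal,
    Matrix.trace_diagonal, Fin.sum_univ_succ]
  simp only [Matrix.cons_val_zero, Matrix.cons_val_succ, mul_zero, zero_add]
  refine Finset.sum_congr rfl fun i _ => ?_
  have := hpos i
  field_simp

lemma localShear_eq (y : E3) (x x' : E3) :
    M.localShear t y (0, x) (0, x')
      = (∑ i, κ i / t * t ^ (2 * κ i) * x i * x' i)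
        - M.localExpansion t y / 3 * M.h t y x x' := by
  rw [ComovingSpacetime.localShear, ComovingSpacetime.restMetric, hK.Z_eq ht, hK.Z_eq ht,
    ComovingSpacetime.metricAt, ComovingSpacetime.metricAt, ComovingSpacetime.metricAt,
    hK.chartMetric_eq ht, hK.chartMetric_eq ht, hK.chartMetric_eq ht, hK.h_eq ht]
  simp only [Fin.sum_univ_three, PiLp.zero_apply]
  ring

lemma localVorticity_eq (y : E3) (a b : ℝ × E3) : M.localVorticity t y a b = 0 := by
  rw [ComovingSpacetime.localVorticity, hK.Z_eq ht, hK.Z_eq ht]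
  simp only [Fin.sum_univ_three]
  ring

end IsKasner

/-! ### Kasner spacetimes: the coarse-grained velocity gradient -/

lemma toForm_toMat (A : E3 →L[ℝ] E3) (x y : E3) : toForm (toMat A) x y = inner ℝ x (A y) := by
  conv_rhs => rw [eq_sum_bas y]
  simp only [toForm, toMat, Matrix.of_apply, inner_eq, Fin.sum_univ_three, map_add, map_smul,
    PiLp.add_apply, PiLp.smul_apply, smul_eq_mul]
  ring

lemma toForm_bas (Q : Matrix (Fin 3) (Fin 3) ℝ) (a b : Fin 3) :
    toForm Q (bas a) (bas b) = Q a b := by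
  simp [toForm, bas]

lemma trace_toMat_conj (A : E3 →L[ℝ] E3) (U : E3 ≃ₗᵢ[ℝ] E3) {B : E3 →L[ℝ] E3}
    (h : ∀ x, B (U x) = U (A x)) : (toMat B).trace = (toMat A).trace := by
  have ht : ∀ A : E3 →L[ℝ] E3, (toMat A).trace = LinearMap.trace ℝ E3 A.toLinearMap := fun A =>
    (LinearMap.trace_eq_matrix_trace ℝ (EuclideanSpace.basisFun (Fin 3) ℝ).toBasis _).symm
  have hB : B.toLinearMap = U.toLinearEquiv.conj A.toLinearMap := by
    ext1 x
    have := h (U.symm x)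
    rw [U.apply_symm_apply] at this
    exact this
  rw [ht, ht, hB, LinearMap.trace_conj']

/-- The metric of the boundary of a domain in a Kasner spacetime. -/
lemma IsKasner.boundaryMetric_eq {M : ComovingSpacetime E3} {κ : Fin 3 → ℝ} (hK : IsKasner M κ)
    (C : Domain E3) {t : ℝ} (ht : 0 < t) (p : S2) (a b : TS p) :
    boundaryMetric M C t p a b
      = ∑ i, t ^ (2 * κ i) * (mvfderiv (𝓡 2) (C.ξ : S2 → E3) p a) i
        * (mvfderiv (𝓡 2) (C.ξ : S2 → E3) p b) i :=
  hK.h_eq ht (C.ξ p) _ _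

/-- By rigidity, the embedding of the boundary differs from the boundary in the flat slice only by
a linear isometry of the slice and a translation. -/
lemma IsKasner.exists_linear {M : ComovingSpacetime E3} {κ : Fin 3 → ℝ} (hK : IsKasner M κ)
    {C : Domain E3} {t : ℝ} (ht : 0 < t) {f : S2 → E3} (hadm : IsAdmissible M C t)
    (hf : IsIsometricEmbedding M C t f) :
    ∃ (U : E3 ≃ₗᵢ[ℝ] E3) (c : E3), ∀ p, f p = U (diagMap (fun i => t ^ κ i) (C.ξ p)) + c := by
  set D := diagMap fun i => t ^ κ i with hD
  have hξ : ContMDiff (𝓡 2) 𝓘(ℝ, E3) ∞ (C.ξ : S2 → E3) := C.contMDiff_ξ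
  let η : S2 → E3 := fun p => D (C.ξ p) + 0
  have hη : ContMDiff (𝓡 2) 𝓘(ℝ, E3) ∞ η := contMDiff_affine hξ D 0
  have hsq : ∀ i, t ^ (2 * κ i) = t ^ κ i * t ^ κ i := fun i => by
    rw [two_mul, Real.rpow_add ht]
  have hpη : pullback η = boundaryMetric M C t := by
    funext p a b
    rw [pullback, mvfderiv_affine hξ, mvfderiv_affine hξ, hK.boundaryMetric_eq C ht, inner_eq_sum]
    refine Finset.sum_congr rfl fun i _ => ?_
    rw [hD, diagMap_apply, diagMap_apply, hsq]
    ring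
  have hpf : pullback f = boundaryMetric M C t := by
    funext p a b
    exact hf.isometric p a b
  obtain ⟨ε, hε, ho⟩ := exists_sign_oval hη (fun p => by rw [hpη]; exact hadm.2 p)
  obtain ⟨δ, hδ, ho'⟩ := exists_sign_oval hf.contMDiff (fun p => by rw [hpf]; exact hadm.2 p)
  obtain ⟨U, c, hU⟩ := exists_congruence_of_pullback (contMDiff_const_smul_S2 hη ε)
    (contMDiff_const_smul_S2 hf.contMDiff δ) ho ho'
    (by rw [pullback_const_smul hη hε, pullback_const_smul hf.contMDiff hδ, hpη, hpf])
  have hsign : ∀ p, f p = (δ * ε) • U (D (C.ξ p)) + δ • c := by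
    intro p
    have h1 := congrArg (fun x => δ • x) (hU p)
    simp only [smul_smul, smul_add, hδ, one_smul, map_smul, η, add_zero] at h1
    exact h1
  have hδε : δ * ε * (δ * ε) = 1 := by
    linear_combination (ε * ε) * hδ + hε
  rcases mul_self_eq_one_iff.mp hδε with h | h
  · exact ⟨U, δ • c, fun p => by rw [hsign, h, one_smul]⟩
  · exact ⟨U.trans (LinearIsometryEquiv.neg ℝ), δ • c, fun p => by
      rw [hsign, h, neg_one_smul]; rfl⟩

/-- The coarse-grained velocity gradient of a Kasner spacetime. -/
theorem IsKasner.coarseGrained {M : ComovingSpacetime E3} {κ : Fin 3 → ℝ} (hK : IsKasner M κ)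
    {C : Domain E3} {t : ℝ} (ht : 0 < t) {f : S2 → E3} (hadm : IsAdmissible M C t)
    (hf : IsIsometricEmbedding M C t f) :
    ∃ (L : E3 →ₗ[ℝ] E3) (c : E3),
      (∀ y x x' : E3, inner ℝ (L x) (L x') = M.h t y x x') ∧
      (∀ p, f p = L (C.ξ p) + c) ∧
      ∀ Q : Matrix (Fin 3) (Fin 3) ℝ,
        (IsCoarseGrained M C t f Q ↔ ∀ y x x' : E3,
          toForm Q (L x) (L x') = M.localShear t y (0, x) (0, x')
            + M.localExpansion t y / 3 * M.h t y x x') ∧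
        (IsCoarseGrained M C t f Q → ∀ y x x' : E3,
          expansion Q = M.localExpansion t y ∧
          toForm (shear Q) (L x) (L x') = M.localShear t y (0, x) (0, x') ∧
          vorticity Q = 0 ∧ M.localVorticity t y (0, x) (0, x') = 0) := by
  obtain ⟨U, c, hfU⟩ := hK.exists_linear ht hadm hf
  set D := diagMap fun i => t ^ κ i with hD
  set K := diagMap fun i => κ i / t with hKdef
  let L : E3 →L[ℝ] E3 := U.toContinuousLinearEquiv.toContinuousLinearMap.comp D
  have hL : ∀ x, L x = U (D x) := fun x => rfl
  have hpos : ∀ i, t ^ κ i ≠ 0 := fun i => (Real.rpow_pos_of_pos ht _).ne'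
  have hsq : ∀ i, t ^ (2 * κ i) = t ^ κ i * t ^ κ i := fun i => by
    rw [two_mul, Real.rpow_add ht]
  have hLin : ∀ x x', inner ℝ (L x) (L x') = ∑ i, t ^ (2 * κ i) * x i * x' i := by
    intro x x'
    rw [hL, hL, U.inner_map_map, inner_eq_sum]
    refine Finset.sum_congr rfl fun i _ => ?_
    rw [hD, diagMap_apply, diagMap_apply, hsq]
    ring
  have hLsurj : ∀ z, ∃ x, L x = z := by
    intro z
    refine ⟨diagMap (fun i => (t ^ κ i)⁻¹) (U.symm z), ?_⟩
    rw [hL, hD, diagMap_comp]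
    have : diagMap (fun i => t ^ κ i * (t ^ κ i)⁻¹) (U.symm z) = U.symm z := by
      apply PiLp.ext
      intro i
      rw [diagMap_apply, mul_inv_cancel₀ (hpos i), one_mul]
    rw [this, U.apply_symm_apply]
  -- In the slice the velocity field is `x ↦ K x`; `A` is its image under the embedding.
  let A : E3 →L[ℝ] E3 := U.toContinuousLinearEquiv.toContinuousLinearMap.comp
    (K.comp U.symm.toContinuousLinearEquiv.toContinuousLinearMap)
  have hAU : ∀ x, A (U x) = U (K x) := by
    intro x
    change U (K (U.symm (U x))) = _
    rw [U.symm_apply_apply]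
  have hKD : ∀ x, K (D x) = D (K x) := by
    intro x
    rw [hKdef, hD, diagMap_comp, diagMap_comp]
    simp only [mul_comm]
  have hAL : ∀ x, A (L x) = L (K x) := by
    intro x
    rw [hL, hAU, hKD, hL]
  have hform : ∀ x x', inner ℝ (L x) (A (L x'))
      = ∑ i, κ i / t * t ^ (2 * κ i) * x i * x' i := by
    intro x x'
    rw [hAL, hLin]
    refine Finset.sum_congr rfl fun i _ => ?_
    rw [hKdef, diagMap_apply]
    ring
  have hsymm : toMat A + (toMat A).transpose = (2 : ℝ) • toMat A := by
    have hA : ∀ x y, inner ℝ x (A y) = inner ℝ y (A x) := by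
      intro x y
      obtain ⟨x, rfl⟩ := hLsurj x
      obtain ⟨y, rfl⟩ := hLsurj y
      rw [hform, hform]
      exact Finset.sum_congr rfl fun i _ => by ring
    ext a b
    rw [Matrix.add_apply, Matrix.transpose_apply, toMat_apply, toMat_apply, hA (bas b),
      Matrix.smul_apply, toMat_apply]
    simp
    ring
  have hξ : ContMDiff (𝓡 2) 𝓘(ℝ, E3) ∞ (C.ξ : S2 → E3) := C.contMDiff_ξ
  have hdf : ∀ p (a : TS p), mvfderiv (𝓡 2) f p a = L (mvfderiv (𝓡 2) (C.ξ : S2 → E3) p a) := by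
    intro p a
    have : f = fun p => L (C.ξ p) + c := funext hfU
    rw [this, mvfderiv_affine hξ]
  have hind : InducesMetricChange M C t f fun p => A (f p) + 0 := by
    refine ⟨contMDiff_affine hf.contMDiff A 0, fun p a b => ?_⟩
    rw [mvfderiv_affine hf.contMDiff, mvfderiv_affine hf.contMDiff, hdf, hdf,
      real_inner_comm (L (mvfderiv (𝓡 2) (C.ξ : S2 → E3) p b)) (A _), hform, hform]
    have h1 : HasDerivAt (fun s : ℝ => ∑ i, s ^ (2 * κ i)
        * (mvfderiv (𝓡 2) (C.ξ : S2 → E3) p a) i * (mvfderiv (𝓡 2) (C.ξ : S2 → E3) p b) i)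
        (∑ i, 2 * (κ i / t) * t ^ (2 * κ i)
        * (mvfderiv (𝓡 2) (C.ξ : S2 → E3) p a) i * (mvfderiv (𝓡 2) (C.ξ : S2 → E3) p b) i) t := by
      refine HasDerivAt.fun_sum fun i _ => ?_
      refine (((Real.hasDerivAt_rpow_const (p := 2 * κ i) (Or.inl ht.ne')).mul_const _).mul_const
        _).congr_deriv ?_
      rw [Real.rpow_sub_one ht.ne']
      ring
    have h2 : (fun s => boundaryMetric M C s p a b) =ᶠ[𝓝 t]
        fun s : ℝ => ∑ i, s ^ (2 * κ i) * (mvfderiv (𝓡 2) (C.ξ : S2 → E3) p a) i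
          * (mvfderiv (𝓡 2) (C.ξ : S2 → E3) p b) i := by
      filter_upwards [Ioi_mem_nhds ht] with s hs
      exact hK.boundaryMetric_eq C hs p a b
    refine (h1.congr_of_eventuallyEq h2).congr_deriv ?_
    rw [← Finset.sum_add_distrib]
    exact Finset.sum_congr rfl fun i _ => by ring
  have hshift : ∀ p (w : TX (C.ξ p)), M.g (t, C.ξ p) (1, 0) (0, w) = 0 := by
    intro p w
    refine (hK.metric_eq t ht (C.ξ p) (1, 0) (0, w)).trans ?_
    have h0 : ∀ i, comp (0 : TX (C.ξ p)) i = 0 := fun i => rfl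
    simp [h0]
  have hiff : ∀ Q, IsCoarseGrained M C t f Q ↔ Q = toMat A := fun Q => by
    rw [isCoarseGrained_iff hadm hf hshift hind, hsymm, smul_smul]
    norm_num
  have hQ : ∀ y x x', toForm (toMat A) (L x) (L x') = M.localShear t y (0, x) (0, x')
      + M.localExpansion t y / 3 * M.h t y x x' := by
    intro y x x'
    rw [toForm_toMat, hform, hK.localShear_eq ht]
    ring
  refine ⟨L.toLinearMap, c, fun y x x' => ?_, hfU, fun Q => ⟨?_, ?_⟩⟩
  · rw [hK.h_eq ht]
    exact hLin x x'
  · rw [hiff]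
    constructor
    · rintro rfl
      exact hQ
    · intro h
      ext a b
      obtain ⟨x, hx⟩ := hLsurj (bas a)
      obtain ⟨x', hx'⟩ := hLsurj (bas b)
      rw [← toForm_bas Q, ← toForm_bas (toMat A), ← hx, ← hx']
      exact (h 0 x x').trans (hQ 0 x x').symm
  · rw [hiff]
    rintro rfl y x x'
    have hexp : expansion (toMat A) = M.localExpansion t y := by
      rw [expansion, trace_toMat_conj K U hAU, hK.localExpansion_eq ht]
      simp only [Matrix.trace, Matrix.diag, toMat, Matrix.of_apply, hKdef, diagMap_apply]
      simp [bas]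
    refine ⟨hexp, ?_, ?_, hK.localVorticity_eq ht y _ _⟩
    · have hs : shear (toMat A) = toMat A - (M.localExpansion t y / 3) • 1 := by
        rw [shear, hsymm, hexp, smul_smul]
        norm_num
      have hlin : ∀ (Q : Matrix (Fin 3) (Fin 3) ℝ) (r : ℝ) (x y : E3),
          toForm (Q - r • 1) x y = toForm Q x y - r * inner ℝ x y := by
        intro Q r x y
        simp [toForm, inner_eq, Fin.sum_univ_three, Matrix.one_apply]
        ring
      have h1 := hQ y x x'
      have h2 := hLin x x'
      have h3 := hK.h_eq ht y x x'
      rw [hs]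
      change toForm _ (L x) (L x') = _
      rw [hlin, h1, h2, h3]
      ring
    · have h1 : (toMat A).transpose = toMat A := by
        have : (toMat A).transpose = (2 : ℝ) • toMat A - toMat A := by rw [← hsymm]; simp
        rw [this, two_smul]
        simp
      rw [vorticity, h1, sub_self, smul_zero]

end CoarseGraining

end

theorem mainTheorem3 :
    -- FLRW spacetimes
    (∀ (X : Type u) [TopologicalSpace X] [ChartedSpace E3 X] [IsManifold (𝓡 3) ∞ X]
      (M : ComovingSpacetime X) (I : Set ℝ) (k : ℝ) (a : ℝ → ℝ) (C : Domain X) (t : ℝ)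
      (f : S2 → E3),
      IsFLRW M I k a → t ∈ I → IsAdmissible M C t → IsIsometricEmbedding M C t f →
        ∀ Q : Matrix (Fin 3) (Fin 3) ℝ,
          (IsCoarseGrained M C t f Q ↔ Q = (deriv a t / a t) • 1) ∧
          (IsCoarseGrained M C t f Q →
            expansion Q = 3 * (deriv a t / a t) ∧ shear Q = 0 ∧ vorticity Q = 0)) ∧
    -- Kasner spacetimes
    (∀ (M : ComovingSpacetime E3) (κ : Fin 3 → ℝ) (C : Domain E3) (t : ℝ) (f : S2 → E3),
      IsKasner M κ → 0 < t → IsAdmissible M C t → IsIsometricEmbedding M C t f →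
        ∃ (L : E3 →ₗ[ℝ] E3) (c : E3),
          (∀ y x x' : E3, inner ℝ (L x) (L x') = M.h t y x x') ∧
          (∀ p, f p = L (C.ξ p) + c) ∧
          ∀ Q : Matrix (Fin 3) (Fin 3) ℝ,
            (IsCoarseGrained M C t f Q ↔ ∀ y x x' : E3,
              toForm Q (L x) (L x') = M.localShear t y (0, x) (0, x')
                + M.localExpansion t y / 3 * M.h t y x x') ∧
            (IsCoarseGrained M C t f Q → ∀ y x x' : E3,
              expansion Q = M.localExpansion t y ∧
              toForm (shear Q) (L x) (L x') = M.localShear t y (0, x) (0, x') ∧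
              vorticity Q = 0 ∧ M.localVorticity t y (0, x) (0, x') = 0)) ∧
    -- Swiss-cheese models
    (∀ (X₀ : Type u) [TopologicalSpace X₀] [ChartedSpace E3 X₀] [IsManifold (𝓡 3) ∞ X₀]
      (X : Type v) [TopologicalSpace X] [ChartedSpace E3 X] [IsManifold (𝓡 3) ∞ X] (ι : Type w)
      (M₀ : ComovingSpacetime X₀) (I : Set ℝ) (k : ℝ) (a : ℝ → ℝ) (B : ι → Set X₀) (ψ : X₀ → X)
      (M : ComovingSpacetime X) (C : Domain X) (t : ℝ) (f : S2 → E3),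
      IsFLRW M₀ I k a → IsSwissCheese M₀ I B ψ M → t ∈ I →
      range C.ξ ⊆ ψ '' (⋃ i, B i)ᶜ → IsAdmissible M C t → IsIsometricEmbedding M C t f →
        ∀ Q : Matrix (Fin 3) (Fin 3) ℝ,
          (IsCoarseGrained M C t f Q ↔ Q = (deriv a t / a t) • 1) ∧
          (IsCoarseGrained M C t f Q →
            expansion Q = 3 * (deriv a t / a t) ∧ shear Q = 0 ∧ vorticity Q = 0)) := by
  refine ⟨?_, ?_, ?_⟩
  · intro X _ _ _ M I k a C t f hF ht hadm hf Q
    exact isCoarseGrained_iff_of_scaling hadm hf (fun _ w => hF.g_one_zero ht _ w)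
      (hF.differentiableAt ht) hF.isOpen ht (fun _ _ _ => hF.exists_scaling _ _ _) Q
  · intro M κ C t f hK ht hadm hf
    exact hK.coarseGrained ht hadm hf
  · intro X₀ _ _ _ X _ _ _ ι M₀ I k a B ψ M C t f h₀ hS ht hr hadm hf Q
    exact isCoarseGrained_iff_of_scaling hadm hf
      (fun p w => (IsSwissCheese.exists_scaling h₀ hS ht (hr ⟨p, rfl⟩) 0 w).2)
      (h₀.differentiableAt ht) h₀.isOpen ht
      (fun p _ _ => (IsSwissCheese.exists_scaling h₀ hS ht (hr ⟨p, rfl⟩) _ _).1) Q
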